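/- Let $d\ge 1$ and let $\eta:\mathbb R^d\to[0,1]$ be a smooth function with $\eta(x)=1$ for $|x|\le \frac1{16d}$ and $\eta(x)=0$ for $|x|\ge\frac1{8d}$. Write $\mathcal F f(\xi)=\int_{\mathbb R^d}f(x)e^{2\pi i\xi\cdot x}\,dx$ on $\mathbb R^d$ (extended to $L^2$), $\hat f(\xi)=\sum_{x\in\mathbb Z^d}f(x)e^{2\pi i \xi\cdot x}$ for $f\in\ell^1(\mathbb Z^d)$, and $\mathcal F^{-1}h(x)=\int_{[0,1)^d}h(\xi)e^{-2\pi i\xi\cdot x}\,d\xi$ $(x\in\mathbb Z^d)$ for functions $h$ on $\mathbb T^d=\mathbb R^d/\mathbb Z^d$. Let $\rho>0$ and $D=\lfloor 2/\rho\rfloor+1$. For an integer $N\ge1$ put $N_0=\lfloor N^{\rho/2}\rfloor+1$, $Q_0=(N_0!)^D$, and let $\mathbb P_N$ be the set of primes in $(N_0,N]$. Let $\Pi(\mathbb P_N)$ be the set of all products $p_1^{\gamma_1}\cdots p_k^{\gamma_k}$ with $1\le k\le D$, $p_1,\dots,p_k\in\mathbb P_N$ distinct and $\gamma_1,\dots,\gamma_k\in\{1,\dots,D\}$,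 let $$P_N=\{Qw:\ Q\mid Q_0,\ w\in\Pi(\mathbb P_N)\cup\{1\}\},$$ and let $\mathscr U_N\subset\mathbb T^d$ be the set of all $a/q$ with $q\in P_N$, $a\in\{1,\dots,q\}^d$ and $\gcd(q,a_1,\dots,a_d)=1$. Let $\Theta$ be a multiplier on $\mathbb R^d$ such that for every $s\in(1,\infty)$ there is a constant $\mathbf A_s>0$ with $$\big\|\mathcal F^{-1}(\Theta\,\mathcal F f)\big\|_{L^s(\mathbb R^d)}\le \mathbf A_s\|f\|_{L^s(\mathbb R^d)}\qquad\text{for all } f\in L^2(\mathbb R^d)\cap L^s(\mathbb R^d).$$ For $N\ge 1$ and $\varepsilon\in(0,\infty)^d$ with $\varepsilon_j\le e^{-N^{2\rho}}$ for all $j$, let $\eta_N(\xi)=\eta(\varepsilon_1^{-1}\xi_1,\dots,\varepsilon_d^{-1}\xi_d)$ and $$\Delta_N(\xi)=\sum_{a/q\in\mathscr U_N}\Theta(\xi-a/q)\,\eta_N(\xi-a/q),$$ where $\Theta\eta_N$ is regarded as a function on $\mathbb T^d$, that is, replaced by its periodization $\xi\mapsto\sum_{n\in\mathbb Z^d}(\Theta\eta_N)(\xi-n)$.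 Then for every $\rho>0$ and $p\in(1,\infty)$ there is a constant $C_{\rho,p}>0$ (depending only on $\rho$, $p$, and the fixed $d$ and $\eta$; in particular not on $\Theta$, $(\mathbf A_s)$, $N$, $\varepsilon$) such that, for every such $\Theta$, every integer $N\ge2$ and every such $\varepsilon$, the map $f\mapsto\mathcal F^{-1}(\Delta_N\hat f)$, defined on $\ell^1(\mathbb Z^d)$, extends to a bounded operator on $\ell^p(\mathbb Z^d)$ and $$\big\|\mathcal F^{-1}(\Delta_N\hat f)\big\|_{\ell^p(\mathbb Z^d)}\le C_{\rho,p}\,\mathbf A_p\,(\log N)\,\|f\|_{\ell^p(\mathbb Z^d)}\qquad\text{for all } f\in\ell^p(\mathbb Z^d).$$ -/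

import Mathlib

open MeasureTheory FourierTransform
open scoped ENNReal ContDiff Nat

noncomputable section

namespace IonescuWainger

/-! ### The special rationals -/

/-- `D = ⌊2/ρ⌋ + 1`. -/
def bigD (ρ : ℝ) : ℕ := ⌊2 / ρ⌋₊ + 1

/-- `N₀ = ⌊N^{ρ/2}⌋ + 1`. -/
def cutN (ρ : ℝ) (N : ℕ) : ℕ := ⌊(N : ℝ) ^ (ρ / 2)⌋₊ + 1

/-- `Q₀ = (N₀!)^D`. -/
def bigQ (ρ : ℝ) (N : ℕ) : ℕ := (cutN ρ N)! ^ bigD ρ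

/-- The primes in `(N₀, N]`. -/
def primeSet (ρ : ℝ) (N : ℕ) : Set ℕ := {p | p.Prime ∧ cutN ρ N < p ∧ p ≤ N}

/-- The products `p₁^{γ₁} ⋯ p_k^{γ_k}` of powers of `k` distinct elements of `V`,
with exponents between `1` and `D`. -/
def primeProductsOfLength (D k : ℕ) (V : Set ℕ) : Set ℕ :=
  {w | ∃ p γ : Fin k → ℕ, Function.Injective p ∧ (∀ i, p i ∈ V) ∧
    (∀ i, 1 ≤ γ i ∧ γ i ≤ D) ∧ w = ∏ i, p i ^ γ i}

/-- The union of the sets above over `1 ≤ k ≤ D`. -/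
def primeProducts (D : ℕ) (V : Set ℕ) : Set ℕ :=
  {w | ∃ k, 1 ≤ k ∧ k ≤ D ∧ w ∈ primeProductsOfLength D k V}

/-- The denominators `P_N`: the integers `Q * w` with `Q ∣ Q₀` and
`w` in `Π(ℙ_N) ∪ {1}`. -/
def denominators (ρ : ℝ) (N : ℕ) : Set ℕ :=
  {q | ∃ Q w : ℕ, Q ∣ bigQ ρ N ∧ w ∈ primeProducts (bigD ρ) (primeSet ρ N) ∪ {1} ∧ q = Q * w}

/-- The fractions `a/q` with `a ∈ {1, …, q}^d`, `gcd(q, a₁, …, a_d) = 1` and `q ∈ S`.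
They are points of the torus `ℝ^d / ℤ^d`, each represented by its unique
representative in `(0, 1]^d`. -/
def reducedFractions (d : ℕ) (S : Set ℕ) : Set (EuclideanSpace ℝ (Fin d)) :=
  {u | ∃ (q : ℕ) (a : Fin d → ℕ), q ∈ S ∧ (∀ i, 1 ≤ a i ∧ a i ≤ q) ∧
    Nat.gcd q (Finset.univ.gcd a) = 1 ∧ u = WithLp.toLp 2 (fun i => (a i : ℝ) / (q : ℝ))}

/-- The set `𝒰_N` of special rationals. -/
def specialRationals (d : ℕ) (ρ : ℝ) (N : ℕ) : Set (EuclideanSpace ℝ (Fin d)) :=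
  reducedFractions d (denominators ρ N)

theorem finite_denominators (ρ : ℝ) (N : ℕ) : (denominators ρ N).Finite := by
  refine (Set.finite_Iic (bigQ ρ N * (N + 1) ^ (bigD ρ * bigD ρ))).subset ?_
  rintro q ⟨Q, w, hQ, hw, rfl⟩
  have hQ' : Q ≤ bigQ ρ N :=
    Nat.le_of_dvd (pow_pos (Nat.factorial_pos _) _) hQ
  refine Nat.mul_le_mul hQ' ?_
  rcases hw with ⟨k, -, hk, p, γ, -, hp, hγ, rfl⟩ | hw
  · calc ∏ i, p i ^ γ i ≤ ∏ _i : Fin k, (N + 1) ^ bigD ρ := by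
          refine Finset.prod_le_prod' fun i _ => ?_
          exact (Nat.pow_le_pow_left ((hp i).2.2.trans (Nat.le_succ N)) _).trans
            (Nat.pow_le_pow_right (Nat.succ_pos N) (hγ i).2)
      _ = (N + 1) ^ (bigD ρ * k) := by simp [pow_mul]
      _ ≤ _ := Nat.pow_le_pow_right (Nat.succ_pos N) (Nat.mul_le_mul_left _ hk)
  · rw [Set.mem_singleton_iff] at hw
    rw [hw]
    exact Nat.one_le_pow _ _ (Nat.succ_pos N)

theorem finite_specialRationals (d : ℕ) (ρ : ℝ) (N : ℕ) :
    (specialRationals d ρ N).Finite := by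
  have h : (⋃ q ∈ denominators ρ N, (fun a : Fin d → ℕ =>
      (WithLp.toLp 2 (fun i => (a i : ℝ) / (q : ℝ)) : EuclideanSpace ℝ (Fin d))) ''
        (Set.Iic (fun _ => q))).Finite :=
    (finite_denominators ρ N).biUnion fun q _ => (Set.finite_Iic _).image _
  refine h.subset ?_
  rintro u ⟨q, a, hq, ha, -, rfl⟩
  simp only [Set.mem_iUnion]
  exact ⟨q, hq, a, fun i => (ha i).2, rfl⟩

/-! ### Multipliers on `ℝ^d`

The Fourier transform here is `ℱ f(ξ) = ∫ f(x) e^{2πi ξ·x} dx`, which on `L²` is the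
operator that Mathlib writes `𝓕⁻`; its inverse is `𝓕`. -/

/-- For every `f ∈ L² ∩ L^p` the function `g = ℱ⁻¹(Θ ℱ f)` exists in `L²`
(it is unique, by Plancherel) and `‖g‖_{L^p} ≤ A ‖f‖_{L^p}`. -/
def IsMultiplierBound {d : ℕ} (Θ : EuclideanSpace ℝ (Fin d) → ℂ) (p : ℝ≥0∞) (A : ℝ) : Prop :=
  ∀ f : Lp ℂ 2 (volume : Measure (EuclideanSpace ℝ (Fin d))), MemLp f p volume →
    ∃ g : Lp ℂ 2 (volume : Measure (EuclideanSpace ℝ (Fin d))),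
      (∀ᵐ ξ, (𝓕⁻ g) ξ = Θ ξ * (𝓕⁻ f) ξ) ∧
      eLpNorm g p volume ≤ ENNReal.ofReal A * eLpNorm f p volume

/-! ### The periodic multipliers -/

/-- `η` is a smooth cutoff with values in `[0, 1]`, equal to `1` for `|x| ≤ 1/(16d)` and to
`0` for `|x| ≥ 1/(8d)`. -/
structure IsCutoff {d : ℕ} (η : EuclideanSpace ℝ (Fin d) → ℝ) : Prop where
  smooth : ContDiff ℝ ∞ η
  nonneg : ∀ x, 0 ≤ η x
  le_one : ∀ x, η x ≤ 1
  eq_one : ∀ x, ‖x‖ ≤ 1 / (16 * (d : ℝ)) → η x = 1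
  eq_zero : ∀ x, 1 / (8 * (d : ℝ)) ≤ ‖x‖ → η x = 0

/-- `η(ℰ⁻¹ ξ)`, where `ℰ` is the diagonal matrix with entries `ε`. -/
def scaledCutoff {d : ℕ} (η : EuclideanSpace ℝ (Fin d) → ℝ) (ε : Fin d → ℝ)
    (ξ : EuclideanSpace ℝ (Fin d)) : ℝ :=
  η (WithLp.toLp 2 fun i => (ε i)⁻¹ * ξ i)

/-- An integer vector as a point of `ℝ^d`. -/
def latticePoint {d : ℕ} (n : Fin d → ℤ) : EuclideanSpace ℝ (Fin d) :=
  WithLp.toLp 2 fun i => (n i : ℝ)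

/-- `Δ_N(ξ) = ∑_{a/q ∈ 𝒰_N} Θ(ξ - a/q) η_N(ξ - a/q)` as a function on `ℝ^d / ℤ^d`: the compactly
supported function `Θ η_N` is made periodic by summing it over `ℤ^d` (only finitely many
terms are nonzero at each point). -/
def periodicMultiplier {d : ℕ} (ρ : ℝ) (N : ℕ) (Θ : EuclideanSpace ℝ (Fin d) → ℂ)
    (η : EuclideanSpace ℝ (Fin d) → ℝ) (ε : Fin d → ℝ) (ξ : EuclideanSpace ℝ (Fin d)) : ℂ :=
  ∑ u ∈ (finite_specialRationals d ρ N).toFinset, ∑' n : Fin d → ℤ,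
    Θ (ξ - u - latticePoint n) * (scaledCutoff η ε (ξ - u - latticePoint n) : ℂ)

/-! ### Fourier analysis on `ℤ^d` -/

/-- `f̂(ξ) = ∑_{x ∈ ℤ^d} f(x) e^{2πi ξ·x}`. -/
def discreteFourier {d : ℕ} (f : (Fin d → ℤ) → ℂ) (ξ : EuclideanSpace ℝ (Fin d)) : ℂ :=
  ∑' x : Fin d → ℤ, f x * Complex.exp (2 * Real.pi * Complex.I * (∑ i, ξ i * (x i : ℝ) : ℝ))

/-- The inverse transform on the torus `[0, 1)^d`:
`ℱ⁻¹ h(x) = ∫_{[0,1)^d} h(ξ) e^{-2πi ξ·x} dξ`. -/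
def torusFourierInv {d : ℕ} (h : EuclideanSpace ℝ (Fin d) → ℂ) (x : Fin d → ℤ) : ℂ :=
  ∫ ξ in {ξ : EuclideanSpace ℝ (Fin d) | ∀ i, ξ i ∈ Set.Ico (0 : ℝ) 1},
    h ξ * Complex.exp (-(2 * Real.pi * Complex.I * (∑ i, ξ i * (x i : ℝ) : ℝ)))

end IonescuWainger

end

/-!
The proof transfers the problem to a finite product space, where the sum over the special rationals
becomes a projection.

Let `p₁, …, p_n` be the primes in `(N₀, N]`. A rational vector is special exactly when it has the
form `a / (Q₀ p₁^D ⋯ p_n^D)` with at most `D` of the prime powers `p_i^D` not dividing `a`. Hence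
the exponential sum `∑_u e(u · z)` over the special rationals vanishes unless `Q₀ ∣ z`, and then it
is `Q₀^d` times the kernel, at the residues of `z` modulo the `p_i^D`, of the orthogonal projection
of functions on `∏ i, (ℤ/p_i^D)^d` onto the sums of functions of at most `D` coordinates
(`sum_ch_specialRationals`). Call this projection, composed with a smooth average over a residue
class modulo `Q₀`, the low part of a function on `ℤ^d`; it is a family of functions on the product
space, indexed by lattice points and residues modulo `Q₀`. The average is taken with a kernel `φ` at
scale `1/ε`, whose Fourier transform `χ` has compact support and does not vanish on the support of
`η`. As `η = (η/χ²) χ²` and the projection is idempotent, the pairing of the operator with two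
functions `f` and `g` is an average over the residues: the convolution operator with multiplier
`Θ · η/χ²`, which is bounded on `ℓ^p` by transference from `ℝ^d` (`exists_transfer_bound`), acts on
the low part of `f` and is paired with the low part of `g` (`exists_pairing_bound`). It remains to
bound low parts on `ℓ^p`, uniformly in the number of primes (`exists_lowPart_bound`).

For an even exponent `2r`, a hypercontractive inequality (`expect_norm_sum_pow_le`) dominates the
`2r`-th moment of a sum of components, each depending on at most `D` coordinates with mean zero in
each, by the moments of square functions: for a set `S` of coordinates, these collect the components
at the sets containing `S` and average their squares over the coordinates outside `S`. Bessel's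
inequality (`squareFun_sq_le`) bounds them on `ℓ²` and on `ℓ^∞`, and Marcinkiewicz interpolation gives
the exponent `2r`, with constants depending only on `r` and `D`. For the dual exponent one passes to the adjoint. There
the residues of one lattice point take the place of independent uniform variables, and in a `2r`-th
moment of functions of at most `D` coordinates this makes no difference
(`UniformFamily.tsum_norm_pow_eq`): only `2rD` coordinates occur at a time, and by Poisson summation
a band-limited weight is exactly equidistributed modulo an integer smaller than the inverse of its
band. Here the integer is at most `Q₀` times `2rD` prime powers `p_i^D ≤ N^D`, and
`ε ≤ exp (-N^{2ρ})` is smaller than its inverse once `N` is large (`exists_bigQ_mul_le`). For the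
remaining `N` the number of special rationals is bounded and the triangle inequality suffices.

Finally, bounds for the pairings over finite sets give an operator on `ℓ^p` (`exists_lp_operator`),
which on `ℓ¹` is the operator of the theorem (`torusFourierInv_periodicMultiplier_mul`). The bound
obtained is uniform in `N`; the factor `log N` is only used through `log N ≥ log 2`.
-/

namespace IonescuWainger

open scoped BigOperators SchwartzMap

/-! ### A hypercontractive inequality on product spaces -/

/-- The scalar inequality behind the one-variable estimate, for `s = ‖a‖`, `t = ‖x‖` and `σ = ⟪a, x⟫`:
the power `‖a + δ x‖ ^ (2k + 2)` exceeds its expansion to first order by at most an error of second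
order in `δ`. The linear term vanishes when averaged over a vector of mean zero. -/
theorem pow_perturbation_aux (k : ℕ) : ∃ B : ℝ, 0 ≤ B ∧ ∀ δ s t σ : ℝ, 0 ≤ δ → δ ≤ 1 → 0 ≤ s →
    0 ≤ t → |σ| ≤ s * t →
    (s ^ 2 + 2 * δ * σ + δ ^ 2 * t ^ 2) ^ (k + 1) ≤
      s ^ (2 * k + 2) + 2 * (k + 1) * δ * s ^ (2 * k) * σ +
        B * δ ^ 2 * (s ^ (2 * k) * t ^ 2 + t ^ (2 * k + 2)) := by
  induction k with
  | zero =>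
    refine ⟨1, zero_le_one, fun δ s t σ _ _ _ _ _ => ?_⟩
    have : 0 ≤ δ ^ 2 * t ^ 2 := by positivity
    simp
    nlinarith
  | succ k ih =>
    obtain ⟨B, hB, ih⟩ := ih
    refine ⟨8 * B + 6 * k + 7, by positivity, fun δ s t σ h0 h1 hs ht hσ => ?_⟩
    have hσ' := abs_le.1 hσ
    set Y := s ^ 2 + 2 * δ * σ + δ ^ 2 * t ^ 2 with hY
    have hY0 : 0 ≤ Y := by nlinarith [sq_nonneg (s - δ * t), mul_nonneg h0 (by linarith : 0 ≤ σ + s * t)]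
    have hδt : δ * t ≤ t := mul_le_of_le_one_left ht h1
    have hδt0 : 0 ≤ δ * t := mul_nonneg h0 ht
    have hY1 : Y ≤ 2 * (s ^ 2 + t ^ 2) := by
      have h2 : δ * σ ≤ δ * (s * t) := mul_le_mul_of_nonneg_left hσ'.2 h0
      nlinarith [sq_nonneg (s - δ * t), mul_self_nonneg (t - δ * t), mul_le_mul hδt hδt hδt0 ht]
    have key := mul_le_mul_of_nonneg_right (ih δ s t σ h0 h1 hs ht hσ) hY0
    rw [← pow_succ] at key
    refine key.trans ?_
    set a := s ^ (2 * k) with ha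
    have ha0 : 0 ≤ a := by positivity
    set b := t ^ (2 * k) with hb
    have hb0 : 0 ≤ b := by positivity
    have e1 : s ^ (2 * k + 2) = a * s ^ 2 := by rw [pow_add]
    have e2 : t ^ (2 * k + 2) = b * t ^ 2 := by rw [pow_add]
    have e3 : s ^ (2 * (k + 1) + 2) = a * s ^ 4 := by rw [ha, ← pow_add]; ring_nf
    have e4 : t ^ (2 * (k + 1) + 2) = b * t ^ 4 := by rw [hb, ← pow_add]; ring_nf
    have e5 : s ^ (2 * (k + 1)) = a * s ^ 2 := by rw [ha, ← pow_add]; ring_nf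
    rw [e1, e2, e3, e4, e5]
    -- every mixed monomial of degree `2k + 4` and of degree at least `2` in `t`
    -- is at most the sum `E` of the two extreme ones
    set E := a * s ^ 2 * t ^ 2 + b * t ^ 4 with hE
    have m1 : a * s * t ^ 3 ≤ E ∧ a * t ^ 4 ≤ E ∧ b * s ^ 2 * t ^ 2 ≤ E := by
      rcases le_total t s with h | h
      · have hba : b ≤ a := pow_le_pow_left₀ ht h _
        have q1 : t ^ 2 ≤ s ^ 2 := pow_le_pow_left₀ ht h _
        have hbt : 0 ≤ b * t ^ 4 := by positivity
        refine ⟨?_, ?_, ?_⟩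
        · have : a * s * t ^ 2 * t ≤ a * s * t ^ 2 * s := mul_le_mul_of_nonneg_left h (by positivity)
          linarith
        · have : a * t ^ 2 * t ^ 2 ≤ a * t ^ 2 * s ^ 2 :=
            mul_le_mul_of_nonneg_left q1 (by positivity)
          linarith
        · have : b * (s ^ 2 * t ^ 2) ≤ a * (s ^ 2 * t ^ 2) :=
            mul_le_mul_of_nonneg_right hba (by positivity)
          linarith
      · have hab : a ≤ b := pow_le_pow_left₀ hs h _
        have q1 : s ^ 2 ≤ t ^ 2 := pow_le_pow_left₀ hs h _
        have hat : 0 ≤ a * s ^ 2 * t ^ 2 := by positivity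
        refine ⟨?_, ?_, ?_⟩
        · have : a * s * t ^ 3 ≤ b * t * t ^ 3 := by gcongr
          linarith
        · have : a * t ^ 4 ≤ b * t ^ 4 := by gcongr
          linarith
        · have : b * s ^ 2 * t ^ 2 ≤ b * t ^ 2 * t ^ 2 := by gcongr
          linarith
    have m4 : a * s ^ 2 * t ^ 2 ≤ E ∧ b * t ^ 4 ≤ E :=
      ⟨le_add_of_nonneg_right (by positivity), le_add_of_nonneg_left (by positivity)⟩
    have hσ2 : σ ^ 2 ≤ s ^ 2 * t ^ 2 := by
      rw [← mul_pow, ← sq_abs σ]; exact pow_le_pow_left₀ (abs_nonneg _) hσ _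
    have hd2 : (0 : ℝ) ≤ δ ^ 2 := sq_nonneg _
    have p1 : a * s ^ 2 * (δ ^ 2 * t ^ 2) ≤ δ ^ 2 * E := by
      have := mul_le_mul_of_nonneg_left m4.1 hd2
      linarith
    have p2 : a * δ ^ 2 * σ ^ 2 ≤ δ ^ 2 * E := by
      have := mul_le_mul_of_nonneg_left hσ2 (mul_nonneg ha0 hd2)
      linarith
    have p3 : δ ^ 3 * a * σ * t ^ 2 ≤ δ ^ 2 * E := by
      have h3 : δ ^ 3 ≤ δ ^ 2 := pow_le_pow_of_le_one h0 h1 (by norm_num)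
      calc δ ^ 3 * a * σ * t ^ 2 ≤ δ ^ 3 * a * (s * t) * t ^ 2 := by
            have := hσ'.2
            gcongr
        _ = δ ^ 3 * (a * s * t ^ 3) := by ring
        _ ≤ δ ^ 2 * E := mul_le_mul h3 m1.1 (by positivity) hd2
    have p4 : B * δ ^ 2 * (a * t ^ 2 + b * t ^ 2) * Y ≤ 8 * B * (δ ^ 2 * E) := by
      have : (a * t ^ 2 + b * t ^ 2) * Y ≤ 8 * E := by
        calc (a * t ^ 2 + b * t ^ 2) * Y ≤ (a * t ^ 2 + b * t ^ 2) * (2 * (s ^ 2 + t ^ 2)) :=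
              mul_le_mul_of_nonneg_left hY1 (by positivity)
          _ ≤ 8 * E := by linarith [m1.2.1, m1.2.2, m4.1, m4.2]
      have h8 := mul_le_mul_of_nonneg_left this (mul_nonneg hB hd2)
      linarith
    have hk : (0 : ℝ) ≤ k := Nat.cast_nonneg k
    have p2' := mul_le_mul_of_nonneg_left p2 (by positivity : (0 : ℝ) ≤ 4 * (k + 1))
    have p3' := mul_le_mul_of_nonneg_left p3 (by positivity : (0 : ℝ) ≤ 2 * (k + 1))
    clear_value Y E a b
    push_cast
    subst hY
    linarith [p1, p2', p3', p4]

/-- Pointwise form of the one-variable inequality: to first order in `x` the left side is the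
inner product term, which averages to zero when `x` has mean zero. -/
theorem exists_norm_add_smul_pow_le (r : ℕ) (hr : 1 ≤ r) : ∃ δ : ℝ, 0 < δ ∧ δ ≤ 1 ∧
    ∀ (H : Type) [NormedAddCommGroup H] [InnerProductSpace ℝ H] (a x : H),
      ‖a + δ • x‖ ^ (2 * r) ≤ ‖a‖ ^ (2 * r) + 2 * r * δ * ‖a‖ ^ (2 * (r - 1)) * inner ℝ a x +
        ‖a‖ ^ (2 * (r - 1)) * ‖x‖ ^ 2 + ‖x‖ ^ (2 * r) := by
  obtain ⟨k, rfl⟩ : ∃ k, r = k + 1 := ⟨r - 1, by omega⟩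
  obtain ⟨B, hB, h⟩ := pow_perturbation_aux k
  refine ⟨(1 + B)⁻¹, by positivity, inv_le_one_of_one_le₀ (by linarith), fun H _ _ a x => ?_⟩
  set δ := (1 + B)⁻¹
  have h0 : 0 < δ := by positivity
  have h1 : δ ≤ 1 := inv_le_one_of_one_le₀ (by linarith)
  have hBδ : B * δ ^ 2 ≤ 1 := by
    have : (1 + B) * δ = 1 := mul_inv_cancel₀ (by positivity)
    nlinarith
  have e : ‖a + δ • x‖ ^ 2 = ‖a‖ ^ 2 + 2 * δ * inner ℝ a x + δ ^ 2 * ‖x‖ ^ 2 := by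
    rw [norm_add_sq_real, inner_smul_right, norm_smul, mul_pow, Real.norm_eq_abs, sq_abs]; ring
  have := h δ ‖a‖ ‖x‖ (inner ℝ a x) h0.le h1 (norm_nonneg _) (norm_nonneg _)
    (abs_real_inner_le_norm a x)
  rw [pow_mul, e]
  refine this.trans ?_
  have hq : 0 ≤ ‖a‖ ^ (2 * k) * ‖x‖ ^ 2 + ‖x‖ ^ (2 * k + 2) := by positivity
  have := mul_le_mul_of_nonneg_right hBδ hq
  simp only [Nat.add_sub_cancel, Nat.cast_add, Nat.cast_one, mul_add, mul_one] at *
  nlinarith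

/-- The one-variable inequality, averaged over a vector `X` of mean zero. -/
def OneVariable (r : ℕ) (δ : ℝ) : Prop :=
  ∀ (H : Type) [NormedAddCommGroup H] [InnerProductSpace ℝ H] (G : Type) [Fintype G] [Nonempty G]
    (a : H) (X : G → H), ∑ g, X g = 0 →
      𝔼 g, ‖a + δ • X g‖ ^ (2 * r) ≤ (‖a‖ ^ 2 + 𝔼 g, ‖X g‖ ^ 2) ^ r + 𝔼 g, ‖X g‖ ^ (2 * r)

/-- For small `δ` the error of second order is absorbed by the right side. -/
theorem exists_oneVariable (r : ℕ) (hr : 1 ≤ r) :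
    ∃ δ : ℝ, 0 < δ ∧ δ ≤ 1 ∧ OneVariable r δ := by
  obtain ⟨δ, h0, h1, h⟩ := exists_norm_add_smul_pow_le r hr
  refine ⟨δ, h0, h1, fun H _ _ G _ _ a X hX => ?_⟩
  have step := Finset.expect_le_expect (s := Finset.univ) (fun g _ => h H a (X g))
  refine step.trans ?_
  have hin : 𝔼 g, inner ℝ a (X g) = 0 := by
    rw [Fintype.expect_eq_sum_div_card, ← inner_sum, hX, inner_zero_right, zero_div]
  simp only [Finset.expect_add_distrib, ← Finset.mul_expect, hin, Fintype.expect_const, mul_zero,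
    add_zero]
  have hT : 0 ≤ 𝔼 g, ‖X g‖ ^ 2 := Finset.expect_nonneg fun _ _ => by positivity
  obtain ⟨k, rfl⟩ : ∃ k, r = k + 1 := ⟨r - 1, by omega⟩
  have : (‖a‖ ^ 2) ^ k * (‖a‖ ^ 2 + 𝔼 g, ‖X g‖ ^ 2) ≤ (‖a‖ ^ 2 + 𝔼 g, ‖X g‖ ^ 2) ^ (k + 1) := by
    rw [pow_succ]
    have : (‖a‖ ^ 2) ^ k ≤ (‖a‖ ^ 2 + 𝔼 g, ‖X g‖ ^ 2) ^ k :=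
      pow_le_pow_left₀ (by positivity) (by linarith) _
    exact mul_le_mul_of_nonneg_right this (by positivity)
  rw [← pow_mul] at this
  have e : ‖a‖ ^ (2 * (k + 1)) = ‖a‖ ^ (2 * k) * ‖a‖ ^ 2 := by rw [← pow_add]; ring_nf
  simp only [Nat.add_sub_cancel]
  rw [e]
  nlinarith

/-- The point with the coordinates of `c` where `S` holds and those of `c'` elsewhere. Subsets of
`Fin n` are encoded by their indicator functions. -/
def mix {n : ℕ} {G : Fin n → Type} (S : Fin n → Bool) (c c' : ∀ i, G i) : ∀ i, G i :=
  fun i => if S i then c i else c' i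

instance decidableLEBool {n : ℕ} (S A : Fin n → Bool) : Decidable (S ≤ A) :=
  inferInstanceAs (Decidable (∀ i, S i ≤ A i))

theorem mix_cons {n : ℕ} {G : Fin (n + 1) → Type} (b : Bool) (S : Fin n → Bool) (g g' : G 0)
    (c c' : ∀ i : Fin n, G i.succ) :
    mix (Fin.cons b S) (Fin.cons g c : ∀ i, G i) (Fin.cons g' c') =
      Fin.cons (if b then g else g') (mix S c c') := by
  funext i
  refine Fin.cases ?_ (fun j => ?_) i <;> simp [mix]

theorem sum_cons_bool {n : ℕ} {M : Type*} [AddCommMonoid M] (f : (Fin (n + 1) → Bool) → M) :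
    ∑ A, f A = ∑ A : Fin n → Bool, (f (Fin.cons false A) + f (Fin.cons true A)) := by
  rw [← (Fin.consEquiv fun _ => Bool).sum_comp, Fintype.sum_prod_type, Finset.sum_add_distrib]
  simp [Fin.consEquiv, add_comm]

theorem expect_cons {n : ℕ} {G : Fin (n + 1) → Type} [∀ i, Fintype (G i)]
    (f : (∀ i, G i) → ℝ) :
    𝔼 c, f c = 𝔼 g, 𝔼 c : ∀ i : Fin n, G i.succ, f (Fin.cons g c) := by
  rw [← Finset.expect_product', Finset.univ_product_univ]
  exact (Fintype.expect_equiv (Fin.consEquiv G) _ _ fun _ => rfl).symm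

theorem cons_le_cons_bool {n : ℕ} (a b : Bool) (S A : Fin n → Bool) :
    (Fin.cons a S : Fin (n + 1) → Bool) ≤ Fin.cons b A ↔ a ≤ b ∧ S ≤ A := Fin.cons_le_cons

/-- The number of elements of the set with indicator function `A`. -/
def wt {n : ℕ} (A : Fin n → Bool) : ℕ := ∑ i, (A i).toNat

theorem wt_cons {n : ℕ} (b : Bool) (A : Fin n → Bool) :
    wt (Fin.cons b A : Fin (n + 1) → Bool) = b.toNat + wt A := by
  simp [wt, Fin.sum_univ_succ]

/-- A hypercontractive inequality for functions on a finite product space, given through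
components `X A` that depend on the coordinates in `A` and have mean zero in each of them.
By induction on the number of coordinates, the vectors at one step being pairs of a vector
and a square integrable function of the next coordinate. -/
theorem expect_norm_sum_pow_le {r : ℕ} {δ : ℝ} (hδ : OneVariable r δ) (n : ℕ) :
    ∀ (G : Fin n → Type) [∀ i, Fintype (G i)] [∀ i, Nonempty (G i)]
      (H : Type) [NormedAddCommGroup H] [InnerProductSpace ℝ H]
      (X : (Fin n → Bool) → (∀ i, G i) → H),
      (∀ A i, A i = false → ∀ c g, X A (Function.update c i g) = X A c) →
      (∀ A i, A i = true → ∀ c, ∑ g, X A (Function.update c i g) = 0) →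
      𝔼 c, ‖∑ A, δ ^ wt A • X A c‖ ^ (2 * r) ≤
        ∑ S, 𝔼 c, (∑ A with S ≤ A, 𝔼 c', ‖X A (mix S c c')‖ ^ 2) ^ r := by
  induction n with
  | zero =>
    intro G _ _ H _ _ X _ _
    simp only [Fintype.sum_unique, Fintype.expect_eq_sum_div_card]
    simp [wt, pow_mul, Finset.filter_true_of_mem, Subsingleton.elim (mix _ _ _) default]
  | succ n ih =>
    intro G _ _ H _ _ X hdep hmean
    -- the value at a fixed first coordinate where the components do not depend on it
    obtain ⟨g₀⟩ : Nonempty (G 0) := inferInstance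
    have hdep0 : ∀ A g g' c, X (Fin.cons false A) (Fin.cons g c) =
        X (Fin.cons false A) (Fin.cons g' c) := fun A g g' c => by
      have := hdep (Fin.cons false A) 0 rfl (Fin.cons g' c) g
      rwa [Fin.update_cons_zero] at this
    have hmean0 : ∀ A c, ∑ g, X (Fin.cons true A) (Fin.cons g c) = 0 := fun A c => by
      have := hmean (Fin.cons true A) 0 rfl (Fin.cons g₀ c)
      simpa only [Fin.update_cons_zero] using this
    set N := (Fintype.card (G 0) : ℝ) with hN
    have hN0 : 0 < N := by rw [hN]; exact_mod_cast Fintype.card_pos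
    set s := (Real.sqrt N)⁻¹ with hs
    have hs2 : s ^ 2 = N⁻¹ := by rw [hs, inv_pow, Real.sq_sqrt hN0.le]
    let X' : (Fin n → Bool) → (∀ i : Fin n, G i.succ) → WithLp 2 (H × PiLp 2 fun _ : G 0 => H) :=
      fun A c => WithLp.toLp 2 (X (Fin.cons false A) (Fin.cons g₀ c),
        WithLp.toLp 2 fun g => s • X (Fin.cons true A) (Fin.cons g c))
    have hX' : ∀ a : H, ∀ b : G 0 → H, ‖(WithLp.toLp 2 (a, WithLp.toLp 2 fun g => s • b g) :
        WithLp 2 (H × PiLp 2 fun _ : G 0 => H))‖ ^ 2 = ‖a‖ ^ 2 + 𝔼 g, ‖b g‖ ^ 2 := fun a b => by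
      rw [WithLp.prod_norm_sq_eq_of_L2, PiLp.norm_sq_eq_of_L2, Fintype.expect_eq_sum_div_card,
        div_eq_inv_mul, Finset.mul_sum]
      simp [norm_smul, mul_pow, hs2, ← hN]
    have ih1 := ih (fun i => G i.succ) (WithLp 2 (H × PiLp 2 fun _ : G 0 => H)) X'
      (fun A i hA c g => by
        simp only [X', Fin.cons_update]
        rw [hdep (Fin.cons false A) i.succ (by simpa using hA)]
        simp only [hdep (Fin.cons true A) i.succ (by simpa using hA)])
      (fun A i hA c => by
        have e1 := hmean (Fin.cons false A) i.succ (by simpa using hA) (Fin.cons g₀ c)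
        have e2 : ∀ g, ∑ x, s • X (Fin.cons true A) (Fin.cons g (Function.update c i x)) = 0 :=
          fun g => by
          rw [← Finset.smul_sum]
          simp only [Fin.cons_update, hmean (Fin.cons true A) i.succ (by simpa using hA),
            smul_zero]
        refine WithLp.ofLp_injective 2 (Prod.ext ?_ (PiLp.ext fun g => ?_))
        · simpa [X', WithLp.ofLp_sum, Prod.fst_sum, Fin.cons_update] using e1
        · simpa [X', WithLp.ofLp_sum, Prod.snd_sum] using e2 g)
    have ih2 : ∀ g, _ := fun g => ih (fun i => G i.succ) H
      (fun A c => X (Fin.cons true A) (Fin.cons g c))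
      (fun A i hA c x => by
        simp only [Fin.cons_update]
        exact hdep (Fin.cons true A) i.succ (by simpa using hA) _ _)
      (fun A i hA c => by
        simp only [Fin.cons_update]
        exact hmean (Fin.cons true A) i.succ (by simpa using hA) _)
    let a : (∀ i : Fin n, G i.succ) → H := fun c =>
      ∑ A, δ ^ wt A • X (Fin.cons false A) (Fin.cons g₀ c)
    let x : G 0 → (∀ i : Fin n, G i.succ) → H := fun g c =>
      ∑ A, δ ^ wt A • X (Fin.cons true A) (Fin.cons g c)
    have hsplit : ∀ g c, ∑ A, δ ^ wt A • X A (Fin.cons g c) = a c + δ • x g c := fun g c => by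
      rw [sum_cons_bool, Finset.sum_add_distrib, Finset.smul_sum]
      congr 1
      · exact Finset.sum_congr rfl fun A _ => by rw [wt_cons, hdep0 A g g₀]; simp
      · refine Finset.sum_congr rfl fun A _ => ?_
        rw [wt_cons, smul_smul, pow_add]; simp
    have hnorm : ∀ c, ‖∑ A, δ ^ wt A • X' A c‖ ^ 2 = ‖a c‖ ^ 2 + 𝔼 g, ‖x g c‖ ^ 2 := fun c => by
      rw [← hX']
      congr 2
      refine WithLp.ofLp_injective 2 (Prod.ext ?_ (PiLp.ext fun g => ?_))
      · simp [X', a, WithLp.ofLp_sum, Prod.fst_sum]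
      · simp only [X', x, WithLp.ofLp_sum, Prod.snd_sum, WithLp.ofLp_smul, Prod.smul_snd,
          Finset.smul_sum, Finset.sum_apply, Pi.smul_apply]
        exact Finset.sum_congr rfl fun A _ => smul_comm _ _ _
    have hxmean : ∀ c, ∑ g, x g c = 0 := fun c => by
      simp only [x]
      rw [Finset.sum_comm]
      refine Finset.sum_eq_zero fun A _ => ?_
      rw [← Finset.smul_sum, hmean0, smul_zero]
    rw [expect_cons]
    calc 𝔼 g, 𝔼 c, ‖∑ A, δ ^ wt A • X A (Fin.cons g c)‖ ^ (2 * r)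
        = 𝔼 c, 𝔼 g, ‖a c + δ • x g c‖ ^ (2 * r) := by
          rw [Finset.expect_comm]; simp only [hsplit]
      _ ≤ 𝔼 c, (‖∑ A, δ ^ wt A • X' A c‖ ^ (2 * r) + 𝔼 g, ‖x g c‖ ^ (2 * r)) := by
          refine Finset.expect_le_expect fun c _ => ?_
          rw [pow_mul ‖∑ A, δ ^ wt A • X' A c‖, hnorm]
          exact hδ H (G 0) (a c) (fun g => x g c) (hxmean c)
      _ = 𝔼 c, ‖∑ A, δ ^ wt A • X' A c‖ ^ (2 * r) + 𝔼 g, 𝔼 c, ‖x g c‖ ^ (2 * r) := by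
          rw [Finset.expect_add_distrib, Finset.expect_comm (f := fun c g => ‖x g c‖ ^ (2 * r))]
      _ ≤ _ := by
          refine (add_le_add ih1 (Finset.expect_le_expect fun g _ => ih2 g)).trans ?_
          rw [Finset.expect_sum_comm, ← Finset.sum_add_distrib, sum_cons_bool]
          refine Finset.sum_le_sum fun S _ => le_of_eq ?_
          have filt : ∀ (b : Bool) (f : (Fin (n + 1) → Bool) → ℝ),
              ∑ A with (Fin.cons b S : Fin (n + 1) → Bool) ≤ A, f A =
              ∑ A with S ≤ A, ((if b then 0 else f (Fin.cons false A)) + f (Fin.cons true A)) := by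
            intro b f
            rw [Finset.sum_filter, sum_cons_bool, Finset.sum_filter]
            refine Finset.sum_congr rfl fun A _ => ?_
            cases b <;> by_cases h : S ≤ A <;> simp [cons_le_cons_bool, h]
          congr 1
          · rw [expect_cons, Finset.expect_comm]
            refine Finset.expect_congr rfl fun c _ => ?_
            rw [← Fintype.expect_const (ι := G 0)
              ((∑ A with S ≤ A, 𝔼 c', ‖X' A (mix S c c')‖ ^ 2) ^ r)]
            refine Finset.expect_congr rfl fun g _ => ?_
            rw [filt]
            congr 1
            refine Finset.sum_congr rfl fun A _ => ?_
            rw [expect_cons, expect_cons]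
            simp only [mix_cons, Bool.false_eq_true, if_false]
            have : ∀ c', ‖X' A (mix S c c')‖ ^ 2 =
                ‖X (Fin.cons false A) (Fin.cons g₀ (mix S c c'))‖ ^ 2 +
                  𝔼 g, ‖X (Fin.cons true A) (Fin.cons g (mix S c c'))‖ ^ 2 := fun c' => hX' _ _
            simp only [this, Finset.expect_add_distrib]
            rw [Finset.expect_comm (f := fun c' g =>
              ‖X (Fin.cons true A) (Fin.cons g (mix S c c'))‖ ^ 2)]
            congr 1
            rw [← Fintype.expect_const (ι := G 0)
              (𝔼 c', ‖X (Fin.cons false A) (Fin.cons g₀ (mix S c c'))‖ ^ 2)]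
            refine Finset.expect_congr rfl fun g _ => ?_
            simp only [hdep0 A g g₀]
          · rw [expect_cons]
            refine Finset.expect_congr rfl fun g _ => Finset.expect_congr rfl fun c _ => ?_
            rw [filt]
            congr 1
            refine Finset.sum_congr rfl fun A _ => ?_
            simp only [if_true, zero_add]
            rw [expect_cons]
            simp only [mix_cons, if_true, Fintype.expect_const]

/-! ### Functions of few coordinates and Bessel's inequality -/

section ProductSpace

variable {n : ℕ} {G : Fin n → Type} [∀ i, Fintype (G i)] [∀ i, Nonempty (G i)]

omit [∀ i, Nonempty (G i)] in
theorem expect_prod_apply (F : ∀ i, G i → ℝ) :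
    𝔼 c : ∀ i, G i, ∏ i, F i (c i) = ∏ i, 𝔼 g, F i g := by
  classical
  simp only [Fintype.expect_eq_sum_div_card, Finset.prod_div_distrib]
  rw [Finset.prod_univ_sum, Fintype.card_pi]
  simp

/-- Replacing the coordinates outside `S` by independent copies does not change the distribution. -/
theorem expect_mix {M : Type*} [AddCommMonoid M] [Module ℚ≥0 M] (S : Fin n → Bool)
    (f : (∀ i, G i) → M) : 𝔼 c, 𝔼 c', f (mix S c c') = 𝔼 c, f c := by
  let e : (∀ i, G i) × (∀ i, G i) ≃ (∀ i, G i) × (∀ i, G i) :=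
    { toFun := fun z => (mix S z.1 z.2, mix S z.2 z.1)
      invFun := fun z => (mix S z.1 z.2, mix S z.2 z.1)
      left_inv := fun z => by ext i <;> by_cases h : S i <;> simp [mix, h]
      right_inv := fun z => by ext i <;> by_cases h : S i <;> simp [mix, h] }
  rw [← Finset.expect_product', Finset.univ_product_univ,
    Fintype.expect_equiv e (fun z => f (mix S z.1 z.2)) (fun z => f z.1) fun _ => rfl,
    ← Finset.univ_product_univ, Finset.expect_product]
  simp only [Fintype.expect_const]

/-- Functions of coordinates in `S` and functions of the other coordinates are independent. -/
theorem expect_mul_of_disjoint (S : Fin n → Bool) (F W : (∀ i, G i) → ℝ)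
    (hF : ∀ c c', F (mix S c c') = F c) (hW : ∀ c c', W (mix S c c') = W c') :
    𝔼 c, F c * W c = (𝔼 c, F c) * 𝔼 c, W c := by
  rw [← expect_mix S]
  simp only [hF, hW, Finset.expect_mul_expect]

/-- The linear span of the functions of at most `m` coordinates. -/
def lowDegree (G : Fin n → Type) (m : ℕ) : Submodule ℂ ((∀ i, G i) → ℂ) :=
  Submodule.span ℂ {Z | ∃ B : Finset (Fin n), B.card ≤ m ∧ DependsOn Z (B : Set (Fin n))}

omit [∀ i, Fintype (G i)] [∀ i, Nonempty (G i)] in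
theorem lowDegree_mono {a b : ℕ} (h : a ≤ b) : lowDegree G a ≤ lowDegree G b :=
  Submodule.span_mono fun _ ⟨B, hB, hZ⟩ => ⟨B, hB.trans h, hZ⟩

omit [∀ i, Fintype (G i)] [∀ i, Nonempty (G i)] in
theorem mul_mem_lowDegree {a b : ℕ} {Z W : (∀ i, G i) → ℂ} (hZ : Z ∈ lowDegree G a)
    (hW : W ∈ lowDegree G b) : Z * W ∈ lowDegree G (a + b) := by
  classical
  have := Submodule.mul_mem_mul hZ hW
  rw [lowDegree, lowDegree, Submodule.span_mul_span] at this
  refine Submodule.span_mono ?_ this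
  rintro _ ⟨Z, ⟨B, hB, hZ⟩, W, ⟨B', hB', hW⟩, rfl⟩
  refine ⟨B ∪ B', (Finset.card_union_le _ _).trans (add_le_add hB hB'), fun c c' h => ?_⟩
  simp only [Pi.mul_apply]
  rw [hZ fun i hi => h i (by simp_all), hW fun i hi => h i (by simp_all)]

omit [∀ i, Fintype (G i)] [∀ i, Nonempty (G i)] in
theorem star_mem_lowDegree {a : ℕ} {Z : (∀ i, G i) → ℂ} (hZ : Z ∈ lowDegree G a) :
    star Z ∈ lowDegree G a := by
  induction hZ using Submodule.span_induction with
  | mem Z h =>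
    obtain ⟨B, hB, hZ⟩ := h
    exact Submodule.subset_span ⟨B, hB, fun c c' h => congrArg star (hZ h)⟩
  | zero => simp
  | add Z W _ _ h1 h2 => rw [star_add]; exact add_mem h1 h2
  | smul a Z _ h => rw [star_smul]; exact Submodule.smul_mem _ _ h

omit [∀ i, Fintype (G i)] [∀ i, Nonempty (G i)] in
theorem one_mem_lowDegree (a : ℕ) : (1 : (∀ i, G i) → ℂ) ∈ lowDegree G a :=
  Submodule.subset_span ⟨∅, by simp, fun _ _ _ => rfl⟩

/-- Under the weight `w`, the residues `π y` are distributed uniformly, as far as functions of at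
most `m` coordinates can tell. -/
def IsEquidistributed {Y : Type} (w : Y → ℝ) (π : Y → ∀ i, G i) (m : ℕ) : Prop :=
  ∀ B : Finset (Fin n), B.card ≤ m → ∀ Z : (∀ i, G i) → ℂ, DependsOn Z (B : Set (Fin n)) →
    ∑' y, (w y : ℂ) * Z (π y) = (∑' y, (w y : ℂ)) * 𝔼 c, Z c

omit [∀ i, Nonempty (G i)] in
theorem summable_mul_comp {Y : Type} {w : Y → ℝ} (hw : Summable w) (π : Y → ∀ i, G i)
    (Z : (∀ i, G i) → ℂ) : Summable fun y => (w y : ℂ) * Z (π y) := by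
  obtain ⟨C, hC⟩ := (Set.finite_range fun c => ‖Z c‖).bddAbove
  refine Summable.of_norm_bounded (g := fun y => |w y| * C) (hw.abs.mul_right C) fun y => ?_
  rw [norm_mul, Complex.norm_real, Real.norm_eq_abs]
  exact mul_le_mul_of_nonneg_left (hC ⟨_, rfl⟩) (abs_nonneg _)

omit [∀ i, Nonempty (G i)] in
theorem IsEquidistributed.tsum_eq {Y : Type} {w : Y → ℝ} {π : Y → ∀ i, G i} {m : ℕ}
    (h : IsEquidistributed w π m) (hw : Summable w) {Z : (∀ i, G i) → ℂ}
    (hZ : Z ∈ lowDegree G m) :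
    ∑' y, (w y : ℂ) * Z (π y) = (∑' y, (w y : ℂ)) * 𝔼 c, Z c := by
  induction hZ using Submodule.span_induction with
  | mem Z hZ => obtain ⟨B, hB, hZ⟩ := hZ; exact h B hB Z hZ
  | zero => simp
  | add Z W _ _ h1 h2 =>
    simp only [Pi.add_apply, mul_add, Finset.expect_add_distrib]
    rw [(summable_mul_comp hw π Z).tsum_add (summable_mul_comp hw π W), h1, h2]
  | smul a Z _ h =>
    simp only [Pi.smul_apply, smul_eq_mul, ← Finset.mul_expect, mul_left_comm _ a]
    rw [tsum_mul_left, h]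

omit [∀ i, Nonempty (G i)] in
theorem IsEquidistributed.tsum_eq_real {Y : Type} {w : Y → ℝ} {π : Y → ∀ i, G i} {m : ℕ}
    (h : IsEquidistributed w π m) (hw : Summable w) {Z : (∀ i, G i) → ℝ}
    (hZ : (fun c => (Z c : ℂ)) ∈ lowDegree G m) :
    ∑' y, w y * Z (π y) = (∑' y, w y) * 𝔼 c, Z c := by
  have := h.tsum_eq hw hZ
  rw [Fintype.expect_eq_sum_div_card] at this ⊢
  exact_mod_cast this

section Kernel

variable [∀ i, DecidableEq (G i)]

/-- The kernel `|G| 1_{a = b} - 1` of the projection onto functions of mean zero. -/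
def pointKernel {G : Type} [Fintype G] [DecidableEq G] (a b : G) : ℝ :=
  (if a = b then (Fintype.card G : ℝ) else 0) - 1

theorem expect_ite_eq_card {G : Type} [Fintype G] [Nonempty G] [DecidableEq G] (a : G)
    (f : G → ℝ) : 𝔼 b, (if a = b then (Fintype.card G : ℝ) else 0) * f b = f a := by
  rw [Fintype.expect_eq_sum_div_card]
  have : (Fintype.card G : ℝ) ≠ 0 := by exact_mod_cast Fintype.card_ne_zero
  simp only [ite_mul, zero_mul, Finset.sum_ite_eq, Finset.mem_univ, if_true]
  field_simp

theorem expect_pointKernel_mul {G : Type} [Fintype G] [Nonempty G] [DecidableEq G] (a : G)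
    (f : G → ℝ) : 𝔼 b, pointKernel a b * f b = f a - 𝔼 b, f b := by
  simp only [pointKernel, sub_mul, one_mul, Finset.expect_sub_distrib, expect_ite_eq_card]

theorem expect_pointKernel {G : Type} [Fintype G] [Nonempty G] [DecidableEq G] (a : G) :
    𝔼 b, pointKernel a b = 0 := by
  simpa [Fintype.expect_const] using expect_pointKernel_mul a (fun _ => 1)

theorem pointKernel_comm {G : Type} [Fintype G] [DecidableEq G] (a b : G) :
    pointKernel a b = pointKernel b a := by
  simp [pointKernel, eq_comm]

theorem expect_abs_pointKernel_le {G : Type} [Fintype G] [Nonempty G] [DecidableEq G] (a : G) :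
    𝔼 b, |pointKernel a b| ≤ 2 := by
  have h : ∀ b, |pointKernel a b| ≤ (if a = b then (Fintype.card G : ℝ) else 0) * 1 + 1 := by
    intro b
    refine (abs_sub _ _).trans ?_
    rw [abs_one, mul_one]
    gcongr
    split_ifs <;> simp
  refine (Finset.expect_le_expect fun b _ => h b).trans ?_
  rw [Finset.expect_add_distrib, expect_ite_eq_card, Fintype.expect_const]
  norm_num

/-- The kernel of the projection onto functions of the coordinates in `A` that have mean zero in
each of them. -/
def setKernel (A : Fin n → Bool) (c c' : ∀ i, G i) : ℝ :=
  ∏ i, if A i then pointKernel (c i) (c' i) else 1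

omit [∀ i, Nonempty (G i)] in
theorem setKernel_comm (A : Fin n → Bool) (c c' : ∀ i, G i) :
    setKernel A c c' = setKernel A c' c :=
  Finset.prod_congr rfl fun i _ => by rw [pointKernel_comm]

theorem expect_setKernel_mul (A B : Fin n → Bool) (c c' : ∀ i, G i) :
    𝔼 b, setKernel A c b * setKernel B c' b = if A = B then setKernel A c c' else 0 := by
  simp only [setKernel, ← Finset.prod_mul_distrib]
  rw [expect_prod_apply (fun i g => (if A i then pointKernel (c i) g else 1) *
    (if B i then pointKernel (c' i) g else 1))]
  have h : ∀ i, (𝔼 g, (if A i then pointKernel (c i) g else 1) *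
      (if B i then pointKernel (c' i) g else 1)) =
      if A i = B i then (if A i then pointKernel (c i) (c' i) else 1) else 0 := by
    intro i
    cases A i <;> cases B i <;> simp [expect_pointKernel]
    rw [expect_pointKernel_mul (c i) (fun b => pointKernel (c' i) b), expect_pointKernel, sub_zero,
      pointKernel_comm]
  simp only [h]
  split_ifs with hAB
  · subst hAB; simp
  · obtain ⟨i, hi⟩ := Function.ne_iff.1 hAB
    exact Finset.prod_eq_zero (Finset.mem_univ i) (by simp [hi])

theorem expect_abs_setKernel_le (A : Fin n → Bool) (c : ∀ i, G i) :
    𝔼 b, |setKernel A c b| ≤ 2 ^ wt A := by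
  simp only [setKernel, Finset.abs_prod]
  rw [expect_prod_apply (fun i g => |if A i then pointKernel (c i) g else 1|), wt,
    ← Finset.prod_pow_eq_pow_sum]
  refine Finset.prod_le_prod (fun i _ => Finset.expect_nonneg fun _ _ => abs_nonneg _)
    fun i _ => ?_
  cases A i
  · simp
  · simpa using expect_abs_pointKernel_le (c i)

omit [∀ i, Nonempty (G i)] in
theorem dependsOn_setKernel (A : Fin n → Bool) (c : ∀ i, G i) :
    DependsOn (setKernel A c) {i | A i = true} := by
  intro b b' h
  refine Finset.prod_congr rfl fun i _ => ?_
  split_ifs with hi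
  · rw [h i hi]
  · rfl

theorem card_filter_eq_wt (A : Fin n → Bool) :
    (Finset.univ.filter fun i => A i = true).card = wt A := by
  rw [Finset.card_filter, wt]
  exact Finset.sum_congr rfl fun i _ => by cases A i <;> simp

omit [∀ i, Fintype (G i)] [∀ i, Nonempty (G i)] [∀ i, DecidableEq (G i)] in
theorem mem_lowDegree_of_dependsOn {A : Fin n → Bool} {D : ℕ} (hA : wt A ≤ D)
    {Z : (∀ i, G i) → ℂ} (hZ : DependsOn Z {i | A i = true}) : Z ∈ lowDegree G D :=
  Submodule.subset_span ⟨Finset.univ.filter fun i => A i = true, by rwa [card_filter_eq_wt],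
    by simpa using hZ⟩

/-- Bessel's inequality for the components of a function on `Y`, in the weighted space with weight
`κ`. The hypothesis says that restriction to `Y` preserves the norm of the functions that occur. -/
theorem bessel_real {Y : Type} (κ : Y → ℝ) (hκ : ∀ y, 0 ≤ κ y) (hs : Summable κ)
    (π : Y → ∀ i, G i) (𝓑 : Finset (Fin n → Bool))
    (h : ∀ z : (Fin n → Bool) → (∀ i, G i) → ℝ,
      ∑' y, κ y * (∑ B ∈ 𝓑, 𝔼 c, z B c * setKernel B c (π y)) ^ 2 ≤
        (∑' y, κ y) * 𝔼 b, (∑ B ∈ 𝓑, 𝔼 c, z B c * setKernel B c b) ^ 2)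
    (F : Finset Y) (f : Y → ℝ) :
    ∑ B ∈ 𝓑, 𝔼 c, (∑ y ∈ F, κ y * f y * setKernel B c (π y)) ^ 2 ≤
      (∑' y, κ y) * ∑ y ∈ F, κ y * f y ^ 2 := by
  set z : (Fin n → Bool) → (∀ i, G i) → ℝ := fun B c =>
    ∑ y ∈ F, κ y * f y * setKernel B c (π y) with hz
  set V : (∀ i, G i) → ℝ := fun b => ∑ B ∈ 𝓑, 𝔼 c, z B c * setKernel B c b with hV
  have hrep : ∀ B c, 𝔼 c', z B c' * setKernel B c' c = z B c := by
    intro B c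
    simp only [hz, Finset.sum_mul]
    rw [Finset.expect_sum_comm]
    refine Finset.sum_congr rfl fun y _ => ?_
    simp only [mul_assoc, ← Finset.mul_expect]
    have := expect_setKernel_mul B B (π y) c
    rw [if_pos rfl, setKernel_comm B (π y) c] at this
    rw [← this]
    congr 2
    exact Finset.expect_congr rfl fun c' _ => by rw [setKernel_comm B (π y), setKernel_comm B c]
  have hEV : 𝔼 b, V b ^ 2 = ∑ B ∈ 𝓑, 𝔼 c, z B c ^ 2 := by
    have e1 : ∀ b, V b = ∑ B ∈ 𝓑, z B b := fun b =>
      Finset.sum_congr rfl fun B _ => hrep B b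
    have e2 : ∀ b, V b ^ 2 = ∑ B ∈ 𝓑, ∑ B' ∈ 𝓑, 𝔼 c, z B c * (setKernel B c b * z B' b) := by
      intro b
      rw [sq]
      nth_rewrite 2 [e1]
      simp only [hV, Finset.sum_mul_sum, Finset.expect_mul, mul_assoc]
    simp only [e2]
    rw [Finset.expect_sum_comm]
    refine Finset.sum_congr rfl fun B hB => ?_
    rw [Finset.expect_sum_comm, Finset.sum_eq_single_of_mem B hB]
    · rw [Finset.expect_comm]
      refine Finset.expect_congr rfl fun c _ => ?_
      rw [← Finset.mul_expect, sq]
      congr 1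
      rw [← hrep B c]
      exact Finset.expect_congr rfl fun b _ => by rw [setKernel_comm, mul_comm]
    · intro B' _ hne
      rw [Finset.expect_comm]
      refine Finset.expect_eq_zero fun c _ => ?_
      rw [← Finset.mul_expect]
      have : 𝔼 b, setKernel B c b * z B' b = 0 := by
        simp only [hz, Finset.mul_sum]
        rw [Finset.expect_sum_comm]
        refine Finset.sum_eq_zero fun y _ => ?_
        simp only [mul_left_comm (setKernel B c _), ← Finset.mul_expect,
          setKernel_comm B' _ (π y)]
        rw [expect_setKernel_mul, if_neg hne.symm, mul_zero]
      rw [this, mul_zero]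
  set Q := ∑ B ∈ 𝓑, 𝔼 c, z B c ^ 2 with hQ
  have hQ0 : 0 ≤ Q := Finset.sum_nonneg fun B _ => Finset.expect_nonneg fun c _ => sq_nonneg _
  have hQV : Q = ∑ y ∈ F, κ y * f y * V (π y) := by
    simp only [hQ, hV, Finset.mul_sum, Finset.mul_expect]
    rw [Finset.sum_comm]
    refine Finset.sum_congr rfl fun B _ => ?_
    rw [← Finset.expect_sum_comm]
    refine Finset.expect_congr rfl fun c _ => ?_
    rw [sq]
    nth_rewrite 1 [hz]
    simp only [Finset.sum_mul]
    exact Finset.sum_congr rfl fun y _ => by ring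
  have hb : Summable fun y => κ y * V (π y) ^ 2 := by
    have := summable_mul_comp hs π (fun c => ((V c ^ 2 : ℝ) : ℂ))
    exact_mod_cast this
  have hle : ∑ y ∈ F, κ y * V (π y) ^ 2 ≤ (∑' y, κ y) * Q := by
    rw [← hEV]
    exact (hb.sum_le_tsum F fun y _ => mul_nonneg (hκ y) (sq_nonneg _)).trans (h z)
  have hCS : Q ^ 2 ≤ (∑ y ∈ F, κ y * f y ^ 2) * ∑ y ∈ F, κ y * V (π y) ^ 2 := by
    rw [hQV]
    exact Finset.sum_sq_le_sum_mul_sum_of_sq_le_mul _ (fun y _ => mul_nonneg (hκ y) (sq_nonneg _))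
      (fun y _ => mul_nonneg (hκ y) (sq_nonneg _)) fun y _ => le_of_eq (by ring)
  have hf0 : 0 ≤ ∑ y ∈ F, κ y * f y ^ 2 :=
    Finset.sum_nonneg fun y _ => mul_nonneg (hκ y) (sq_nonneg _)
  rcases hQ0.eq_or_lt with h0 | h0
  · rw [← h0]; exact mul_nonneg (tsum_nonneg hκ) hf0
  · have := hCS.trans (mul_le_mul_of_nonneg_left hle hf0)
    nlinarith

theorem bessel {Y : Type} (κ : Y → ℝ) (hκ : ∀ y, 0 ≤ κ y) (hs : Summable κ)
    (π : Y → ∀ i, G i) (𝓑 : Finset (Fin n → Bool))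
    (h : ∀ z : (Fin n → Bool) → (∀ i, G i) → ℝ,
      ∑' y, κ y * (∑ B ∈ 𝓑, 𝔼 c, z B c * setKernel B c (π y)) ^ 2 ≤
        (∑' y, κ y) * 𝔼 b, (∑ B ∈ 𝓑, 𝔼 c, z B c * setKernel B c b) ^ 2)
    (F : Finset Y) (f : Y → ℂ) :
    ∑ B ∈ 𝓑, 𝔼 c, ‖∑ y ∈ F, (κ y : ℂ) * f y * setKernel B c (π y)‖ ^ 2 ≤
      (∑' y, κ y) * ∑ y ∈ F, κ y * ‖f y‖ ^ 2 := by
  have e : ∀ w : ℂ, ‖w‖ ^ 2 = w.re ^ 2 + w.im ^ 2 := fun w => by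
    rw [Complex.sq_norm, Complex.normSq_apply]; ring
  simp only [e, Complex.re_sum, Complex.im_sum, Complex.mul_re, Complex.mul_im, Complex.ofReal_re,
    Complex.ofReal_im, zero_mul, mul_zero, sub_zero, add_zero, zero_add,
    Finset.expect_add_distrib, Finset.sum_add_distrib, mul_add]
  exact add_le_add (bessel_real κ hκ hs π 𝓑 h F fun y => (f y).re)
    (bessel_real κ hκ hs π 𝓑 h F fun y => (f y).im)

end Kernel

end ProductSpace

/-! ### The square functions of the components -/

section SquareFunction

variable {n : ℕ} {G : Fin n → Type} [∀ i, Fintype (G i)] [∀ i, Nonempty (G i)]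
  [∀ i, DecidableEq (G i)] {Y : Type}

/-- The component of `κ f` at the set of coordinates `A`. Here and below only the values of `f`
on the finite set `F` matter. -/
def component (κ : Y → ℝ) (π : Y → ∀ i, G i) (F : Finset Y) (f : Y → ℂ) (A : Fin n → Bool)
    (c : ∀ i, G i) : ℂ :=
  ∑ y ∈ F, (κ y : ℂ) * f y * setKernel A c (π y)

/-- The sum of the components at the sets with at most `D` elements. -/
def lowPart (D : ℕ) (κ : Y → ℝ) (π : Y → ∀ i, G i) (F : Finset Y) (f : Y → ℂ)
    (c : ∀ i, G i) : ℂ :=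
  ∑ A with wt A ≤ D, component κ π F f A c

/-- The components at the sets `A ⊇ S` with at most `D` elements, as functions of the coordinates
outside `S`, collected into one vector. -/
noncomputable def squareVector (D : ℕ) (κ : Y → ℝ) (π : Y → ∀ i, G i) (F : Finset Y) (f : Y → ℂ)
    (S : Fin n → Bool) (c : ∀ i, G i) : PiLp 2 fun _ : (Fin n → Bool) × (∀ i, G i) => ℂ :=
  WithLp.toLp 2 fun z => if S ≤ z.1 ∧ wt z.1 ≤ D then
    ((Real.sqrt (Fintype.card (∀ i, G i)))⁻¹ : ℝ) • component κ π F f z.1 (mix S c z.2) else 0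

/-- The `ℓ²` norm of the components at the sets `A ⊇ S` with at most `D` elements, averaged over the
coordinates outside `S`. -/
noncomputable def squareFun (D : ℕ) (κ : Y → ℝ) (π : Y → ∀ i, G i) (F : Finset Y) (f : Y → ℂ)
    (S : Fin n → Bool) (c : ∀ i, G i) : ℝ := ‖squareVector D κ π F f S c‖

variable (D : ℕ) (κ : Y → ℝ) (π : Y → ∀ i, G i) (F : Finset Y)

theorem squareFun_sq (f : Y → ℂ) (S : Fin n → Bool) (c : ∀ i, G i) :
    squareFun D κ π F f S c ^ 2 =
      ∑ A with S ≤ A ∧ wt A ≤ D, 𝔼 c', ‖component κ π F f A (mix S c c')‖ ^ 2 := by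
  have hN : (0 : ℝ) < Fintype.card (∀ i, G i) := by exact_mod_cast Fintype.card_pos
  rw [squareFun, PiLp.norm_sq_eq_of_L2, Fintype.sum_prod_type, Finset.sum_filter]
  refine Finset.sum_congr rfl fun A _ => ?_
  by_cases h : S ≤ A ∧ wt A ≤ D
  · simp only [squareVector, h, and_self, if_true, norm_smul, mul_pow, Real.norm_eq_abs, sq_abs,
      inv_pow, Real.sq_sqrt hN.le]
    rw [← Finset.mul_sum, Fintype.expect_eq_sum_div_card, div_eq_inv_mul]
  · simp [squareVector, h]

omit [∀ i, Nonempty (G i)] in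
theorem squareFun_add_le (f g : Y → ℂ) (S : Fin n → Bool) (c : ∀ i, G i) :
    squareFun D κ π F (f + g) S c ≤ squareFun D κ π F f S c + squareFun D κ π F g S c := by
  refine le_trans (le_of_eq (congrArg norm ?_)) (norm_add_le _ _)
  refine PiLp.ext fun z => ?_
  simp only [squareVector, PiLp.add_apply]
  split_ifs
  · rw [← smul_add]
    simp only [component, Pi.add_apply, mul_add, add_mul, Finset.sum_add_distrib]
  · simp

omit [∀ i, Nonempty (G i)] in
theorem squareFun_nonneg (f : Y → ℂ) (S : Fin n → Bool) (c : ∀ i, G i) :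
    0 ≤ squareFun D κ π F f S c := norm_nonneg _

omit [∀ i, Nonempty (G i)] in
theorem component_dep (f : Y → ℂ) (A : Fin n → Bool) (i : Fin n) (hA : A i = false)
    (c : ∀ i, G i) (g : G i) :
    component κ π F f A (Function.update c i g) = component κ π F f A c := by
  refine Finset.sum_congr rfl fun y _ => ?_
  rw [setKernel_comm, setKernel_comm A c]
  rw [dependsOn_setKernel A (π y) (fun j hj => Function.update_of_ne (by rintro rfl; simp_all) _ _)]

theorem component_mean (f : Y → ℂ) (A : Fin n → Bool) (i : Fin n) (hA : A i = true)
    (c : ∀ i, G i) : ∑ g, component κ π F f A (Function.update c i g) = 0 := by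
  simp only [component]
  rw [Finset.sum_comm]
  refine Finset.sum_eq_zero fun y _ => ?_
  rw [← Finset.mul_sum]
  have : ∑ g, setKernel A (Function.update c i g) (π y) = 0 := by
    have h1 : ∀ g, setKernel A (Function.update c i g) (π y) =
        pointKernel (π y i) g * ∏ j ∈ Finset.univ.erase i,
          if A j then pointKernel (c j) (π y j) else 1 := fun g => by
      rw [setKernel, ← Finset.mul_prod_erase _ _ (Finset.mem_univ i)]
      congr 1
      · simp [hA, pointKernel_comm]
      · refine Finset.prod_congr rfl fun j hj => ?_
        rw [Function.update_of_ne (Finset.ne_of_mem_erase hj)]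
    simp only [h1]
    rw [← Finset.sum_mul, ← Fintype.card_smul_expect, expect_pointKernel]
    simp
  rw [← Complex.ofReal_sum, this]
  simp

/-- The `2r`-th moment of the low part is controlled by those of the square functions. -/
theorem expect_lowPart_pow_le {r : ℕ} {δ : ℝ} (hδ : OneVariable r δ) (h0 : 0 < δ) (h1 : δ ≤ 1)
    (f : Y → ℂ) :
    𝔼 c, ‖lowPart D κ π F f c‖ ^ (2 * r) ≤
      (δ⁻¹ ^ D) ^ (2 * r) * ∑ S, 𝔼 c, squareFun D κ π F f S c ^ (2 * r) := by
  have key := expect_norm_sum_pow_le hδ n G ℂ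
    (fun A c => if wt A ≤ D then δ⁻¹ ^ wt A • component κ π F f A c else 0)
    (fun A i hA c g => by simp only [component_dep κ π F f A i hA c g])
    (fun A i hA c => by
      split_ifs
      · rw [← Finset.smul_sum, component_mean κ π F f A i hA c, smul_zero]
      · simp)
  have e : ∀ c, ∑ A, δ ^ wt A • (if wt A ≤ D then δ⁻¹ ^ wt A • component κ π F f A c else 0) =
      lowPart D κ π F f c := fun c => by
    rw [lowPart, Finset.sum_filter]
    refine Finset.sum_congr rfl fun A _ => ?_
    split_ifs
    · rw [smul_smul, ← mul_pow, mul_inv_cancel₀ h0.ne', one_pow, one_smul]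
    · simp
  simp only [e] at key
  refine key.trans ?_
  rw [Finset.mul_sum]
  refine Finset.sum_le_sum fun S _ => ?_
  rw [Finset.mul_expect]
  refine Finset.expect_le_expect fun c _ => ?_
  rw [pow_mul _ 2 r, pow_mul _ 2 r, ← mul_pow, squareFun_sq]
  refine pow_le_pow_left₀ (Finset.sum_nonneg fun A _ => Finset.expect_nonneg fun _ _ => by
    positivity) ?_ r
  rw [Finset.mul_sum, Finset.sum_filter, Finset.sum_filter]
  refine Finset.sum_le_sum fun A _ => ?_
  by_cases hS : S ≤ A <;> by_cases hA : wt A ≤ D <;> simp only [hS, hA, if_true, if_false, and_self,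
    and_true, and_false, norm_zero, le_refl]
  · rw [Finset.mul_expect]
    refine Finset.expect_le_expect fun c' _ => ?_
    rw [norm_smul, mul_pow]
    gcongr
    rw [norm_pow, Real.norm_of_nonneg (by positivity)]
    exact pow_le_pow_right₀ (one_le_inv₀ h0 |>.2 h1) hA
  · simp

theorem apply_eq_true_of_le {S A : Fin n → Bool} (h : S ≤ A) {i : Fin n} (hi : S i = true) :
    A i = true := by
  have : (true : Bool) ≤ A i := hi ▸ h i
  cases hA : A i with
  | true => rfl
  | false => rw [hA] at this; exact absurd this (by decide)

/-- The set difference `A \ S`. -/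
def diffSet (A S : Fin n → Bool) : Fin n → Bool := fun i => A i && !S i

omit [∀ i, Nonempty (G i)] in
theorem setKernel_mix {A S : Fin n → Bool} (h : S ≤ A) (c c' b : ∀ i, G i) :
    setKernel A (mix S c c') b = setKernel S c b * setKernel (diffSet A S) c' b := by
  rw [setKernel, setKernel, setKernel, ← Finset.prod_mul_distrib]
  refine Finset.prod_congr rfl fun i _ => ?_
  have := @apply_eq_true_of_le _ _ _ h i
  cases hS : S i <;> cases hA : A i <;> simp_all [mix, diffSet]

theorem wt_mono {A B : Fin n → Bool} (h : A ≤ B) : wt A ≤ wt B :=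
  Finset.sum_le_sum fun i _ => by
    have := @apply_eq_true_of_le _ _ _ h i
    cases hA : A i <;> cases hB : B i <;> simp_all

theorem diffSet_le (A S : Fin n → Bool) : diffSet A S ≤ A := fun i => by
  cases hA : A i <;> simp [diffSet, hA]

theorem diffSet_injOn (S : Fin n → Bool) : Set.InjOn (fun A => diffSet A S) {A | S ≤ A} := by
  intro A hA B hB h
  funext i
  have h1 := @apply_eq_true_of_le _ _ _ hA i
  have h2 := @apply_eq_true_of_le _ _ _ hB i
  have h3 := congrFun h i
  cases hS : S i <;> simp_all [diffSet]

section Bounds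

variable {κ π}

/-- Bessel's inequality for the weight `κ |k_S(c, ·)|` and the components in the coordinates
outside `S`. -/
theorem squareFun_sq_le (hκ : ∀ y, 0 ≤ κ y) (hs : Summable κ) (he : IsEquidistributed κ π (3 * D))
    (f : Y → ℂ) (S : Fin n → Bool) (hS : wt S ≤ D) (c : ∀ i, G i) :
    squareFun D κ π F f S c ^ 2 ≤ (∑' y, κ y * |setKernel S c (π y)|) *
      ∑ y ∈ F, κ y * |setKernel S c (π y)| * ‖f y‖ ^ 2 := by
  set κ' : Y → ℝ := fun y => κ y * |setKernel S c (π y)| with hκ'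
  have hκ'0 : ∀ y, 0 ≤ κ' y := fun y => mul_nonneg (hκ y) (abs_nonneg _)
  have hs' : Summable κ' := by
    have := summable_mul_comp hs π (fun b => ((|setKernel S c b| : ℝ) : ℂ))
    exact_mod_cast this
  set 𝓐 : Finset (Fin n → Bool) := Finset.univ.filter fun A => S ≤ A ∧ wt A ≤ D with h𝓐
  set 𝓑 : Finset (Fin n → Bool) := 𝓐.image fun A => diffSet A S with h𝓑
  have hB : ∀ B ∈ 𝓑, wt B ≤ D ∧ ∀ i, B i = true → S i = false := by
    intro B hB
    obtain ⟨A, hA, rfl⟩ := Finset.mem_image.1 hB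
    refine ⟨(wt_mono (diffSet_le A S)).trans (Finset.mem_filter.1 hA).2.2, fun i hi => ?_⟩
    simp only [diffSet, Bool.and_eq_true, Bool.not_eq_true'] at hi
    exact hi.2
  have hm1 : (fun b => ((|setKernel S c b| : ℝ) : ℂ)) ∈ lowDegree G D :=
    mem_lowDegree_of_dependsOn hS fun b b' h => by rw [dependsOn_setKernel S c h]
  have hmass : ∑' y, κ' y = (∑' y, κ y) * 𝔼 b, |setKernel S c b| :=
    he.tsum_eq_real hs (Z := fun b => |setKernel S c b|) (lowDegree_mono (by omega) hm1)
  have hbes := bessel κ' hκ'0 hs' π 𝓑 (fun z => by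
    set V : (∀ i, G i) → ℝ := fun b => ∑ B ∈ 𝓑, 𝔼 c, z B c * setKernel B c b with hV
    have hVS : ∀ b b' : ∀ i, G i, V (mix S b b') = V b' := fun b b' => by
      refine Finset.sum_congr rfl fun B hB' => Finset.expect_congr rfl fun c _ => ?_
      rw [dependsOn_setKernel B c fun i hi => ?_]
      simp [mix, (hB B hB').2 i hi]
    have hm2 : (fun b => (V b : ℂ)) ∈ lowDegree G D := by
      have : (fun b => (V b : ℂ)) =
          ∑ B ∈ 𝓑, fun b => ((𝔼 c, z B c * setKernel B c b : ℝ) : ℂ) := by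
        funext b; simp [hV]
      rw [this]
      refine sum_mem fun B hB' => mem_lowDegree_of_dependsOn (hB B hB').1 fun b b' h => ?_
      simp only [dependsOn_setKernel B _ h]
    have hm3 : (fun b => ((|setKernel S c b| * V b ^ 2 : ℝ) : ℂ)) ∈ lowDegree G (3 * D) := by
      refine lowDegree_mono (by omega) ?_ (a := D + (D + D))
      have := mul_mem_lowDegree hm1 (mul_mem_lowDegree hm2 hm2)
      convert this using 1
      funext b
      simp [sq]
    have e := he.tsum_eq_real hs (Z := fun b => |setKernel S c b| * V b ^ 2) hm3
    rw [expect_mul_of_disjoint S (fun b => |setKernel S c b|) (fun b => V b ^ 2)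
      (fun b b' => by rw [dependsOn_setKernel S c fun i hi => ?_]; simp_all [mix])
      (fun b b' => by simp only [hVS]), ← mul_assoc, ← hmass] at e
    rw [← e]
    exact le_of_eq (tsum_congr fun y => by simp only [hκ']; ring)) F
      (fun y => (SignType.sign (setKernel S c (π y)) : ℝ) * f y)
  rw [squareFun_sq]
  have e1 : ∑ A with S ≤ A ∧ wt A ≤ D, 𝔼 c', ‖component κ π F f A (mix S c c')‖ ^ 2 =
      ∑ B ∈ 𝓑, 𝔼 c', ‖∑ y ∈ F, (κ' y : ℂ) *
        ((SignType.sign (setKernel S c (π y)) : ℝ) * f y) * setKernel B c' (π y)‖ ^ 2 := by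
    rw [h𝓑, Finset.sum_image (fun A hA B hB h => diffSet_injOn S (Finset.mem_filter.1 hA).2.1
      (Finset.mem_filter.1 hB).2.1 h)]
    refine Finset.sum_congr rfl fun A hA => Finset.expect_congr rfl fun c' _ => ?_
    congr 2
    refine Finset.sum_congr rfl fun y _ => ?_
    rw [setKernel_mix (Finset.mem_filter.1 hA).2.1]
    have : (κ' y : ℂ) * ((SignType.sign (setKernel S c (π y)) : ℝ) : ℂ) =
        κ y * setKernel S c (π y) := by
      rw [← Complex.ofReal_mul, ← Complex.ofReal_mul]
      congr 1
      simp only [hκ']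
      rw [mul_assoc, abs_mul_sign]
    rw [← mul_assoc (κ' y : ℂ), this]
    push_cast
    ring
  rw [e1]
  refine hbes.trans (mul_le_mul_of_nonneg_left (Finset.sum_le_sum fun y _ => ?_)
    (tsum_nonneg hκ'0))
  refine mul_le_mul_of_nonneg_left ?_ (hκ'0 y)
  rw [norm_mul, mul_pow]
  refine mul_le_of_le_one_left (by positivity) ?_
  rcases lt_trichotomy (setKernel S c (π y)) 0 with h | h | h <;> simp [h]

/-- The bound of the square functions from `ℓ^∞` to `ℓ^∞`. -/
theorem squareFun_le (hκ : ∀ y, 0 ≤ κ y) (hs : Summable κ) (h1 : ∑' y, κ y = 1)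
    (he : IsEquidistributed κ π (3 * D)) (f : Y → ℂ) (a : ℝ) (ha : 0 ≤ a)
    (hf : ∀ y ∈ F, ‖f y‖ ≤ a) (S : Fin n → Bool) (c : ∀ i, G i) :
    squareFun D κ π F f S c ≤ 2 ^ D * a := by
  by_cases hS : wt S ≤ D
  · refine abs_le_of_sq_le_sq' ?_ (by positivity) |>.2
    refine (squareFun_sq_le D F hκ hs he f S hS c).trans ?_
    have hs' : Summable fun y => κ y * |setKernel S c (π y)| := by
      have := summable_mul_comp hs π (fun b => ((|setKernel S c b| : ℝ) : ℂ))
      exact_mod_cast this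
    have hm1 : (fun b => ((|setKernel S c b| : ℝ) : ℂ)) ∈ lowDegree G (3 * D) :=
      lowDegree_mono (by omega) (mem_lowDegree_of_dependsOn hS fun b b' h => by
        rw [dependsOn_setKernel S c h])
    have hmass := he.tsum_eq_real hs (Z := fun b => |setKernel S c b|) hm1
    rw [h1, one_mul] at hmass
    have hM : ∑' y, κ y * |setKernel S c (π y)| ≤ 2 ^ D := by
      rw [hmass]
      exact (expect_abs_setKernel_le S c).trans (pow_le_pow_right₀ (by norm_num) hS)
    have hn : ∀ y, 0 ≤ κ y * |setKernel S c (π y)| := fun y => mul_nonneg (hκ y) (abs_nonneg _)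
    have h2 : ∑ y ∈ F, κ y * |setKernel S c (π y)| * ‖f y‖ ^ 2 ≤ 2 ^ D * a ^ 2 := by
      calc _ ≤ ∑ y ∈ F, κ y * |setKernel S c (π y)| * a ^ 2 :=
            Finset.sum_le_sum fun y hy => mul_le_mul_of_nonneg_left
              (pow_le_pow_left₀ (norm_nonneg _) (hf y hy) 2) (hn y)
        _ ≤ 2 ^ D * a ^ 2 := by
            rw [← Finset.sum_mul]
            exact mul_le_mul_of_nonneg_right
              ((hs'.sum_le_tsum F fun y _ => hn y).trans hM) (by positivity)
    calc _ ≤ (2 : ℝ) ^ D * (2 ^ D * a ^ 2) := mul_le_mul hM h2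
            (Finset.sum_nonneg fun y _ => mul_nonneg (hn y) (by positivity)) (by positivity)
      _ = _ := by ring
  · have : squareFun D κ π F f S c ^ 2 = 0 := by
      rw [squareFun_sq, Finset.filter_false_of_mem, Finset.sum_empty]
      rintro A - ⟨h3, h4⟩
      exact hS ((wt_mono h3).trans h4)
    rw [pow_eq_zero_iff two_ne_zero] at this
    rw [this]
    positivity

theorem card_subsets_eq (A : Fin n → Bool) :
    (Finset.univ.filter fun S : Fin n → Bool => S ≤ A).card = 2 ^ wt A := by
  have : ∀ S : Fin n → Bool, (if S ≤ A then 1 else 0) = ∏ i, if S i ≤ A i then 1 else 0 := by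
    intro S
    rw [Finset.prod_ite_zero]
    simp [Pi.le_def]
  rw [Finset.card_filter]
  simp only [this]
  rw [← Fintype.piFinset_univ, ← Finset.prod_univ_sum (fun _ => Finset.univ)
    (fun i b => if b ≤ A i then 1 else 0), wt, ← Finset.prod_pow_eq_pow_sum]
  refine Finset.prod_congr rfl fun i _ => ?_
  cases A i
  · simp; rfl
  · simp

/-- The bound of the square functions from `ℓ²` to `ℓ²`. -/
theorem sum_expect_squareFun_sq_le (hκ : ∀ y, 0 ≤ κ y) (hs : Summable κ) (h1 : ∑' y, κ y = 1)
    (he : IsEquidistributed κ π (3 * D)) (f : Y → ℂ) :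
    ∑ S, 𝔼 c, squareFun D κ π F f S c ^ 2 ≤ 2 ^ D * ∑ y ∈ F, κ y * ‖f y‖ ^ 2 := by
  obtain ⟨c₀⟩ : Nonempty (∀ i, G i) := inferInstance
  have hle : ∑ A with wt A ≤ D, 𝔼 c', ‖component κ π F f A c'‖ ^ 2 ≤
      ∑ y ∈ F, κ y * ‖f y‖ ^ 2 := by
    have hz : wt (fun _ : Fin n => false) = 0 := by simp [wt]
    have := squareFun_sq_le D F hκ hs he f (fun _ => false) (by omega) c₀
    have e : ∀ b, setKernel (fun _ : Fin n => false) c₀ b = 1 := fun b => by simp [setKernel]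
    have e2 : ∀ A : Fin n → Bool, (fun _ => false) ≤ A := fun A i => Bool.false_le _
    have e3 : ∀ c' : ∀ i, G i, mix (fun _ => false) c₀ c' = c' := fun c' => by
      funext i; simp [mix]
    rw [squareFun_sq] at this
    simpa only [e, e2, e3, true_and, abs_one, mul_one, h1, one_mul] using this
  refine le_trans ?_ (mul_le_mul_of_nonneg_left hle (by positivity))
  simp only [squareFun_sq, Finset.sum_filter, Finset.expect_sum_comm]
  rw [Finset.sum_comm, Finset.mul_sum]
  refine Finset.sum_le_sum fun A _ => ?_
  by_cases hA : wt A ≤ D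
  · simp only [hA, and_true, if_true]
    have : ∀ S : Fin n → Bool, (𝔼 c, if S ≤ A then
        𝔼 c', ‖component κ π F f A (mix S c c')‖ ^ 2 else 0) =
        if S ≤ A then 𝔼 c', ‖component κ π F f A c'‖ ^ 2 else 0 := fun S => by
      split_ifs
      · exact expect_mix S fun c => ‖component κ π F f A c‖ ^ 2
      · simp
    simp only [this]
    rw [← Finset.sum_filter, Finset.sum_const, card_subsets_eq, nsmul_eq_mul]
    push_cast
    refine mul_le_mul_of_nonneg_right (pow_le_pow_right₀ (by norm_num) hA)
      (Finset.expect_nonneg fun _ _ => by positivity)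
  · simp [hA]

end Bounds

end SquareFunction

/-! ### Real interpolation on finite sets -/

theorem integral_indicator_rpow {p s : ℝ} (hp : 0 < p) (hs : 0 ≤ s) :
    IntegrableOn ((Set.Iio s).indicator fun t => p * t ^ (p - 1)) (Set.Ioi 0) ∧
    ∫ t in Set.Ioi 0, (Set.Iio s).indicator (fun t => p * t ^ (p - 1)) t = s ^ p := by
  have hset : Set.Iio s ∩ Set.Ioi 0 = Set.Ioo 0 s := by ext t; simp [and_comm]
  have hint : IntervalIntegrable (fun t : ℝ => p * t ^ (p - 1)) volume 0 s :=
    (intervalIntegral.intervalIntegrable_rpow' (by linarith)).const_mul p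
  refine ⟨?_, ?_⟩
  · rw [IntegrableOn, integrable_indicator_iff measurableSet_Iio, IntegrableOn,
      Measure.restrict_restrict measurableSet_Iio, hset]
    exact (hint.1).mono_set Set.Ioo_subset_Ioc_self
  · rw [integral_indicator measurableSet_Iio, Measure.restrict_restrict measurableSet_Iio, hset,
      ← integral_Ioc_eq_integral_Ioo, ← intervalIntegral.integral_of_le hs,
      intervalIntegral.integral_const_mul, integral_rpow (Or.inl (by linarith))]
    rw [sub_add_cancel, Real.zero_rpow hp.ne', sub_zero, mul_div_cancel₀ _ hp.ne']

theorem integral_indicator_rpow_Ici {q a : ℝ} (hq : 0 < q) (ha : 0 < a) :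
    IntegrableOn ((Set.Ici a).indicator fun t => t ^ (-q - 1)) (Set.Ioi 0) ∧
    ∫ t in Set.Ioi 0, (Set.Ici a).indicator (fun t => t ^ (-q - 1)) t = a ^ (-q) / q := by
  have hset : Set.Ici a ∩ Set.Ioi 0 = Set.Ici a := by
    ext t; simp only [Set.mem_inter_iff, Set.mem_Ici, Set.mem_Ioi]
    exact ⟨fun h => h.1, fun h => ⟨h, ha.trans_le h⟩⟩
  refine ⟨?_, ?_⟩
  · rw [IntegrableOn, integrable_indicator_iff measurableSet_Ici, IntegrableOn,
      Measure.restrict_restrict measurableSet_Ici, hset]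
    exact (integrableOn_Ici_iff_integrableOn_Ioi).2
      (integrableOn_Ioi_rpow_of_lt (by linarith) ha)
  · rw [integral_indicator measurableSet_Ici, Measure.restrict_restrict measurableSet_Ici, hset,
      integral_Ici_eq_integral_Ioi, integral_Ioi_rpow_of_lt (by linarith) ha, sub_add_cancel,
      neg_div_neg_eq]

/-- Marcinkiewicz interpolation: integration over the levels `t` of a bound for the distribution
function of `s` in terms of `a` truncated at height `t`. -/
theorem sum_rpow_le_of_distribution {Y Ω : Type} (F : Finset Y) (Ω₀ : Finset Ω) (a : Y → ℝ)
    (s w : Ω → ℝ) (ha : ∀ y, 0 ≤ a y) (hs : ∀ v, 0 ≤ s v) {p₀ p p₁ A₀ A₁ : ℝ} (h0 : 0 < p₀)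
    (hp₀ : p₀ < p) (hp₁ : p < p₁)
    (h : ∀ t, 0 < t → ∑ v ∈ Ω₀ with t < s v, w v ≤ A₀ * t ^ (-p₀) * ∑ y ∈ F with t < a y, a y ^ p₀ +
      A₁ * t ^ (-p₁) * ∑ y ∈ F with a y ≤ t, a y ^ p₁) :
    ∑ v ∈ Ω₀, w v * s v ^ p ≤ p * (A₀ / (p - p₀) + A₁ / (p₁ - p)) * ∑ y ∈ F, a y ^ p := by
  have hp : 0 < p := h0.trans hp₀
  -- the two sides as integrals over the levels
  let L : ℝ → ℝ := fun t => ∑ v ∈ Ω₀, w v * (Set.Iio (s v)).indicator (fun t => p * t ^ (p - 1)) t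
  let R₀ : Y → ℝ → ℝ := fun y t =>
    A₀ * p * a y ^ p₀ / (p - p₀) *
      (Set.Iio (a y)).indicator (fun t => (p - p₀) * t ^ (p - p₀ - 1)) t
  let R₁ : Y → ℝ → ℝ := fun y t => if a y = 0 then 0 else
    A₁ * p * a y ^ p₁ * (Set.Ici (a y)).indicator (fun t => t ^ (-(p₁ - p) - 1)) t
  have hL : IntegrableOn L (Set.Ioi 0) ∧ ∫ t in Set.Ioi 0, L t = ∑ v ∈ Ω₀, w v * s v ^ p := by
    refine ⟨integrable_finsetSum _ fun v _ =>
      ((integral_indicator_rpow hp (hs v)).1).const_mul _, ?_⟩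
    rw [integral_finsetSum _ fun v _ => ((integral_indicator_rpow hp (hs v)).1).const_mul _]
    refine Finset.sum_congr rfl fun v _ => ?_
    rw [integral_const_mul, (integral_indicator_rpow hp (hs v)).2]
  have hR₀ : ∀ y, IntegrableOn (R₀ y) (Set.Ioi 0) ∧
      ∫ t in Set.Ioi 0, R₀ y t = p * (A₀ / (p - p₀)) * a y ^ p := fun y => by
    have := integral_indicator_rpow (p := p - p₀) (by linarith) (ha y)
    refine ⟨this.1.const_mul _, ?_⟩
    simp only [R₀]
    rw [integral_const_mul, this.2]
    have e : a y ^ p = a y ^ p₀ * a y ^ (p - p₀) := by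
      rcases (ha y).eq_or_lt with h' | h'
      · rw [← h', Real.zero_rpow hp.ne', Real.zero_rpow h0.ne', zero_mul]
      · rw [← Real.rpow_add h']; congr 1; ring
    rw [e]; ring
  have hR₁ : ∀ y, IntegrableOn (R₁ y) (Set.Ioi 0) ∧
      ∫ t in Set.Ioi 0, R₁ y t = p * (A₁ / (p₁ - p)) * a y ^ p := fun y => by
    rcases (ha y).eq_or_lt with h' | h'
    · simp only [R₁, ← h', if_true]
      refine ⟨integrableOn_zero, ?_⟩
      rw [Real.zero_rpow hp.ne']; simp
    · have := integral_indicator_rpow_Ici (q := p₁ - p) (by linarith) h'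
      simp only [R₁, h'.ne', if_false]
      refine ⟨this.1.const_mul _, ?_⟩
      rw [integral_const_mul, this.2]
      have e : a y ^ p = a y ^ p₁ * a y ^ (-(p₁ - p)) := by
        rw [← Real.rpow_add h']; congr 1; ring
      rw [e]; ring
  have hR : ∀ y, IntegrableOn (fun t => R₀ y t + R₁ y t) (Set.Ioi 0) := fun y =>
    (hR₀ y).1.add (hR₁ y).1
  have hsum : ∫ t in Set.Ioi 0, (∑ y ∈ F, (R₀ y t + R₁ y t)) =
      p * (A₀ / (p - p₀) + A₁ / (p₁ - p)) * ∑ y ∈ F, a y ^ p := by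
    rw [integral_finsetSum _ fun y _ => hR y, Finset.mul_sum]
    refine Finset.sum_congr rfl fun y _ => ?_
    rw [integral_add (hR₀ y).1 (hR₁ y).1, (hR₀ y).2, (hR₁ y).2]
    ring
  rw [← hL.2, ← hsum]
  refine setIntegral_mono_on hL.1 (integrable_finsetSum _ fun y _ => hR y)
    measurableSet_Ioi fun t (ht : 0 < t) => ?_
  have e0 : L t = p * t ^ (p - 1) * ∑ v ∈ Ω₀ with t < s v, w v := by
    simp only [L]
    rw [Finset.sum_filter, Finset.mul_sum]
    refine Finset.sum_congr rfl fun v _ => ?_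
    by_cases hv : t < s v <;> simp [Set.indicator, hv]
    ring
  rw [e0]
  refine (mul_le_mul_of_nonneg_left (h t ht) (by positivity)).trans (le_of_eq ?_)
  rw [mul_add, Finset.sum_add_distrib]
  congr 1
  · rw [Finset.sum_filter, Finset.mul_sum, Finset.mul_sum]
    refine Finset.sum_congr rfl fun y _ => ?_
    by_cases hy : t < a y
    · simp only [R₀, Set.indicator, Set.mem_Iio, hy, if_true]
      have e : t ^ (p - p₀ - 1) = t ^ (p - 1) * t ^ (-p₀) := by
        rw [← Real.rpow_add ht]; congr 1; ring
      have : p - p₀ ≠ 0 := by linarith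
      rw [e]; field_simp
    · simp [R₀, Set.indicator, hy]
  · rw [Finset.sum_filter, Finset.mul_sum, Finset.mul_sum]
    refine Finset.sum_congr rfl fun y _ => ?_
    by_cases hy : a y ≤ t
    · rcases (ha y).eq_or_lt with h' | h'
      · simp [R₁, ← h', Real.zero_rpow (by linarith : p₁ ≠ 0)]
      · simp only [R₁, Set.indicator, Set.mem_Ici, hy, if_true, h'.ne', if_false]
        have e : t ^ (-(p₁ - p) - 1) = t ^ (p - 1) * t ^ (-p₁) := by
          rw [← Real.rpow_add ht]; congr 1; ring
        rw [e]; ring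
    · simp [R₁, Set.indicator, hy]

/-- Chebyshev's inequality for weighted finite sums. -/
theorem sum_filter_lt_le {Ω : Type} (Ω₀ : Finset Ω) (w s : Ω → ℝ) (hw : ∀ v, 0 ≤ w v)
    (hs : ∀ v, 0 ≤ s v) {q t : ℝ} (hq : 0 < q) (ht : 0 < t) :
    ∑ v ∈ Ω₀ with t < s v, w v ≤ t ^ (-q) * ∑ v ∈ Ω₀, w v * s v ^ q := by
  rw [Finset.mul_sum, Finset.sum_filter]
  refine Finset.sum_le_sum fun v _ => ?_
  split_ifs with h
  · have h1 : t ^ q ≤ s v ^ q := Real.rpow_le_rpow ht.le h.le hq.le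
    have h2 : t ^ (-q) * t ^ q = 1 := by rw [← Real.rpow_add ht]; simp
    calc w v = w v * (t ^ (-q) * t ^ q) := by rw [h2, mul_one]
      _ ≤ w v * (t ^ (-q) * s v ^ q) := by
          have := hw v
          gcongr
      _ = _ := by ring
  · exact mul_nonneg (by positivity) (mul_nonneg (hw v) (Real.rpow_nonneg (hs v) _))

/-- The part of `f` where its size exceeds `t`. -/
noncomputable def highPart {Y : Type} (t : ℝ) (f : Y → ℂ) (y : Y) : ℂ := if t < ‖f y‖ then f y else 0

/-- The part of `f` where its size is at most `t`. -/
noncomputable def smallPart {Y : Type} (t : ℝ) (f : Y → ℂ) (y : Y) : ℂ := if t < ‖f y‖ then 0 else f y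

theorem highPart_add_smallPart {Y : Type} (t : ℝ) (f : Y → ℂ) :
    highPart t f + smallPart t f = f := by
  funext y; simp only [highPart, smallPart, Pi.add_apply]; split_ifs <;> simp

theorem sum_norm_highPart {Y : Type} (F : Finset Y) (t : ℝ) (f : Y → ℂ) {q : ℝ} (hq : 0 < q) :
    ∑ y ∈ F, ‖highPart t f y‖ ^ q = ∑ y ∈ F with t < ‖f y‖, ‖f y‖ ^ q := by
  rw [Finset.sum_filter]
  refine Finset.sum_congr rfl fun y _ => ?_
  simp only [highPart]; split_ifs <;> simp [Real.zero_rpow hq.ne']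

theorem sum_norm_smallPart {Y : Type} (F : Finset Y) (t : ℝ) (f : Y → ℂ) {q : ℝ} (hq : 0 < q) :
    ∑ y ∈ F, ‖smallPart t f y‖ ^ q = ∑ y ∈ F with ‖f y‖ ≤ t, ‖f y‖ ^ q := by
  rw [Finset.sum_filter]
  refine Finset.sum_congr rfl fun y _ => ?_
  simp only [smallPart, ← not_lt]; split_ifs <;> simp [Real.zero_rpow hq.ne']

/-- Interpolation of a sublinear operator between `L^{p₀}` and `L^∞`. -/
theorem interpolation_top {Y Ω : Type} (F : Finset Y) (Ω₀ : Finset Ω) (w : Ω → ℝ)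
    (hw : ∀ v, 0 ≤ w v) (S : (Y → ℂ) → Ω → ℝ) (hS0 : ∀ f v, 0 ≤ S f v)
    (hS : ∀ f g v, S (f + g) v ≤ S f v + S g v) {p₀ p C K : ℝ} (h0 : 0 < p₀) (hp : p₀ < p)
    (hK : 0 < K)
    (h2 : ∀ f, ∑ v ∈ Ω₀, w v * S f v ^ p₀ ≤ C * ∑ y ∈ F, ‖f y‖ ^ p₀)
    (hinf : ∀ f t, 0 ≤ t → (∀ y ∈ F, ‖f y‖ ≤ t) → ∀ v ∈ Ω₀, S f v ≤ K * t) (f : Y → ℂ) :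
    ∑ v ∈ Ω₀, w v * S f v ^ p ≤
      (2 * K) ^ p * (p * (K ^ (-p₀) * C / (p - p₀))) * ∑ y ∈ F, ‖f y‖ ^ p := by
  have key := sum_rpow_le_of_distribution F Ω₀ (fun y => ‖f y‖) (fun v => S f v / (2 * K)) w
    (fun y => norm_nonneg _) (fun v => div_nonneg (hS0 f v) (by positivity)) (p₁ := p + 1)
    (A₀ := K ^ (-p₀) * C) (A₁ := 0) h0 hp (by linarith) (fun t ht => by
      rw [zero_mul, zero_mul, add_zero, ← sum_norm_highPart F t f h0]
      have h1 : ∑ v ∈ Ω₀ with t < S f v / (2 * K), w v ≤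
          ∑ v ∈ Ω₀ with K * t < S (highPart t f) v, w v := by
        refine Finset.sum_le_sum_of_subset_of_nonneg (fun v hv => ?_) fun v _ _ => hw v
        obtain ⟨hv0, hv⟩ := Finset.mem_filter.1 hv
        rw [lt_div_iff₀ (by positivity)] at hv
        refine Finset.mem_filter.2 ⟨hv0, ?_⟩
        have h3 := hS (highPart t f) (smallPart t f) v
        rw [highPart_add_smallPart] at h3
        have h4 := hinf (smallPart t f) t ht.le (fun y _ => by
          simp only [smallPart]; split_ifs with h
          · simpa using ht.le
          · exact not_lt.1 h) v hv0
        linarith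
      refine h1.trans ((sum_filter_lt_le Ω₀ w _ hw (hS0 _) h0 (by positivity)).trans ?_)
      refine (mul_le_mul_of_nonneg_left (h2 (highPart t f)) (by positivity)).trans (le_of_eq ?_)
      rw [Real.mul_rpow hK.le ht.le]; ring)
  have e : ∑ v ∈ Ω₀, w v * S f v ^ p = (2 * K) ^ p * ∑ v ∈ Ω₀, w v * (S f v / (2 * K)) ^ p := by
    rw [Finset.mul_sum]
    refine Finset.sum_congr rfl fun v _ => ?_
    rw [Real.div_rpow (hS0 f v) (by positivity)]
    have : (2 * K) ^ p ≠ 0 := by positivity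
    field_simp
  rw [e, mul_assoc]
  refine mul_le_mul_of_nonneg_left (key.trans (le_of_eq ?_)) (by positivity)
  rw [zero_div, add_zero]

/-- Interpolation of a sublinear operator between `L^{p₀}` and `L^{p₁}`. -/
theorem interpolation {Y Ω : Type} (F : Finset Y) (Ω₀ : Finset Ω) (w : Ω → ℝ)
    (hw : ∀ v, 0 ≤ w v) (S : (Y → ℂ) → Ω → ℝ) (hS0 : ∀ f v, 0 ≤ S f v)
    (hS : ∀ f g v, S (f + g) v ≤ S f v + S g v) {p₀ p p₁ C₀ C₁ : ℝ} (h0 : 0 < p₀) (hp₀ : p₀ < p)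
    (hp₁ : p < p₁)
    (hC₀ : ∀ f, ∑ v ∈ Ω₀, w v * S f v ^ p₀ ≤ C₀ * ∑ y ∈ F, ‖f y‖ ^ p₀)
    (hC₁ : ∀ f, ∑ v ∈ Ω₀, w v * S f v ^ p₁ ≤ C₁ * ∑ y ∈ F, ‖f y‖ ^ p₁) (f : Y → ℂ) :
    ∑ v ∈ Ω₀, w v * S f v ^ p ≤
      2 ^ p * (p * (C₀ / (p - p₀) + C₁ / (p₁ - p))) * ∑ y ∈ F, ‖f y‖ ^ p := by
  have key := sum_rpow_le_of_distribution F Ω₀ (fun y => ‖f y‖) (fun v => S f v / 2) w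
    (fun y => norm_nonneg _) (fun v => div_nonneg (hS0 f v) (by positivity)) (p₁ := p₁)
    (A₀ := C₀) (A₁ := C₁) h0 hp₀ hp₁ (fun t ht => by
      rw [← sum_norm_highPart F t f h0, ← sum_norm_smallPart F t f (by linarith : 0 < p₁)]
      have h1 : ∑ v ∈ Ω₀ with t < S f v / 2, w v ≤
          ∑ v ∈ Ω₀ with t < S (highPart t f) v, w v +
            ∑ v ∈ Ω₀ with t < S (smallPart t f) v, w v := by
        rw [Finset.sum_filter, Finset.sum_filter, Finset.sum_filter, ← Finset.sum_add_distrib]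
        refine Finset.sum_le_sum fun v _ => ?_
        have h3 := hS (highPart t f) (smallPart t f) v
        rw [highPart_add_smallPart] at h3
        have := hw v
        split_ifs <;> linarith
      refine h1.trans (add_le_add ?_ ?_)
      · refine (sum_filter_lt_le Ω₀ w _ hw (hS0 _) h0 ht).trans ?_
        refine (mul_le_mul_of_nonneg_left (hC₀ (highPart t f)) (by positivity)).trans (le_of_eq ?_)
        ring
      · refine (sum_filter_lt_le Ω₀ w _ hw (hS0 _) (by linarith : 0 < p₁) ht).trans ?_
        refine (mul_le_mul_of_nonneg_left (hC₁ (smallPart t f)) (by positivity)).trans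
          (le_of_eq ?_)
        ring)
  have e : ∑ v ∈ Ω₀, w v * S f v ^ p = 2 ^ p * ∑ v ∈ Ω₀, w v * (S f v / 2) ^ p := by
    rw [Finset.mul_sum]
    refine Finset.sum_congr rfl fun v _ => ?_
    rw [Real.div_rpow (hS0 f v) (by positivity)]
    have : (2 : ℝ) ^ p ≠ 0 := by positivity
    field_simp
  rw [e, mul_assoc]
  exact mul_le_mul_of_nonneg_left key (by positivity)

/-! ### Bounds for the low part -/

section LowPart

/-- The left side is the form in which the interpolation lemmas, stated for weighted finite sums, are
applied to square functions. -/
theorem sum_weighted_expect {n : ℕ} {G : Fin n → Type} [∀ i, Fintype (G i)] {X : Type}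
    (X₀ : Finset X) (μ : X → ℝ) {T : Type} [Fintype T] (s : X → T → (∀ i, G i) → ℝ) :
    ∑ v ∈ X₀ ×ˢ (Finset.univ : Finset (T × ∀ i, G i)),
      μ v.1 / Fintype.card (∀ i, G i) * s v.1 v.2.1 v.2.2 =
    ∑ x ∈ X₀, μ x * ∑ t, 𝔼 c, s x t c := by
  rw [Finset.sum_product]
  refine Finset.sum_congr rfl fun x _ => ?_
  rw [Fintype.sum_prod_type, Finset.mul_sum]
  refine Finset.sum_congr rfl fun t _ => ?_
  rw [Fintype.expect_eq_sum_div_card, Finset.sum_div, Finset.mul_sum]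
  exact Finset.sum_congr rfl fun c _ => by ring

/-- The bound for the low part on `ℓ^{2r}`: the hypercontractive inequality reduces it to the square
functions, which are bounded on `ℓ²` and on `ℓ^∞`. -/
theorem exists_lowPart_even_bound (r D : ℕ) (hr : 2 ≤ r) : ∃ C : ℝ, 0 ≤ C ∧
    ∀ (n : ℕ) (G : Fin n → Type) [∀ i, Fintype (G i)] [∀ i, Nonempty (G i)]
      [∀ i, DecidableEq (G i)] (X Y : Type) (κ : X → Y → ℝ) (π : Y → ∀ i, G i) (μ : X → ℝ)
      (X₀ : Finset X) (F : Finset Y), (∀ x y, 0 ≤ κ x y) → (∀ x, Summable (κ x)) →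
      (∀ x, ∑' y, κ x y = 1) → (∀ x, IsEquidistributed (κ x) π (3 * D)) → (∀ x, 0 ≤ μ x) →
      (∀ y, ∑ x ∈ X₀, μ x * κ x y ≤ 1) → ∀ f : Y → ℂ,
      ∑ x ∈ X₀, μ x * 𝔼 c, ‖lowPart D (κ x) π F f c‖ ^ (2 * r) ≤
        C * ∑ y ∈ F, ‖f y‖ ^ (2 * r) := by
  obtain ⟨δ, h0, h1, hδ⟩ := exists_oneVariable r (by omega)
  have hr' : (2 : ℝ) < 2 * r := by
    have : (2 : ℝ) ≤ r := by exact_mod_cast hr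
    linarith
  set K : ℝ := 2 ^ D
  have hK : 0 < K := by positivity
  set C₁ : ℝ := (2 * K) ^ (2 * r : ℝ) * (2 * r * (K ^ (-(2 : ℝ)) * 2 ^ D / (2 * r - 2))) with hC₁
  have hC₁0 : 0 ≤ C₁ := by
    have : (0 : ℝ) < 2 * r - 2 := by linarith
    positivity
  refine ⟨(δ⁻¹ ^ D) ^ (2 * r) * C₁, by positivity, ?_⟩
  intro n G _ _ _ X Y κ π μ X₀ F hκ hs hm he hμ hμκ f
  have hL2 : ∀ f : Y → ℂ, ∑ x ∈ X₀, μ x * ∑ S, 𝔼 c, squareFun D (κ x) π F f S c ^ (2 : ℝ) ≤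
      2 ^ D * ∑ y ∈ F, ‖f y‖ ^ (2 : ℝ) := fun f => by
    simp only [Real.rpow_two]
    calc _ ≤ ∑ x ∈ X₀, μ x * (2 ^ D * ∑ y ∈ F, κ x y * ‖f y‖ ^ 2) :=
          Finset.sum_le_sum fun x _ => mul_le_mul_of_nonneg_left
            (sum_expect_squareFun_sq_le D F (hκ x) (hs x) (hm x) (he x) f) (hμ x)
      _ = 2 ^ D * ∑ y ∈ F, (∑ x ∈ X₀, μ x * κ x y) * ‖f y‖ ^ 2 := by
          simp only [Finset.mul_sum, Finset.sum_mul]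
          rw [Finset.sum_comm]
          exact Finset.sum_congr rfl fun y _ => Finset.sum_congr rfl fun x _ => by ring
      _ ≤ _ := by
          refine mul_le_mul_of_nonneg_left (Finset.sum_le_sum fun y _ => ?_) (by positivity)
          exact mul_le_of_le_one_left (by positivity) (hμκ y)
  have key := interpolation_top F (X₀ ×ˢ (Finset.univ : Finset ((Fin n → Bool) × ∀ i, G i)))
    (fun v => μ v.1 / Fintype.card (∀ i, G i)) (fun v => div_nonneg (hμ _) (Nat.cast_nonneg _))
    (fun f v => squareFun D (κ v.1) π F f v.2.1 v.2.2) (fun f v => squareFun_nonneg _ _ _ _ _ _ _)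
    (fun f g v => squareFun_add_le _ _ _ _ _ _ _ _) (p₀ := 2) (p := 2 * r) (C := 2 ^ D) (K := K)
    (by norm_num) hr' hK
    (fun f => by
      rw [sum_weighted_expect X₀ μ (fun x S c => squareFun D (κ x) π F f S c ^ (2 : ℝ))]
      exact hL2 f)
    (fun f t ht hf v _ => squareFun_le D F (hκ _) (hs _) (hm _) (he _) f t ht hf _ _) f
  rw [sum_weighted_expect X₀ μ (fun x S c => squareFun D (κ x) π F f S c ^ (2 * r : ℝ))] at key
  have hpow : ∀ t : ℝ, t ^ (2 * r : ℝ) = t ^ (2 * r) := fun t => by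
    rw [← Real.rpow_natCast]; push_cast; rfl
  rw [← hC₁] at key
  simp only [hpow] at key
  rw [mul_assoc]
  calc _ ≤ ∑ x ∈ X₀, μ x * ((δ⁻¹ ^ D) ^ (2 * r) *
        ∑ S, 𝔼 c, squareFun D (κ x) π F f S c ^ (2 * r)) :=
        Finset.sum_le_sum fun x _ => mul_le_mul_of_nonneg_left
          (expect_lowPart_pow_le D (κ x) π F hδ h0 h1 f) (hμ x)
    _ = (δ⁻¹ ^ D) ^ (2 * r) *
        ∑ x ∈ X₀, μ x * ∑ S, 𝔼 c, squareFun D (κ x) π F f S c ^ (2 * r) := by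
        rw [Finset.mul_sum]; exact Finset.sum_congr rfl fun x _ => by ring
    _ ≤ _ := by
        refine mul_le_mul_of_nonneg_left ?_ (by positivity)
        exact key

variable {n : ℕ} {G : Fin n → Type} [∀ i, Fintype (G i)] [∀ i, Nonempty (G i)]
  [∀ i, DecidableEq (G i)]

/-- The kernel of the projection onto sums of functions of at most `D` coordinates. -/
def lowKernel (D : ℕ) (c b : ∀ i, G i) : ℝ := ∑ A with wt A ≤ D, setKernel A c b

omit [∀ i, Nonempty (G i)] in
theorem lowKernel_comm (D : ℕ) (c b : ∀ i, G i) : lowKernel D c b = lowKernel D b c :=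
  Finset.sum_congr rfl fun A _ => setKernel_comm A c b

omit [∀ i, Nonempty (G i)] in
theorem lowPart_eq {Y : Type} (D : ℕ) (κ : Y → ℝ) (π : Y → ∀ i, G i) (F : Finset Y) (f : Y → ℂ)
    (c : ∀ i, G i) :
    lowPart D κ π F f c = ∑ y ∈ F, (κ y : ℂ) * f y * lowKernel D c (π y) := by
  simp only [lowPart, component, lowKernel, Complex.ofReal_sum, Finset.mul_sum]
  exact Finset.sum_comm

omit [∀ i, Nonempty (G i)] in
theorem lowPart_add {Y : Type} (D : ℕ) (κ : Y → ℝ) (π : Y → ∀ i, G i) (F : Finset Y)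
    (f g : Y → ℂ) (c : ∀ i, G i) :
    lowPart D κ π F (f + g) c = lowPart D κ π F f c + lowPart D κ π F g c := by
  simp only [lowPart_eq, Pi.add_apply, mul_add, add_mul, Finset.sum_add_distrib]

/-- The projection of a function on the product space onto the sums of functions of at most `D`
coordinates. -/
noncomputable def lowProj (D : ℕ) (H : (∀ i, G i) → ℂ) (b : ∀ i, G i) : ℂ :=
  𝔼 c, (lowKernel D c b : ℂ) * H c

omit [∀ i, Nonempty (G i)] in
theorem lowProj_mem (D : ℕ) (H : (∀ i, G i) → ℂ) : lowProj D H ∈ lowDegree G D := by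
  have : lowProj D H = ∑ A with wt A ≤ D, fun b => 𝔼 c, (setKernel A c b : ℂ) * H c := by
    funext b
    simp only [lowProj, lowKernel, Complex.ofReal_sum, Finset.sum_mul, Finset.sum_apply]
    exact Finset.expect_sum_comm _ _ _
  rw [this]
  refine sum_mem fun A hA => mem_lowDegree_of_dependsOn (Finset.mem_filter.1 hA).2 fun b b' h => ?_
  simp only [dependsOn_setKernel A _ h]

omit [∀ i, DecidableEq (G i)] in
theorem isEquidistributed_id (m : ℕ) :
    IsEquidistributed (fun _ : ∀ i, G i => (Fintype.card (∀ i, G i) : ℝ)⁻¹) id m := by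
  intro B _ Z _
  have : (Fintype.card (∀ i, G i) : ℂ) ≠ 0 := by exact_mod_cast Fintype.card_ne_zero
  rw [tsum_fintype, tsum_fintype, Fintype.expect_eq_sum_div_card, ← Finset.mul_sum]
  simp only [Finset.sum_const, Finset.card_univ, nsmul_eq_mul, id_eq]
  push_cast
  field_simp

/-- The projection is bounded on `L^{2r}`, being an instance of the low part. -/
theorem exists_lowProj_bound (r D : ℕ) (hr : 2 ≤ r) : ∃ C : ℝ, 0 ≤ C ∧
    ∀ (n : ℕ) (G : Fin n → Type) [∀ i, Fintype (G i)] [∀ i, Nonempty (G i)]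
      [∀ i, DecidableEq (G i)] (H : (∀ i, G i) → ℂ),
      𝔼 b, ‖lowProj D H b‖ ^ (2 * r) ≤ C * 𝔼 c, ‖H c‖ ^ (2 * r) := by
  obtain ⟨C, hC, h⟩ := exists_lowPart_even_bound r D hr
  refine ⟨C, hC, fun n G _ _ _ H => ?_⟩
  set N : ℝ := (Fintype.card (∀ i, G i) : ℝ) with hN
  have hN0 : 0 < N := by rw [hN]; exact_mod_cast Fintype.card_pos
  have := h n G Unit (∀ i, G i) (fun _ _ => N⁻¹) id (fun _ => N) Finset.univ Finset.univ
    (fun _ _ => by positivity) (fun _ => (hasSum_fintype _).summable)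
    (fun _ => by
      rw [tsum_fintype]
      simp only [Finset.sum_const, Finset.card_univ, nsmul_eq_mul, ← hN]
      exact mul_inv_cancel₀ hN0.ne')
    (fun _ => isEquidistributed_id _) (fun _ => hN0.le)
    (fun y => by simp [mul_inv_cancel₀ hN0.ne']) H
  have e : ∀ b, lowPart D (fun _ => N⁻¹) id Finset.univ H b = lowProj D H b := fun b => by
    rw [lowPart_eq, lowProj, Fintype.expect_eq_sum_div_card, Finset.sum_div]
    refine Finset.sum_congr rfl fun c _ => ?_
    rw [lowKernel_comm]
    simp only [hN, id]
    push_cast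
    ring
  simp only [e, Finset.univ_unique, Finset.sum_singleton] at this
  rw [Fintype.expect_eq_sum_div_card (fun c => ‖H c‖ ^ (2 * r)), mul_div_assoc',
    le_div_iff₀ hN0]
  linarith

omit [∀ i, Fintype (G i)] [∀ i, Nonempty (G i)] [∀ i, DecidableEq (G i)] in
theorem prod_mem_lowDegree {D m : ℕ} (Z : Fin m → (∀ i, G i) → ℂ) (hZ : ∀ j, Z j ∈ lowDegree G D) :
    ∏ j, Z j ∈ lowDegree G (m * D) := by
  induction m with
  | zero => simpa using one_mem_lowDegree (G := G) 0
  | succ m ih =>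
    rw [Fin.prod_univ_succ]
    refine lowDegree_mono (by rw [Nat.succ_mul, add_comm]) (mul_mem_lowDegree (hZ 0)
      (ih _ fun j => hZ j.succ))

/-- A family of probability weights on `Y` under which the residues `π y` are uniformly
distributed; so are they under products of `2r` of the weights. -/
structure UniformFamily {X Y : Type} (r D : ℕ) (κ : X → Y → ℝ) (π : Y → ∀ i, G i) : Prop where
  nonneg : ∀ x y, 0 ≤ κ x y
  summable : ∀ x, Summable (κ x)
  tsum_eq_one : ∀ x, ∑' y, κ x y = 1
  equi : ∀ x, IsEquidistributed (κ x) π (3 * D)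
  equi_prod : ∀ ξ ξ' : Fin r → X,
    IsEquidistributed (fun y => (∏ j, κ (ξ j) y) * ∏ j, κ (ξ' j) y) π (2 * r * D)

omit [∀ i, Nonempty (G i)] [∀ i, DecidableEq (G i)] in
theorem UniformFamily.le_one {X Y : Type} {r D : ℕ} {κ : X → Y → ℝ} {π : Y → ∀ i, G i}
    (h : UniformFamily r D κ π) (x : X) (y : Y) : κ x y ≤ 1 := by
  rw [← h.tsum_eq_one x]
  exact (h.summable x).le_tsum y fun _ _ => h.nonneg x _

omit [∀ i, Nonempty (G i)] [∀ i, DecidableEq (G i)] in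
/-- In even moments of sums of products of weights and functions of few coordinates, the residues
may be replaced by independent uniform variables. -/
theorem UniformFamily.tsum_norm_pow_eq {X Y : Type} {r D : ℕ} (hr : 1 ≤ r) {κ : X → Y → ℝ}
    {π : Y → ∀ i, G i} (h : UniformFamily r D κ π) (X₀ : Finset X) (μ : X → ℝ)
    (g : X → (∀ i, G i) → ℂ) (hg : ∀ x, g x ∈ lowDegree G D) :
    (Summable fun y => ‖∑ x ∈ X₀, ((μ x * κ x y : ℝ) : ℂ) * g x (π y)‖ ^ (2 * r)) ∧
    ∑' y, ‖∑ x ∈ X₀, ((μ x * κ x y : ℝ) : ℂ) * g x (π y)‖ ^ (2 * r) =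
      ∑' y, 𝔼 b, ‖∑ x ∈ X₀, ((μ x * κ x y : ℝ) : ℂ) * g x b‖ ^ (2 * r) := by
  classical
  let V : Y → (∀ i, G i) → ℂ := fun y b => ∑ x ∈ X₀, ((μ x * κ x y : ℝ) : ℂ) * g x b
  let P : Finset (Fin r → X) := Fintype.piFinset fun _ => X₀
  let m : (Fin r → X) → ℝ := fun ξ => ∏ j, μ (ξ j)
  let w : (Fin r → X) → (Fin r → X) → Y → ℝ := fun ξ ξ' y =>
    (∏ j, κ (ξ j) y) * ∏ j, κ (ξ' j) y
  let Z : (Fin r → X) → (Fin r → X) → (∀ i, G i) → ℂ := fun ξ ξ' =>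
    (∏ j, g (ξ j)) * star (∏ j, g (ξ' j))
  have hZ : ∀ ξ ξ', Z ξ ξ' ∈ lowDegree G (2 * r * D) := fun ξ ξ' =>
    lowDegree_mono (by rw [two_mul, add_mul]) (mul_mem_lowDegree
      (prod_mem_lowDegree _ fun j => hg _) (star_mem_lowDegree (prod_mem_lowDegree _ fun j => hg _)))
  have hprod1 : ∀ (ξ : Fin r → X) y, 0 ≤ ∏ j, κ (ξ j) y ∧ ∏ j, κ (ξ j) y ≤ κ (ξ ⟨0, hr⟩) y := by
    intro ξ y
    refine ⟨Finset.prod_nonneg fun j _ => h.nonneg _ _, ?_⟩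
    rw [← Finset.mul_prod_erase _ _ (Finset.mem_univ (⟨0, hr⟩ : Fin r))]
    exact mul_le_of_le_one_right (h.nonneg _ _)
      (Finset.prod_le_one (fun j _ => h.nonneg _ _) fun j _ => h.le_one _ _)
  have hw : ∀ ξ ξ', Summable (w ξ ξ') := fun ξ ξ' =>
    Summable.of_nonneg_of_le (fun y => mul_nonneg (hprod1 ξ y).1 (hprod1 ξ' y).1)
      (fun y => (mul_le_of_le_one_right (hprod1 ξ y).1
        ((hprod1 ξ' y).2.trans (h.le_one _ _))).trans (hprod1 ξ y).2) (h.summable (ξ ⟨0, hr⟩))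
  have hV : ∀ y b, ((‖V y b‖ ^ (2 * r) : ℝ) : ℂ) =
      ∑ ξ ∈ P, ∑ ξ' ∈ P, ((m ξ * m ξ' : ℝ) : ℂ) * ((w ξ ξ' y : ℂ) * Z ξ ξ' b) := by
    intro y b
    have e1 : V y b ^ r = ∑ ξ ∈ P, ((m ξ * ∏ j, κ (ξ j) y : ℝ) : ℂ) * ∏ j, g (ξ j) b := by
      have : V y b ^ r = ∏ _j : Fin r, V y b := by simp
      rw [this]
      simp only [V, P]
      rw [Finset.prod_univ_sum]
      refine Finset.sum_congr rfl fun ξ _ => ?_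
      rw [Finset.prod_mul_distrib, ← Complex.ofReal_prod, Finset.prod_mul_distrib]
    have e2 : ((‖V y b‖ ^ (2 * r) : ℝ) : ℂ) = V y b ^ r * star (V y b ^ r) := by
      rw [pow_mul, star_pow, ← mul_pow, Complex.star_def, Complex.mul_conj, Complex.normSq_eq_norm_sq]
      push_cast; rfl
    rw [e2, e1, star_sum, Finset.sum_mul_sum]
    refine Finset.sum_congr rfl fun ξ _ => Finset.sum_congr rfl fun ξ' _ => ?_
    simp only [w, Z, Pi.mul_apply, Pi.star_apply, Finset.prod_apply, star_mul',
      Complex.star_def, Complex.conj_ofReal]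
    push_cast
    ring
  have hsum1 : ∀ ξ ξ', Summable fun y =>
      ((m ξ * m ξ' : ℝ) : ℂ) * ((w ξ ξ' y : ℂ) * Z ξ ξ' (π y)) := fun ξ ξ' =>
    (summable_mul_comp (hw ξ ξ') π _).mul_left _
  have hsum2 : ∀ ξ ξ', Summable fun y =>
      ((m ξ * m ξ' : ℝ) : ℂ) * ((w ξ ξ' y : ℂ) * 𝔼 b, Z ξ ξ' b) := fun ξ ξ' =>
    ((Complex.hasSum_ofReal.2 (hw ξ ξ').hasSum).summable.mul_right _).mul_left _
  have hS : Summable fun y => ((‖V y (π y)‖ ^ (2 * r) : ℝ) : ℂ) := by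
    simp only [hV]
    exact summable_sum fun ξ _ => summable_sum fun ξ' _ => hsum1 ξ ξ'
  refine ⟨Complex.summable_ofReal.1 hS, ?_⟩
  apply Complex.ofReal_injective
  rw [Complex.ofReal_tsum, Complex.ofReal_tsum]
  have e3 : ∀ y, ((𝔼 b, ‖V y b‖ ^ (2 * r) : ℝ) : ℂ) =
      ∑ ξ ∈ P, ∑ ξ' ∈ P, ((m ξ * m ξ' : ℝ) : ℂ) * ((w ξ ξ' y : ℂ) * 𝔼 b, Z ξ ξ' b) := by
    intro y
    have : ((𝔼 b, ‖V y b‖ ^ (2 * r) : ℝ) : ℂ) = 𝔼 b, ((‖V y b‖ ^ (2 * r) : ℝ) : ℂ) := by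
      simp only [Fintype.expect_eq_sum_div_card]
      push_cast
      rfl
    rw [this]
    simp only [hV, Finset.expect_sum_comm, Finset.mul_expect]
  change ∑' y, ((‖V y (π y)‖ ^ (2 * r) : ℝ) : ℂ) = ∑' y, ((𝔼 b, ‖V y b‖ ^ (2 * r) : ℝ) : ℂ)
  simp only [hV, e3]
  rw [Summable.tsum_finsetSum fun ξ _ => summable_sum fun ξ' _ => hsum1 ξ ξ',
    Summable.tsum_finsetSum fun ξ _ => summable_sum fun ξ' _ => hsum2 ξ ξ']
  refine Finset.sum_congr rfl fun ξ _ => ?_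
  rw [Summable.tsum_finsetSum fun ξ' _ => hsum1 ξ ξ',
    Summable.tsum_finsetSum fun ξ' _ => hsum2 ξ ξ']
  refine Finset.sum_congr rfl fun ξ' _ => ?_
  rw [tsum_mul_left, tsum_mul_left, (h.equi_prod ξ ξ').tsum_eq (hw ξ ξ') (hZ ξ ξ'),
    tsum_mul_right]

end LowPart

/-! ### The low part at the dual exponent -/

section LowPartDual

variable {n : ℕ} {G : Fin n → Type} [∀ i, Fintype (G i)] [∀ i, Nonempty (G i)]
  [∀ i, DecidableEq (G i)]

/-- Jensen's inequality for weights of total mass at most one. -/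
theorem sum_mul_pow_le_of_sum_le_one {X : Type} (X₀ : Finset X) (w a : X → ℝ) (hw : ∀ x, 0 ≤ w x)
    (ha : ∀ x, 0 ≤ a x) (h : ∑ x ∈ X₀, w x ≤ 1) (m : ℕ) (hm : 1 ≤ m) :
    (∑ x ∈ X₀, w x * a x) ^ m ≤ ∑ x ∈ X₀, w x * a x ^ m := by
  have hm' : (1 : ℝ) ≤ m := by exact_mod_cast hm
  have hm0 : (m : ℝ) ≠ 0 := by positivity
  have h0 : 0 ≤ ∑ x ∈ X₀, w x := Finset.sum_nonneg fun x _ => hw x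
  have h1 : 0 ≤ ∑ x ∈ X₀, w x * a x := Finset.sum_nonneg fun x _ => mul_nonneg (hw x) (ha x)
  have h2 : 0 ≤ ∑ x ∈ X₀, w x * a x ^ (m : ℝ) :=
    Finset.sum_nonneg fun x _ => mul_nonneg (hw x) (Real.rpow_nonneg (ha x) _)
  have key := Real.inner_le_weight_mul_Lp_of_nonneg X₀ hm' w a hw ha
  have key2 : ∑ x ∈ X₀, w x * a x ≤ (∑ x ∈ X₀, w x * a x ^ (m : ℝ)) ^ ((m : ℝ)⁻¹) :=
    key.trans (mul_le_of_le_one_left (Real.rpow_nonneg h2 _) (Real.rpow_le_one h0 h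
      (sub_nonneg.2 (inv_le_one_of_one_le₀ hm'))))
  have key3 := Real.rpow_le_rpow h1 key2 (Nat.cast_nonneg m)
  rw [Real.rpow_inv_rpow h2 hm0] at key3
  simpa only [Real.rpow_natCast] using key3

/-- The absorption step of the duality argument: the unknown `N` reappears on the right side of
Hölder's inequality to a power less than one. -/
theorem rpow_le_of_le_rpow_mul {N A B q s : ℝ} (hN : 0 ≤ N) (hA : 0 ≤ A) (hB : 0 ≤ B)
    (hqs : q.HolderConjugate s) (h : N ≤ A ^ (1 / q) * (B * N) ^ (1 / s)) :
    N ≤ B ^ (q / s) * A := by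
  have hq := hqs.pos
  rcases hN.eq_or_lt with h0 | h0
  · rw [← h0]; positivity
  rw [Real.mul_rpow hB hN] at h
  have e : N = N ^ (1 / q) * N ^ (1 / s) := by
    rw [← Real.rpow_add h0]
    have := hqs.inv_add_inv_eq_one
    simp only [one_div, this, Real.rpow_one]
  have h1 : N ^ (1 / q) ≤ A ^ (1 / q) * B ^ (1 / s) := by
    have hs : 0 < N ^ (1 / s) := Real.rpow_pos_of_pos h0 _
    nth_rewrite 1 [e] at h
    rw [← mul_assoc] at h
    exact le_of_mul_le_mul_right h hs
  have h2 := Real.rpow_le_rpow (Real.rpow_nonneg hN _) h1 hq.le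
  rw [← Real.rpow_mul hN, Real.mul_rpow (Real.rpow_nonneg hA _) (Real.rpow_nonneg hB _),
    ← Real.rpow_mul hA, ← Real.rpow_mul hB, one_div_mul_cancel hq.ne', Real.rpow_one,
    Real.rpow_one] at h2
  calc N ≤ A * B ^ (1 / s * q) := h2
    _ = B ^ (q / s) * A := by rw [mul_comm, one_div_mul_eq_div]

omit [∀ i, Nonempty (G i)] in
/-- The bound of the adjoint of the low part on `ℓ^{2r}`. -/
theorem UniformFamily.sum_norm_adjoint_le {X Y : Type} {r D : ℕ} (hr : 1 ≤ r) {κ : X → Y → ℝ}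
    {π : Y → ∀ i, G i} (h : UniformFamily r D κ π) (X₀ : Finset X) (μ : X → ℝ)
    (hμ : ∀ x, 0 ≤ μ x) (hμκ : ∀ y, ∑ x ∈ X₀, μ x * κ x y ≤ 1) {C : ℝ}
    (hC : ∀ H : (∀ i, G i) → ℂ, 𝔼 b, ‖lowProj D H b‖ ^ (2 * r) ≤ C * 𝔼 c, ‖H c‖ ^ (2 * r))
    (H : X → (∀ i, G i) → ℂ) (F : Finset Y) :
    ∑ y ∈ F, ‖∑ x ∈ X₀, ((μ x * κ x y : ℝ) : ℂ) * lowProj D (H x) (π y)‖ ^ (2 * r) ≤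
      C * ∑ x ∈ X₀, μ x * 𝔼 c, ‖H x c‖ ^ (2 * r) := by
  obtain ⟨hs, ht⟩ := h.tsum_norm_pow_eq hr X₀ μ (fun x => lowProj D (H x)) fun x => lowProj_mem D _
  refine (hs.sum_le_tsum F fun y _ => by positivity).trans ?_
  rw [ht]
  have hsum : Summable fun y => ∑ x ∈ X₀, μ x * κ x y * 𝔼 b, ‖lowProj D (H x) b‖ ^ (2 * r) :=
    summable_sum fun x _ => ((h.summable x).mul_left _).mul_right _
  have hle : ∀ y, 𝔼 b, ‖∑ x ∈ X₀, ((μ x * κ x y : ℝ) : ℂ) * lowProj D (H x) b‖ ^ (2 * r) ≤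
      ∑ x ∈ X₀, μ x * κ x y * 𝔼 b, ‖lowProj D (H x) b‖ ^ (2 * r) := fun y => by
    simp only [Finset.mul_expect]
    rw [← Finset.expect_sum_comm]
    refine Finset.expect_le_expect fun b _ => ?_
    refine le_trans (pow_le_pow_left₀ (norm_nonneg _) (norm_sum_le _ _) _) ?_
    have hw : ∀ x, 0 ≤ μ x * κ x y := fun x => mul_nonneg (hμ x) (h.nonneg x y)
    simp only [norm_mul, Complex.norm_real, Real.norm_of_nonneg (hw _)]
    exact sum_mul_pow_le_of_sum_le_one X₀ _ _ hw (fun x => norm_nonneg _) (hμκ y) _ (by omega)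
  refine ((Summable.of_nonneg_of_le (fun y => Finset.expect_nonneg fun _ _ => by positivity) hle
    hsum).tsum_le_tsum hle hsum).trans ?_
  rw [Summable.tsum_finsetSum fun x _ => ((h.summable x).mul_left _).mul_right _, Finset.mul_sum]
  refine Finset.sum_le_sum fun x _ => ?_
  rw [tsum_mul_right, tsum_mul_left, h.tsum_eq_one, mul_one, mul_left_comm]
  exact mul_le_mul_of_nonneg_left (hC (H x)) (hμ x)

/-- The bound for the low part at the exponent dual to `2r`, by testing it against the functions that
give equality in Hölder's inequality. -/
theorem exists_lowPart_dual_bound (r D : ℕ) (hr : 2 ≤ r) (q : ℝ)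
    (hq : q.HolderConjugate (2 * r : ℝ)) : ∃ C : ℝ, 0 ≤ C ∧
    ∀ (n : ℕ) (G : Fin n → Type) [∀ i, Fintype (G i)] [∀ i, Nonempty (G i)]
      [∀ i, DecidableEq (G i)] (X Y : Type) (κ : X → Y → ℝ) (π : Y → ∀ i, G i) (μ : X → ℝ)
      (X₀ : Finset X) (F : Finset Y), UniformFamily r D κ π → (∀ x, 0 ≤ μ x) →
      (∀ y, ∑ x ∈ X₀, μ x * κ x y ≤ 1) → ∀ f : Y → ℂ,
      ∑ x ∈ X₀, μ x * 𝔼 c, ‖lowPart D (κ x) π F f c‖ ^ q ≤ C * ∑ y ∈ F, ‖f y‖ ^ q := by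
  obtain ⟨C, hC, h⟩ := exists_lowProj_bound r D hr
  refine ⟨C ^ (q / (2 * r)), by positivity, ?_⟩
  intro n G _ _ _ X Y κ π μ X₀ F hU hμ hμκ f
  have hq0 := hq.pos
  set J : X → (∀ i, G i) → ℂ := fun x => lowPart D (κ x) π F f with hJ
  -- the function for which Hölder's inequality is an equality
  let H : X → (∀ i, G i) → ℂ := fun x c => ((‖J x c‖ ^ (q - 2) : ℝ) : ℂ) * star (J x c)
  have hJH : ∀ x c, J x c * H x c = ((‖J x c‖ ^ q : ℝ) : ℂ) := by
    intro x c
    rcases eq_or_ne (J x c) 0 with h0 | h0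
    · simp [H, h0, Real.zero_rpow hq0.ne']
    · have hn : 0 < ‖J x c‖ := norm_pos_iff.2 h0
      simp only [H]
      rw [mul_left_comm, Complex.star_def, Complex.mul_conj, Complex.normSq_eq_norm_sq,
        ← Complex.ofReal_mul, ← Real.rpow_two, ← Real.rpow_add hn, sub_add_cancel]
  have hHn : ∀ x c, ‖H x c‖ ^ (2 * r) = ‖J x c‖ ^ q := by
    intro x c
    rcases eq_or_ne (J x c) 0 with h0 | h0
    · have hr0 : r ≠ 0 := by omega
      simp [H, h0, Real.zero_rpow hq0.ne', hr0]
    · have hn : 0 < ‖J x c‖ := norm_pos_iff.2 h0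
      have e : ‖H x c‖ = ‖J x c‖ ^ (q - 1) := by
        simp only [H, norm_mul, norm_star, Complex.norm_real]
        rw [Real.norm_of_nonneg (Real.rpow_nonneg hn.le _), ← Real.rpow_add_one hn.ne']
        congr 1; ring
      rw [e, ← Real.rpow_natCast, ← Real.rpow_mul hn.le]
      congr 1
      push_cast
      exact hq.sub_one_mul_conj
  set N := ∑ x ∈ X₀, μ x * 𝔼 c, ‖J x c‖ ^ q with hN
  have hN0 : 0 ≤ N := Finset.sum_nonneg fun x _ => mul_nonneg (hμ x)
    (Finset.expect_nonneg fun c _ => by positivity)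
  let W : Y → ℂ := fun y => ∑ x ∈ X₀, ((μ x * κ x y : ℝ) : ℂ) * lowProj D (H x) (π y)
  have hNW : (N : ℂ) = ∑ y ∈ F, f y * W y := by
    have e1 : ∀ x, ((𝔼 c, ‖J x c‖ ^ q : ℝ) : ℂ) = 𝔼 c, J x c * H x c := fun x => by
      simp only [hJH, Fintype.expect_eq_sum_div_card]
      push_cast
      rfl
    simp only [hN, Complex.ofReal_sum, Complex.ofReal_mul, e1, W, Finset.mul_sum]
    rw [Finset.sum_comm]
    refine Finset.sum_congr rfl fun x _ => ?_
    simp only [hJ, lowPart_eq, Finset.sum_mul]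
    rw [Finset.expect_sum_comm, Finset.mul_sum]
    refine Finset.sum_congr rfl fun y _ => ?_
    simp only [lowProj, Finset.mul_expect]
    exact Finset.expect_congr rfl fun c _ => by ring
  have hW : ∑ y ∈ F, ‖W y‖ ^ (2 * r : ℝ) ≤ C * N := by
    have := hU.sum_norm_adjoint_le (by omega) X₀ μ hμ hμκ (h n G) H F
    simp only [hHn] at this
    have e : ∀ t : ℝ, t ^ (2 * r : ℝ) = t ^ (2 * r) := fun t => by
      rw [← Real.rpow_natCast]; push_cast; rfl
    simp only [e]
    exact this
  have hHol : N ≤ (∑ y ∈ F, ‖f y‖ ^ q) ^ (1 / q) * (C * N) ^ (1 / (2 * r : ℝ)) := by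
    calc N = ‖(N : ℂ)‖ := by rw [Complex.norm_real, Real.norm_of_nonneg hN0]
      _ ≤ ∑ y ∈ F, ‖f y‖ * ‖W y‖ := by
          rw [hNW]; exact (norm_sum_le _ _).trans (le_of_eq (by simp only [norm_mul]))
      _ ≤ (∑ y ∈ F, ‖f y‖ ^ q) ^ (1 / q) * (∑ y ∈ F, ‖W y‖ ^ (2 * r : ℝ)) ^ (1 / (2 * r : ℝ)) :=
          Real.inner_le_Lp_mul_Lq_of_nonneg F hq (fun _ _ => norm_nonneg _)
            (fun _ _ => norm_nonneg _)
      _ ≤ _ := by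
          refine mul_le_mul_of_nonneg_left (Real.rpow_le_rpow
            (Finset.sum_nonneg fun _ _ => by positivity) hW (by positivity)) (by positivity)
  exact rpow_le_of_le_rpow_mul hN0 (Finset.sum_nonneg fun _ _ => by positivity) hC hq hHol

/-- The bound for the low part on `ℓ^p`, by interpolation between `ℓ^{2r}` and the dual exponent. -/
theorem exists_lowPart_bound (r D : ℕ) (hr : 2 ≤ r) (p : ℝ) (hp1 : 2 * r / (2 * r - 1) < p)
    (hp2 : p < 2 * r) : ∃ C : ℝ, 0 ≤ C ∧
    ∀ (n : ℕ) (G : Fin n → Type) [∀ i, Fintype (G i)] [∀ i, Nonempty (G i)]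
      [∀ i, DecidableEq (G i)] (X Y : Type) (κ : X → Y → ℝ) (π : Y → ∀ i, G i) (μ : X → ℝ)
      (X₀ : Finset X) (F : Finset Y), UniformFamily r D κ π → (∀ x, 0 ≤ μ x) →
      (∀ y, ∑ x ∈ X₀, μ x * κ x y ≤ 1) → ∀ f : Y → ℂ,
      ∑ x ∈ X₀, μ x * 𝔼 c, ‖lowPart D (κ x) π F f c‖ ^ p ≤ C * ∑ y ∈ F, ‖f y‖ ^ p := by
  have hr' : (2 : ℝ) ≤ r := by exact_mod_cast hr
  have hq : (2 * r / (2 * r - 1) : ℝ).HolderConjugate (2 * r : ℝ) := by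
    have := Real.HolderConjugate.conjExponent (p := (2 * r : ℝ)) (by linarith)
    exact this.symm
  obtain ⟨C₀, hC₀, h₀⟩ := exists_lowPart_dual_bound r D hr _ hq
  obtain ⟨C₁, hC₁, h₁⟩ := exists_lowPart_even_bound r D hr
  set q : ℝ := 2 * r / (2 * r - 1) with hqdef
  have hq0 : 0 < q := hq.pos
  refine ⟨2 ^ p * (p * (C₀ / (p - q) + C₁ / (2 * r - p))), ?_, ?_⟩
  · have : 0 < p - q := sub_pos.2 hp1
    have : 0 < 2 * r - p := sub_pos.2 hp2
    have : 0 < p := hq0.trans hp1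
    positivity
  intro n G _ _ _ X Y κ π μ X₀ F hU hμ hμκ f
  have conv : ∀ s : X → (∀ i, G i) → ℝ,
      ∑ v ∈ X₀ ×ˢ (Finset.univ : Finset (Unit × ∀ i, G i)),
        μ v.1 / Fintype.card (∀ i, G i) * s v.1 v.2.2 = ∑ x ∈ X₀, μ x * 𝔼 c, s x c := fun s => by
    rw [sum_weighted_expect X₀ μ (fun x (_ : Unit) c => s x c)]
    simp
  have key := interpolation F (X₀ ×ˢ (Finset.univ : Finset (Unit × ∀ i, G i)))
    (fun v => μ v.1 / Fintype.card (∀ i, G i)) (fun v => div_nonneg (hμ _) (Nat.cast_nonneg _))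
    (fun f v => ‖lowPart D (κ v.1) π F f v.2.2‖) (fun f v => norm_nonneg _)
    (fun f g v => by rw [lowPart_add]; exact norm_add_le _ _) (p₀ := q) (p := p) (p₁ := 2 * r)
    (C₀ := C₀) (C₁ := C₁) hq0 hp1 hp2
    (fun f => by
      rw [conv fun x c => ‖lowPart D (κ x) π F f c‖ ^ q]
      exact h₀ n G X Y κ π μ X₀ F hU hμ hμκ f)
    (fun f => by
      rw [conv fun x c => ‖lowPart D (κ x) π F f c‖ ^ (2 * r : ℝ)]
      have := h₁ n G X Y κ π μ X₀ F hU.nonneg hU.summable hU.tsum_eq_one hU.equi hμ hμκ f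
      have e : ∀ t : ℝ, t ^ (2 * r : ℝ) = t ^ (2 * r) := fun t => by
        rw [← Real.rpow_natCast]; push_cast; rfl
      simp only [e]
      exact this) f
  rwa [conv fun x c => ‖lowPart D (κ x) π F f c‖ ^ p] at key

end LowPartDual

/-! ### Band-limited functions on the line -/

/-- `W` is a Schwartz function whose Fourier transform vanishes outside `(-τ, τ)`. -/
def BandLimited (τ : ℝ) (W : ℝ → ℂ) : Prop :=
  ∃ S : 𝓢(ℝ, ℂ), ⇑S = W ∧ ∀ ξ : ℝ, τ ≤ |ξ| → 𝓕 W ξ = 0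

theorem fourier_fourier (S : 𝓢(ℝ, ℂ)) (ξ : ℝ) : (𝓕 (𝓕 S : 𝓢(ℝ, ℂ)) : 𝓢(ℝ, ℂ)) ξ = S (-ξ) := by
  conv_rhs => rw [← FourierTransform.fourierInv_fourier_eq (F := 𝓢(ℝ, ℂ)) S]
  rw [SchwartzMap.fourierInv_coe, Real.fourierInv_eq_fourier_neg, neg_neg, SchwartzMap.fourier_coe]

/-- The Fourier transform of a product is a convolution, so that the bands add. -/
theorem BandLimited.mul {τ₁ τ₂ : ℝ} {W₁ W₂ : ℝ → ℂ} (h₁ : BandLimited τ₁ W₁)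
    (h₂ : BandLimited τ₂ W₂) : BandLimited (τ₁ + τ₂) (fun t => W₁ t * W₂ t) := by
  obtain ⟨S₁, rfl, h₁⟩ := h₁
  obtain ⟨S₂, rfl, h₂⟩ := h₂
  set B := ContinuousLinearMap.mul ℂ ℂ
  have key : 𝓕 (SchwartzMap.convolution B (𝓕⁻ S₁) (𝓕⁻ S₂)) = SchwartzMap.pairing B S₁ S₂ := by
    rw [SchwartzMap.fourier_convolution]; simp
  have hfun : (fun t => S₁ t * S₂ t) = ⇑(SchwartzMap.pairing B S₁ S₂) := by
    ext t; simp [SchwartzMap.pairing_apply_apply, B]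
  refine ⟨SchwartzMap.pairing B S₁ S₂, hfun.symm, fun ξ hξ => ?_⟩
  rw [hfun, ← SchwartzMap.fourier_coe, ← key]
  rw [fourier_fourier, SchwartzMap.convolution_apply]
  by_contra hne
  obtain ⟨a, ha, b, hb, hab⟩ := Set.mem_add.1 (support_convolution_subset _ hne)
  have hz : ∀ (S : 𝓢(ℝ, ℂ)) (τ : ℝ), (∀ ξ : ℝ, τ ≤ |ξ| → 𝓕 (⇑S) ξ = 0) →
      ∀ a ∈ Function.support (⇑(𝓕⁻ S : 𝓢(ℝ, ℂ))), |a| < τ := by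
    intro S τ h a ha
    by_contra hlt
    refine ha ?_
    rw [SchwartzMap.fourierInv_coe, Real.fourierInv_eq_fourier_neg]
    exact h _ (by rw [abs_neg]; exact not_lt.1 hlt)
  have h3 := hz S₁ τ₁ h₁ a ha
  have h4 := hz S₂ τ₂ h₂ b hb
  have : |ξ| ≤ |a| + |b| := by
    rw [← abs_neg, ← hab]; exact abs_add_le a b
  linarith

theorem BandLimited.prod {ι : Type*} {τ : ℝ} {W : ι → ℝ → ℂ} (s : Finset ι) (hs : s.Nonempty)
    (h : ∀ i ∈ s, BandLimited τ (W i)) :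
    BandLimited (s.card * τ) (fun t => ∏ i ∈ s, W i t) := by
  classical
  induction hs using Finset.Nonempty.cons_induction with
  | singleton a => simpa using h a (by simp)
  | cons a s ha hs ih =>
    have h1 := h a (by simp)
    have h2 := ih fun i hi => h i (by simp [hi])
    have := h1.mul h2
    simp only [Finset.prod_cons, Finset.card_cons]
    convert this using 1
    push_cast; ring

theorem BandLimited.const_mul {τ : ℝ} {W : ℝ → ℂ} (h : BandLimited τ W) (a : ℂ) :
    BandLimited τ (fun t => a * W t) := by
  obtain ⟨S, rfl, h⟩ := h
  have hf : (fun t => a * S t) = ⇑(a • S) := by ext t; simp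
  refine ⟨a • S, hf.symm, fun ξ hξ => ?_⟩
  rw [hf, ← SchwartzMap.fourier_coe, FourierTransform.fourier_smul, smul_apply,
    SchwartzMap.fourier_coe, h ξ hξ, smul_zero]

/-- The composition of a Schwartz function with the map `t ↦ a + b t`. -/
theorem exists_schwartz_affine (S : 𝓢(ℝ, ℂ)) (a : ℝ) {b : ℝ} (hb : b ≠ 0) :
    ∃ S' : 𝓢(ℝ, ℂ), ⇑S' = fun t => S (a + b * t) := by
  let e : ℝ ≃L[ℝ] ℝ := ContinuousLinearEquiv.smulLeft (Units.mk0 b hb)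
  refine ⟨SchwartzMap.compCLMOfContinuousLinearEquiv ℂ e (S.compSubConstCLM ℂ (-a)), ?_⟩
  ext t
  simp [e, Units.smul_def, add_comm]

theorem fourier_affine (S : 𝓢(ℝ, ℂ)) (a : ℝ) {b : ℝ} (hb : b ≠ 0) (ξ : ℝ) :
    𝓕 (fun t => S (a + b * t)) ξ =
      ((|b⁻¹| : ℝ) : ℂ) * Complex.exp (2 * Real.pi * Complex.I * (ξ * a / b)) * 𝓕 S (ξ / b) := by
  rw [SchwartzMap.fourier_coe, Real.fourier_real_eq_integral_exp_smul,
    Real.fourier_real_eq_integral_exp_smul]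
  set g : ℝ → ℂ := fun t => Complex.exp (2 * Real.pi * Complex.I * (ξ * a / b)) *
    (Complex.exp (↑(-2 * Real.pi * t * (ξ / b)) * Complex.I) • S t) with hg
  have h1 : (fun v : ℝ => Complex.exp (↑(-2 * Real.pi * v * ξ) * Complex.I) • S (a + b * v))
      = fun v => g (a + b * v) := by
    ext v
    have hb' : (b : ℂ) ≠ 0 := by exact_mod_cast hb
    simp only [hg, smul_eq_mul]
    rw [← mul_assoc, ← Complex.exp_add]
    congr 2
    push_cast
    field_simp
    ring
  rw [h1]
  have h2 : ∫ v, g (a + b * v) = |b⁻¹| • ∫ t, g t := by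
    have h3 := Measure.integral_comp_mul_left (fun v => g (a + v)) b
    rw [h3]
    congr 1
    exact integral_add_left_eq_self g a
  rw [h2, hg, MeasureTheory.integral_const_mul, Complex.real_smul]
  push_cast
  ring

theorem BandLimited.affine {τ : ℝ} {W : ℝ → ℂ} (h : BandLimited τ W) (a : ℝ) {b : ℝ}
    (hb : b ≠ 0) : BandLimited (|b| * τ) (fun t => W (a + b * t)) := by
  obtain ⟨S, rfl, h⟩ := h
  obtain ⟨S', hS'⟩ := exists_schwartz_affine S a hb
  refine ⟨S', hS', fun ξ hξ => ?_⟩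
  rw [fourier_affine S a hb, SchwartzMap.fourier_coe, h, mul_zero]
  rw [abs_div, le_div_iff₀ (abs_pos.2 hb)]
  linarith

theorem summable_int_schwartz (S : 𝓢(ℝ, ℂ)) : Summable fun n : ℤ => ‖S n‖ := by
  have h := S.isBigO_cocompact_rpow (-2)
  have h2 := (h.comp_tendsto Int.tendsto_coe_cofinite).norm_left
  refine summable_of_isBigO (g := fun n : ℤ => |(n : ℝ)| ^ (-2 : ℝ)) ?_ h2
  exact Real.summable_abs_int_rpow (by norm_num)

theorem BandLimited.summable {τ : ℝ} {W : ℝ → ℂ} (h : BandLimited τ W) :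
    Summable fun n : ℤ => W n := by
  obtain ⟨S, rfl, h⟩ := h
  exact (summable_int_schwartz S).of_norm

/-- Sampling a band-limited function along the integers gives its integral exactly. -/
theorem BandLimited.tsum_eq {τ : ℝ} {W : ℝ → ℂ} (h : BandLimited τ W) (hτ : τ ≤ 1) :
    ∑' n : ℤ, W n = ∫ t, W t := by
  obtain ⟨S, rfl, h⟩ := h
  have h0 := S.tsum_eq_tsum_fourier 0
  simp only [zero_add] at h0
  rw [h0, tsum_eq_single 0]
  · rw [SchwartzMap.fourier_coe, Real.fourier_real_eq_integral_exp_smul]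
    simp
  · intro n hn
    rw [SchwartzMap.fourier_coe, h, zero_mul]
    refine hτ.trans ?_
    exact_mod_cast Int.one_le_abs hn

/-- Sampling along an arithmetic progression. -/
theorem BandLimited.tsum_progression {τ : ℝ} {W : ℝ → ℂ} (h : BandLimited τ W) {M : ℕ}
    (hM : 0 < M) (hτ : M * τ ≤ 1) (a : ℤ) :
    ∑' n : ℤ, W ((a + M * n : ℤ) : ℝ) = (M : ℂ)⁻¹ * ∫ t, W t := by
  have hM' : (M : ℝ) ≠ 0 := by positivity
  have h1 := (h.affine a hM').tsum_eq (by simpa using hτ)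
  push_cast
  rw [h1]
  have h3 := Measure.integral_comp_mul_left (fun v => W (a + v)) M
  rw [h3, integral_add_left_eq_self W (a : ℝ), abs_of_nonneg (by positivity), Complex.real_smul]
  push_cast; rfl

/-! ### The band-limited kernel -/

/-- A nonnegative even Schwartz function `ker` of integral one on the line, whose Fourier transform
`hat` is supported in `[-1, 1]` and has no zeros inside. -/
structure BandKernel where
  /-- The kernel. -/
  ker : ℝ → ℝ
  /-- Its Fourier transform. -/
  hat : ℝ → ℝ
  /-- The Schwartz function underlying `ker`. -/
  S : 𝓢(ℝ, ℂ)
  coe_eq : ⇑S = fun t => (ker t : ℂ)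
  nonneg : ∀ t, 0 ≤ ker t
  even : ∀ t, ker (-t) = ker t
  fourier_eq : ∀ ξ, 𝓕 (⇑S) ξ = (hat ξ : ℂ)
  smooth : ContDiff ℝ ∞ hat
  hat_eq_zero : ∀ ξ, 1 ≤ |ξ| → hat ξ = 0
  hat_ne_zero : ∀ ξ, |ξ| < 1 → hat ξ ≠ 0
  hat_zero : hat 0 = 1

theorem exists_bandKernel : Nonempty BandKernel := by
  -- `ker` is the square of the Fourier transform of an even bump `h`, so that `hat` is proportional
  -- to `h ⋆ h`.
  let hb : ContDiffBump (0 : ℝ) := ⟨1/4, 1/2, by norm_num, by norm_num⟩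
  have hsm : ContDiff ℝ ∞ (fun t : ℝ => ((hb t : ℝ) : ℂ)) :=
    Complex.ofRealCLM.contDiff.comp hb.contDiff
  have hcs : HasCompactSupport (fun t : ℝ => ((hb t : ℝ) : ℂ)) :=
    hb.hasCompactSupport.comp_left (g := fun x : ℝ => (x : ℂ)) (by simp)
  let H : 𝓢(ℝ, ℂ) := hcs.toSchwartzMap hsm
  have hH : ⇑H = fun t : ℝ => ((hb t : ℝ) : ℂ) := rfl
  have heven : ∀ t, hb (-t) = hb t := fun t => hb.neg t
  have hreal : ∀ ξ, (starRingEnd ℂ) (𝓕 (⇑H) ξ) = 𝓕 (⇑H) ξ := by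
    intro ξ
    rw [Real.fourier_real_eq_integral_exp_smul, ← integral_conj]
    conv_rhs => rw [← integral_neg_eq_self]
    congr 1
    ext t
    rw [hH]
    simp only [smul_eq_mul, map_mul, Complex.conj_ofReal, heven, ← Complex.exp_conj, Complex.conj_I]
    congr 2
    push_cast; ring
  have hHeven : ∀ ξ, 𝓕 (⇑H) (-ξ) = 𝓕 (⇑H) ξ := by
    intro ξ
    rw [Real.fourier_real_eq_integral_exp_smul, Real.fourier_real_eq_integral_exp_smul]
    conv_rhs => rw [← integral_neg_eq_self]
    congr 1
    ext t
    rw [hH]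
    simp only [heven]
    congr 3
    push_cast; ring
  set ψ : ℝ → ℝ := fun ξ => (𝓕 (⇑H) ξ).re with hψ
  have hψ' : ∀ ξ, 𝓕 (⇑H) ξ = (ψ ξ : ℂ) := fun ξ =>
    (Complex.conj_eq_iff_re.1 (hreal ξ)).symm
  set B := ContinuousLinearMap.mul ℂ ℂ
  set conv : ℝ → ℝ := fun ξ => ∫ t, hb t * hb (ξ - t) with hconv
  have hconvC : ∀ ξ, SchwartzMap.convolution B H H ξ = (conv ξ : ℂ) := by
    intro ξ
    rw [SchwartzMap.convolution_apply, convolution_def, hconv, ← integral_complex_ofReal]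
    simp [B, hH]
  have hcont : ∀ ξ, Continuous fun t => hb t * hb (ξ - t) := fun ξ =>
    hb.continuous.mul (hb.continuous.comp (by fun_prop))
  have hpos : ∀ ξ, |ξ| < 1 → 0 < conv ξ := by
    intro ξ hξ
    refine (hcont ξ).integral_pos_of_hasCompactSupport_nonneg_nonzero
      (hb.hasCompactSupport.mul_right) (fun t => mul_nonneg hb.nonneg hb.nonneg) (x := ξ / 2) ?_
    have h1 : 0 < hb (ξ / 2) := hb.pos_of_mem_ball (by
      rw [mem_ball_zero_iff, Real.norm_eq_abs, abs_div]
      simp only [hb, Nat.abs_ofNat]; linarith)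
    have h2 : ξ - ξ / 2 = ξ / 2 := by ring
    rw [h2]; positivity
  have hzero : ∀ ξ, 1 ≤ |ξ| → conv ξ = 0 := by
    intro ξ hξ
    rw [hconv]
    refine integral_eq_zero_of_ae (Filter.Eventually.of_forall fun t => ?_)
    simp only [Pi.zero_apply, mul_eq_zero]
    by_contra! hne
    have h1 : |t| < 1/2 := by
      by_contra! hlt
      exact hne.1 (hb.zero_of_le_dist (by simpa [hb] using hlt))
    have h2 : |ξ - t| < 1/2 := by
      by_contra! hlt
      exact hne.2 (hb.zero_of_le_dist (by simpa [hb] using hlt))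
    have h3 : |ξ| ≤ |ξ - t| + |t| := by
      simpa using abs_add_le (ξ - t) t
    linarith
  set c := conv 0 with hc
  have hc0 : 0 < c := hpos 0 (by simp)
  set P : 𝓢(ℝ, ℂ) := 𝓕 (SchwartzMap.convolution B H H) with hP
  have hPv : ∀ t, P t = ((ψ t ^ 2 : ℝ) : ℂ) := by
    intro t
    rw [hP, SchwartzMap.fourier_convolution, SchwartzMap.pairing_apply_apply]
    simp only [SchwartzMap.fourier_coe, hψ', B, ContinuousLinearMap.mul_apply']
    push_cast; ring
  have hψe : ∀ t, ψ (-t) = ψ t := fun t => by simp only [hψ, hHeven]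
  have hconve : ∀ ξ, conv (-ξ) = conv ξ := by
    intro ξ
    simp only [hconv]
    conv_rhs => rw [← integral_neg_eq_self]
    congr 1
    ext t
    rw [heven, ← heven (-ξ - t)]
    congr 2; ring
  have hPF : ∀ ξ, 𝓕 (⇑P) ξ = (conv ξ : ℂ) := by
    intro ξ
    rw [← hconve, ← hconvC]
    rw [← fourier_fourier]
    rfl
  refine ⟨⟨fun t => c⁻¹ * ψ t ^ 2, fun ξ => c⁻¹ * conv ξ, (c⁻¹ : ℂ) • P, ?_, ?_, ?_, ?_, ?_, ?_, ?_, ?_⟩⟩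
  · ext t; rw [smul_apply, hPv]; push_cast; rfl
  · intro t; positivity
  · intro t; simp only [hψe]
  · intro ξ
    rw [← SchwartzMap.fourier_coe, FourierTransform.fourier_smul, smul_apply,
      SchwartzMap.fourier_coe, hPF]
    push_cast; rfl
  · refine contDiff_const.mul ?_
    have : conv = fun ξ => (SchwartzMap.convolution B H H ξ).re := by ext ξ; simp [hconvC]
    rw [this]
    exact Complex.reCLM.contDiff.comp (SchwartzMap.smooth _ _)
  · intro ξ hξ; simp [hzero ξ hξ]
  · intro ξ hξ; exact mul_ne_zero (inv_ne_zero hc0.ne') (hpos ξ hξ).ne'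
  · exact inv_mul_cancel₀ hc0.ne'

namespace BandKernel

variable (k : BandKernel)

theorem bandLimited : BandLimited 1 (fun t => (k.ker t : ℂ)) :=
  ⟨k.S, k.coe_eq, fun ξ hξ => by rw [← k.coe_eq, k.fourier_eq, k.hat_eq_zero ξ hξ, Complex.ofReal_zero]⟩

theorem integral_ker : ∫ t, (k.ker t : ℂ) = 1 := by
  have h := k.fourier_eq 0
  rw [k.hat_zero, Real.fourier_real_eq_integral_exp_smul, k.coe_eq] at h
  simpa using h

/-- The dilated kernel `ε ker(ε n)` on the integers. -/
def dilate (ε : ℝ) (n : ℤ) : ℝ := ε * k.ker (ε * n)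

theorem dilate_nonneg {ε : ℝ} (hε : 0 < ε) (n : ℤ) : 0 ≤ k.dilate ε n :=
  mul_nonneg hε.le (k.nonneg _)

theorem dilate_neg (ε : ℝ) (n : ℤ) : k.dilate ε (-n) = k.dilate ε n := by
  simp [dilate, k.even]

theorem summable_dilate {ε : ℝ} (hε : 0 < ε) : Summable (k.dilate ε) := by
  have h := ((k.bandLimited.affine 0 hε.ne').const_mul ε).summable
  have h2 := (Complex.hasSum_re h.hasSum).summable
  refine h2.congr fun n => ?_
  rw [dilate, ← Complex.ofReal_mul, Complex.ofReal_re, zero_add]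

/-- The reproducing property of the dilated kernel at low frequencies: only the frequency zero
survives in Poisson's formula. -/
theorem tsum_dilate_mul_exp {ε : ℝ} (hε : 0 < ε) (hε' : ε ≤ 1 / 2) {x : ℝ} (hx : |x| ≤ 1 / 2) :
    ∑' n : ℤ, (k.dilate ε n : ℂ) * Complex.exp (2 * Real.pi * Complex.I * (x * n : ℝ)) =
      k.hat (x / ε) := by
  obtain ⟨T, hT⟩ := exists_schwartz_affine (𝓕 k.S) 0 (b := ε⁻¹) (inv_ne_zero hε.ne')
  have hT' : ∀ s, T s = k.hat (s / ε) := by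
    intro s
    rw [hT]; simp only [SchwartzMap.fourier_coe, k.fourier_eq]
    congr 2; rw [zero_add, div_eq_inv_mul]
  have hFT : ∀ n : ℤ, 𝓕 T n = k.dilate ε n := by
    intro n
    rw [SchwartzMap.fourier_coe, hT, fourier_affine _ 0 (inv_ne_zero hε.ne')]
    rw [fourier_fourier, k.coe_eq]
    simp only [inv_inv, abs_of_pos hε, k.even, dilate]
    simp [mul_comm]
  have h0 := T.tsum_eq_tsum_fourier x
  have h1 : ∑' n : ℤ, T (x + n) = k.hat (x / ε) := by
    rw [tsum_eq_single 0, hT']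
    · simp
    · intro n hn
      rw [hT', k.hat_eq_zero, Complex.ofReal_zero]
      rw [abs_div, abs_of_pos hε, le_div_iff₀ hε]
      have h3 : (1 : ℝ) ≤ |(n : ℝ)| := by exact_mod_cast Int.one_le_abs hn
      have h4 : |(n : ℝ)| ≤ |x + n| + |x| := by
        simpa using abs_sub (x + n) x
      linarith
  rw [← h1, h0]
  refine tsum_congr fun n => ?_
  rw [hFT, fourier_coe_apply]
  congr 2
  push_cast
  simp
  ring

end BandKernel

/-! ### Equidistribution of residues of lattice points -/

theorem summable_and_tsum_prod {d : ℕ} {β : Type*} (v : Fin d → β → ℂ)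
    (hv : ∀ j, Summable fun t => ‖v j t‖) :
    (Summable fun y : Fin d → β => ‖∏ j, v j (y j)‖) ∧
      ∑' y : Fin d → β, ∏ j, v j (y j) = ∏ j, ∑' t, v j t := by
  induction d with
  | zero =>
    constructor
    · exact (hasSum_fintype _).summable
    · simp
  | succ d ih =>
    obtain ⟨ih1, ih2⟩ := ih (fun j => v j.succ) fun j => hv j.succ
    let e := Fin.consEquiv fun _ : Fin (d + 1) => β
    have hp : ∀ z : β × (Fin d → β), ∏ j, v j (e z j) = v 0 z.1 * ∏ j, v j.succ (z.2 j) := by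
      intro z
      rw [Fin.prod_univ_succ]
      simp [e, Fin.consEquiv]
    constructor
    · rw [← e.summable_iff]
      have := summable_mul_of_summable_norm (f := fun t => ‖v 0 t‖)
        (g := fun y : Fin d → β => ‖∏ j, v j.succ (y j)‖) (by simpa using hv 0) (by simpa using ih1)
      refine this.congr fun z => ?_
      simp only [Function.comp_apply]
      rw [hp, norm_mul]
    · rw [← e.tsum_eq, Fin.prod_univ_succ, ← ih2, tsum_mul_tsum_of_summable_norm (hv 0) ih1]
      exact tsum_congr hp

theorem tsum_ite_eq_progression (W : ℤ → ℂ) {M : ℕ} (hM : 0 < M) (a : ℤ) :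
    (∑' n : ℤ, if (n : ZMod M) = (a : ZMod M) then W n else 0) = ∑' n : ℤ, W (a + M * n) := by
  have hinj : Function.Injective fun n : ℤ => a + M * n := by
    intro x y h
    simpa [hM.ne'] using h
  rw [← hinj.tsum_eq]
  · refine tsum_congr fun n => ?_
    simp
  · intro n hn
    rw [Function.mem_support] at hn
    have h1 : (n : ZMod M) = a := by
      by_contra h; exact hn (if_neg h)
    obtain ⟨c, hc⟩ := (ZMod.intCast_eq_intCast_iff_dvd_sub a n M).1 h1.symm
    exact ⟨c, by simp only; rw [← hc]; ring⟩

/-- A band-limited weight is exactly equidistributed modulo `M`, if `M` is at most the inverse of the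
band: in Poisson's formula only the zero frequency contributes. -/
theorem BandLimited.tsum_ite_eq {τ : ℝ} {W : ℝ → ℂ} (h : BandLimited τ W) {M : ℕ} (hM : 0 < M)
    (hτ : M * τ ≤ 1) (b : ZMod M) :
    (∑' n : ℤ, if (n : ZMod M) = b then W n else 0) = (M : ℂ)⁻¹ * ∫ t, W t := by
  obtain ⟨a, rfl⟩ := ZMod.intCast_surjective b
  rw [tsum_ite_eq_progression (fun n : ℤ => W n) hM, h.tsum_progression hM hτ]

/-- A band-limited weight, restricted to residue classes modulo `M₀`, is equidistributed in the
residue classes modulo any `M₁` prime to `M₀`. -/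
theorem BandLimited.tsum_ite_residue {τ : ℝ} {W : ℝ → ℂ} (h : BandLimited τ W) {M₀ M₁ : ℕ}
    (hM₀ : 0 < M₀) (hM₁ : 0 < M₁) (hcop : M₀.Coprime M₁) (hτ0 : 0 ≤ τ)
    (hτ : M₀ * M₁ * τ ≤ 1) {ι : Type*} [Nonempty ι] (c : ι → ZMod M₀) [∀ t : ℤ, Decidable (∀ s, (t : ZMod M₀) = c s)]
    (b : ZMod M₁) :
    (∑' t : ℤ, if (t : ZMod M₁) = b then (if ∀ s, (t : ZMod M₀) = c s then W t else 0) else 0) =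
      (M₁ : ℂ)⁻¹ * ∑' t : ℤ, if ∀ s, (t : ZMod M₀) = c s then W t else 0 := by
  obtain ⟨s₀⟩ := ‹Nonempty ι›
  by_cases hc : ∀ s, c s = c s₀
  · have hiff : ∀ t : ℤ, (∀ s, (t : ZMod M₀) = c s) ↔ (t : ZMod M₀) = c s₀ :=
      fun t => ⟨fun h => h s₀, fun h s => by rw [h, hc s]⟩
    have h1 : (M₀ : ℝ) * τ ≤ 1 := by
      refine le_trans ?_ hτ
      have : (1 : ℝ) ≤ M₁ := by exact_mod_cast hM₁
      nlinarith [mul_nonneg (Nat.cast_nonneg (α := ℝ) M₀) hτ0]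
    let e := ZMod.chineseRemainder hcop
    have hcrt : ∀ t : ℤ, (t : ZMod (M₀ * M₁)) = e.symm (c s₀, b) ↔
        (t : ZMod M₁) = b ∧ (t : ZMod M₀) = c s₀ := by
      intro t
      rw [RingEquiv.eq_symm_apply, map_intCast]
      simp [Prod.ext_iff, and_comm]
    have h2 : ∀ t : ℤ, (if (t : ZMod M₁) = b then
        (if ∀ s, (t : ZMod M₀) = c s then W t else 0) else 0) =
        if (t : ZMod (M₀ * M₁)) = e.symm (c s₀, b) then W t else 0 := by
      intro t
      simp only [hiff]
      by_cases ha : (t : ZMod M₁) = b <;> by_cases hb : (t : ZMod M₀) = c s₀ <;>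
        simp [hcrt, ha, hb]
    have h3 : ∀ t : ℤ, (if ∀ s, (t : ZMod M₀) = c s then W t else 0) =
        if (t : ZMod M₀) = c s₀ then W t else 0 := by
      intro t
      simp only [hiff]
    simp_rw [h2, h3]
    rw [h.tsum_ite_eq (Nat.mul_pos hM₀ hM₁) (by push_cast; linarith), h.tsum_ite_eq hM₀ h1]
    push_cast
    rw [mul_inv]; ring
  · have h0 : ∀ t : ℤ, ¬ ∀ s, (t : ZMod M₀) = c s := by
      intro t ht
      exact hc fun s => by rw [← ht s, ← ht s₀]
    simp [h0]

section Residues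

variable {d n : ℕ} (q : Fin n → ℕ)

/-- The residues of a lattice point modulo `q₁, …, q_n`. -/
def residues (y : Fin d → ℤ) : ∀ i : Fin n, Fin d → ZMod (q i) := fun _ j => y j

/-- Equidistribution for product weights. By the Chinese remainder theorem, a function of the residues
modulo the `q i`, `i ∈ B`, is a function of the residue modulo their product, so that the claim reduces
to equidistribution of each one-dimensional factor modulo this product. -/
theorem isEquidistributed_residues [∀ i, NeZero (q i)]
    (hq : Pairwise (Function.onFun Nat.Coprime q)) (m : ℕ) (w : (Fin d → ℤ) → ℝ)
    (v : Fin d → ℤ → ℂ) (hwv : ∀ y, (w y : ℂ) = ∏ j, v j (y j))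
    (hv : ∀ j, Summable fun t => ‖v j t‖)
    (hequi : ∀ B : Finset (Fin n), B.card ≤ m → ∀ j, ∀ b : ZMod (∏ i : B, q i),
      (∑' t : ℤ, if (t : ZMod (∏ i : B, q i)) = b then v j t else 0) =
        ((∏ i : B, q i : ℕ) : ℂ)⁻¹ * ∑' t, v j t) :
    IsEquidistributed w (residues q (d := d)) m := by
  classical
  intro B hB Z hZ
  let G : Fin n → Type := fun i => Fin d → ZMod (q i)
  let M : ℕ := ∏ i : B, q i
  let e := Equiv.piEquivPiSubtypeProd (· ∈ B) G
  let H : Type := ∀ i : {i // i ∈ B}, G i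
  let ext : H → ∀ i, G i := fun h => e.symm (h, fun _ => 0)
  have hext : ∀ (h : H) (r), Z (e.symm (h, r)) = Z (ext h) := by
    intro h r
    refine hZ fun i hi => ?_
    have hi' : i ∈ B := hi
    simp [ext, e, Equiv.piEquivPiSubtypeProd, hi']
  let crt := ZMod.prodEquivPi (fun i : B => q i)
    (fun i j hij => hq (fun h => hij (Subtype.ext h)))
  let b : H → Fin d → ZMod M := fun h j => crt.symm fun i => h i j
  have hb : ∀ (h : H) (y : Fin d → ℤ), (e (residues q y)).1 = h ↔
      ∀ j, ((y j : ℤ) : ZMod M) = b h j := by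
    intro h y
    simp only [b, RingEquiv.eq_symm_apply, map_intCast]
    constructor
    · rintro rfl j
      ext i
      simp [e, residues, Equiv.piEquivPiSubtypeProd]
    · intro hj
      ext i j
      have := congrFun (hj j) i
      simp only [e, residues, Equiv.piEquivPiSubtypeProd, Equiv.coe_fn_mk]
      rw [← this]; simp
  have hZy : ∀ y : Fin d → ℤ, Z (residues q y) =
      ∑ h : H, (if (e (residues q y)).1 = h then Z (ext h) else 0) := by
    intro y
    rw [Finset.sum_ite_eq, if_pos (Finset.mem_univ _), ← hext _ (e (residues q y)).2]
    simp
  have hterm : ∀ (h : H) (y : Fin d → ℤ),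
      (w y : ℂ) * (if (e (residues q y)).1 = h then Z (ext h) else 0) =
      (∏ j, if ((y j : ℤ) : ZMod M) = b h j then v j (y j) else 0) * Z (ext h) := by
    intro h y
    by_cases hy : (e (residues q y)).1 = h
    · rw [if_pos hy, hwv]
      congr 1
      exact Finset.prod_congr rfl fun j _ => (if_pos ((hb h y).1 hy j)).symm
    · rw [if_neg hy, mul_zero]
      rw [hb] at hy
      push Not at hy
      obtain ⟨j, hj⟩ := hy
      rw [Finset.prod_eq_zero (Finset.mem_univ j) (if_neg hj), zero_mul]
  have hs : ∀ (h : H) (j), Summable fun t : ℤ => ‖if (t : ZMod M) = b h j then v j t else 0‖ := by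
    intro h j
    refine (hv j).of_nonneg_of_le (fun _ => norm_nonneg _) fun t => ?_
    split_ifs
    · exact le_rfl
    · simp
  have hprod := fun h => summable_and_tsum_prod
    (fun j (t : ℤ) => if (t : ZMod M) = b h j then v j t else 0) (hs h)
  have hw : ∑' y, (w y : ℂ) = ∏ j, ∑' t, v j t := by
    simp_rw [hwv]; exact (summable_and_tsum_prod v hv).2
  simp_rw [hZy, Finset.mul_sum, hterm]
  rw [Summable.tsum_finsetSum fun h _ => ((hprod h).1.of_norm.mul_right _)]
  simp_rw [tsum_mul_right, (hprod _).2, M, hequi B hB, Finset.prod_mul_distrib]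
  rw [← hw]
  have hcard : (Fintype.card H : ℂ) = ((M : ℂ)) ^ d := by
    simp [H, G, M, Fintype.card_pi, ZMod.card, Finset.prod_pow]
  have hexp : 𝔼 c, Z c = 𝔼 h : H, Z (ext h) := by
    rw [Fintype.expect_equiv e Z (fun z => Z (e.symm z)) (fun c => by simp),
      ← Finset.univ_product_univ, Finset.expect_product]
    refine Finset.expect_congr rfl fun h _ => ?_
    simp_rw [hext]
    exact Fintype.expect_const _
  rw [hexp, Fintype.expect_eq_sum_div_card, hcard, Finset.prod_const, Finset.card_univ,
    Fintype.card_fin, ← Finset.mul_sum]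
  rw [inv_pow]; ring

end Residues

/-! ### The kernels on the lattice -/

namespace BandKernel

variable (k : BandKernel) {d : ℕ}

/-- The kernel at `x` and the residue class `c` modulo `M₀`: a bump of width `ε⁻¹` around `x`,
restricted to the lattice points in the class. -/
def latticeKernel (M₀ : ℕ) (ε : Fin d → ℝ) (x : (Fin d → ℤ) × (Fin d → ZMod M₀))
    (y : Fin d → ℤ) : ℝ :=
  ∏ j, ((M₀ : ℝ) * k.dilate (ε j) (x.1 j - y j) * if (y j : ZMod M₀) = x.2 j then 1 else 0)

theorem latticeKernel_nonneg (M₀ : ℕ) {ε : Fin d → ℝ} (hε : ∀ j, 0 < ε j)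
    (x : (Fin d → ℤ) × (Fin d → ZMod M₀)) (y : Fin d → ℤ) : 0 ≤ k.latticeKernel M₀ ε x y := by
  refine Finset.prod_nonneg fun j _ => ?_
  have := k.dilate_nonneg (hε j) (x.1 j - y j)
  positivity

/-- The bump factor of the kernel in one coordinate. -/
def bump (M₀ : ℕ) (ε : ℝ) (x : ℤ) (t : ℝ) : ℂ := ((M₀ : ℂ) * ε) * k.ker (ε * x + -ε * t)

theorem bandLimited_bump (M₀ : ℕ) {ε : ℝ} (hε : 0 < ε) (x : ℤ) :
    BandLimited ε (k.bump M₀ ε x) := by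
  have := (k.bandLimited.affine (ε * x) (b := -ε) (by linarith)).const_mul ((M₀ : ℂ) * ε)
  rwa [abs_neg, abs_of_pos hε, mul_one] at this

theorem bump_intCast (M₀ : ℕ) (ε : ℝ) (x t : ℤ) :
    k.bump M₀ ε x t = ((M₀ * k.dilate ε (x - t) : ℝ) : ℂ) := by
  simp only [bump, dilate]
  push_cast
  rw [mul_assoc]
  congr 4
  ring

theorem integral_bump (M₀ : ℕ) {ε : ℝ} (hε : 0 < ε) (x : ℤ) : ∫ t, k.bump M₀ ε x t = M₀ := by
  simp only [bump]
  rw [integral_const_mul]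
  have h3 := Measure.integral_comp_mul_left (fun v => (k.ker (ε * x + v) : ℂ)) (-ε)
  rw [h3, integral_add_left_eq_self (fun v => (k.ker v : ℂ)) (ε * x : ℝ), k.integral_ker, abs_inv,
    abs_neg, abs_of_pos hε]
  have : (ε : ℂ) ≠ 0 := by exact_mod_cast hε.ne'
  simp
  field_simp

/-- The product of several kernels in one coordinate. -/
theorem prod_bump_eq (M₀ : ℕ) (ε : ℝ) {ι : Type*} [Fintype ι] (x : ι → ℤ) (c : ι → ZMod M₀)
    (t : ℤ) [Decidable (∀ s, (t : ZMod M₀) = c s)] :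
    ((∏ s, ((M₀ : ℝ) * k.dilate ε (x s - t) * if (t : ZMod M₀) = c s then 1 else 0) : ℝ) : ℂ) =
      if ∀ s, (t : ZMod M₀) = c s then ∏ s, k.bump M₀ ε (x s) t else 0 := by
  split_ifs with h
  · simp_rw [bump_intCast]
    push_cast
    refine Finset.prod_congr rfl fun s _ => ?_
    simp [h s]
  · push Not at h
    obtain ⟨s, hs⟩ := h
    rw [Finset.prod_eq_zero (Finset.mem_univ s) (by simp [hs])]
    simp

/-- The sum over all points of the kernel in one coordinate. -/
theorem tsum_bump_ite (M₀ : ℕ) (hM₀ : 0 < M₀) {ε : ℝ} (hε : 0 < ε) (hεM : M₀ * ε ≤ 1)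
    (x : ℤ) (c : ZMod M₀) :
    (∑' t : ℤ, if (t : ZMod M₀) = c then k.bump M₀ ε x t else 0) = 1 := by
  rw [(k.bandLimited_bump M₀ hε x).tsum_ite_eq hM₀ hεM, k.integral_bump M₀ hε]
  exact inv_mul_cancel₀ (by exact_mod_cast hM₀.ne')

theorem summable_and_tsum_latticeKernel (M₀ : ℕ) (hM₀ : 0 < M₀) {ε : Fin d → ℝ}
    (hε : ∀ j, 0 < ε j) (hεM : ∀ j, M₀ * ε j ≤ 1) (x : (Fin d → ℤ) × (Fin d → ZMod M₀)) :
    Summable (k.latticeKernel M₀ ε x) ∧ ∑' y, k.latticeKernel M₀ ε x y = 1 := by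
  classical
  have hs : ∀ j, Summable fun t : ℤ =>
      ‖if (t : ZMod M₀) = x.2 j then k.bump M₀ (ε j) (x.1 j) t else 0‖ := by
    intro j
    refine ((k.bandLimited_bump M₀ (hε j) (x.1 j)).summable.norm).of_nonneg_of_le
      (fun _ => norm_nonneg _) fun t => ?_
    split_ifs
    · exact le_rfl
    · simp
  have h := summable_and_tsum_prod (fun j (t : ℤ) =>
    if (t : ZMod M₀) = x.2 j then k.bump M₀ (ε j) (x.1 j) t else 0) hs
  have heq : ∀ y, (k.latticeKernel M₀ ε x y : ℂ) = ∏ j,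
      if (y j : ZMod M₀) = x.2 j then k.bump M₀ (ε j) (x.1 j) (y j) else 0 := by
    intro y
    rw [latticeKernel]; push_cast
    refine Finset.prod_congr rfl fun j _ => ?_
    rw [bump_intCast]
    split_ifs <;> simp
  simp_rw [← heq] at h
  refine ⟨?_, ?_⟩
  · refine h.1.congr fun y => ?_
    rw [Complex.norm_real, Real.norm_of_nonneg (k.latticeKernel_nonneg M₀ hε x y)]
  · have h2 := h.2
    simp_rw [k.tsum_bump_ite M₀ hM₀ (hε _) (hεM _), Finset.prod_const_one] at h2
    exact_mod_cast h2

/-- A product of kernels indexed by `ι` has `|ι|` times the band of one kernel, and restricts the points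
to one residue class modulo `M₀` or to none. -/
theorem isEquidistributed_prod_latticeKernel (M₀ : ℕ) (hM₀ : 0 < M₀) {ε : Fin d → ℝ}
    (hε : ∀ j, 0 < ε j) {n : ℕ} (q : Fin n → ℕ) [∀ i, NeZero (q i)]
    (hq : Pairwise (Function.onFun Nat.Coprime q)) (hqM : ∀ i, M₀.Coprime (q i)) (m : ℕ)
    {ι : Type*} [Fintype ι] [Nonempty ι]
    (hεM : ∀ B : Finset (Fin n), B.card ≤ m → ∀ j,
      M₀ * (∏ i : B, q i : ℕ) * (Fintype.card ι * ε j) ≤ 1)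
    (ξ : ι → (Fin d → ℤ) × (Fin d → ZMod M₀)) :
    IsEquidistributed (fun y => ∏ s, k.latticeKernel M₀ ε (ξ s) y) (residues q (d := d)) m := by
  classical
  have hW : ∀ j, BandLimited (Fintype.card ι * ε j) fun t => ∏ s, k.bump M₀ (ε j) ((ξ s).1 j) t :=
    fun j => BandLimited.prod _ Finset.univ_nonempty fun s _ => k.bandLimited_bump M₀ (hε j) _
  refine isEquidistributed_residues q hq m _ (fun j t => if ∀ s, (t : ZMod M₀) = (ξ s).2 j then
    ∏ s, k.bump M₀ (ε j) ((ξ s).1 j) t else 0) ?_ ?_ ?_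
  · intro y
    simp_rw [latticeKernel]
    rw [Finset.prod_comm]
    push_cast
    refine Finset.prod_congr rfl fun j _ => ?_
    rw [← k.prod_bump_eq]
    push_cast; rfl
  · intro j
    refine (hW j).summable.norm.of_nonneg_of_le (fun _ => norm_nonneg _) fun t => ?_
    split_ifs
    · exact le_rfl
    · rw [norm_zero]; exact norm_nonneg _
  · intro B hB j b
    have hpos : 0 < ∏ i : B, q i := Finset.prod_pos fun i _ => Nat.pos_of_ne_zero (NeZero.ne (q i))
    have hcop : M₀.Coprime (∏ i : B, q i) := Nat.Coprime.prod_right fun i _ => hqM i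
    have hτ0 : 0 ≤ Fintype.card ι * ε j := mul_nonneg (Nat.cast_nonneg _) (hε j).le
    exact (hW j).tsum_ite_residue hM₀ hpos hcop hτ0 (hεM B hB j) (fun s => (ξ s).2 j) b

/-- The kernels form a uniform family as soon as `ε` is small compared with the moduli. -/
theorem uniformFamily (M₀ : ℕ) (hM₀ : 0 < M₀) {ε : Fin d → ℝ} (hε : ∀ j, 0 < ε j) {n : ℕ}
    (q : Fin n → ℕ) [∀ i, NeZero (q i)] (hq : Pairwise (Function.onFun Nat.Coprime q))
    (hqM : ∀ i, M₀.Coprime (q i)) {r D : ℕ} (hr : 2 ≤ r)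
    (hεM : ∀ B : Finset (Fin n), B.card ≤ 2 * r * D → ∀ j,
      M₀ * (∏ i : B, q i : ℕ) * (2 * r * ε j) ≤ 1) :
    UniformFamily r D (k.latticeKernel M₀ ε) (residues q (d := d)) := by
  have hεM₁ : ∀ j, M₀ * ε j ≤ 1 := by
    intro j
    refine le_trans ?_ (hεM ∅ (by simp) j)
    have h1 : (1 : ℝ) ≤ 2 * r := by
      have : (2 : ℝ) ≤ r := by exact_mod_cast hr
      linarith
    have h2 : (0 : ℝ) ≤ M₀ * ε j := mul_nonneg (Nat.cast_nonneg _) (hε j).le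
    simp
    nlinarith
  refine ⟨fun x y => k.latticeKernel_nonneg M₀ hε x y,
    fun x => (k.summable_and_tsum_latticeKernel M₀ hM₀ hε hεM₁ x).1,
    fun x => (k.summable_and_tsum_latticeKernel M₀ hM₀ hε hεM₁ x).2, fun x => ?_, fun ξ ξ' => ?_⟩
  · have := k.isEquidistributed_prod_latticeKernel M₀ hM₀ hε q hq hqM (3 * D) (ι := Unit)
      (fun B hB j => ?_) fun _ => x
    · simpa using this
    · refine le_trans ?_ (hεM B (hB.trans (by gcongr; omega)) j)
      have : (1 : ℝ) ≤ 2 * r := by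
        have : (2 : ℝ) ≤ r := by exact_mod_cast hr
        linarith
      simp only [Fintype.card_unit, Nat.cast_one]
      have := (hε j).le
      gcongr
  · have : Nonempty (Fin r ⊕ Fin r) := ⟨Sum.inl ⟨0, by omega⟩⟩
    have := k.isEquidistributed_prod_latticeKernel M₀ hM₀ hε q hq hqM (2 * r * D)
      (ι := Fin r ⊕ Fin r) (fun B hB j => ?_) (Sum.elim ξ ξ')
    · simpa [Fintype.prod_sum_type] using this
    · have := hεM B hB j
      simp only [Fintype.card_sum, Fintype.card_fin]
      rw [← two_mul]
      push_cast at this ⊢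
      exact this

/-- The sum over the residues removes the restriction to a class, and what remains is the total mass
of the kernel without restriction, as a function of its centre. -/
theorem sum_latticeKernel_le (M₀ : ℕ) [NeZero M₀] {ε : Fin d → ℝ} (hε : ∀ j, 0 < ε j)
    (hε' : ∀ j, ε j ≤ 1) (X₀ : Finset (Fin d → ℤ)) (y : Fin d → ℤ) :
    ∑ x ∈ X₀ ×ˢ (Finset.univ : Finset (Fin d → ZMod M₀)),
      ((M₀ : ℝ) ^ d)⁻¹ * k.latticeKernel M₀ ε x y ≤ 1 := by
  have hM : (M₀ : ℝ) ≠ 0 := by exact_mod_cast NeZero.ne M₀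
  rw [Finset.sum_product]
  have h1 : ∀ x, ∑ c : Fin d → ZMod M₀, ((M₀ : ℝ) ^ d)⁻¹ * k.latticeKernel M₀ ε (x, c) y =
      k.latticeKernel 1 ε (y, fun j => (x j : ZMod 1)) x := by
    intro x
    rw [← Finset.mul_sum, Finset.sum_eq_single (fun j => (y j : ZMod M₀))]
    · simp only [latticeKernel, if_true, mul_one, Finset.prod_mul_distrib, Finset.prod_const,
        Finset.card_univ, Fintype.card_fin, Nat.cast_one, one_mul]
      rw [inv_mul_cancel_left₀ (pow_ne_zero _ hM)]
      refine Finset.prod_congr rfl fun j _ => ?_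
      rw [← k.dilate_neg, neg_sub]
    · intro c _ hc
      obtain ⟨j, hj⟩ := Function.ne_iff.1 hc
      exact Finset.prod_eq_zero (Finset.mem_univ j) (by simp [Ne.symm hj])
    · simp
  simp_rw [h1]
  have h2 := k.summable_and_tsum_latticeKernel 1 one_pos hε (by simpa using hε') (y, fun _ => 0)
  have h3 : ∀ x : Fin d → ℤ, (fun j => (x j : ZMod 1)) = fun _ => 0 := fun x => by
    ext j; exact Subsingleton.elim (α := ZMod 1) _ _
  simp_rw [h3]
  rw [← h2.2]
  exact h2.1.sum_le_tsum _ fun x _ => k.latticeKernel_nonneg 1 hε _ x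

end BandKernel

/-! ### The denominators of the special rationals -/

theorem exists_eq_prod_pow {ι : Type*} {p : ι → ℕ} (hp : ∀ i, (p i).Prime) (D : ℕ) (A : Finset ι)
    {w : ℕ} (hw : w ∣ ∏ i ∈ A, p i ^ D) :
    ∃ γ : ι → ℕ, (∀ i, γ i ≤ D) ∧ w = ∏ i ∈ A, p i ^ γ i := by
  classical
  induction A using Finset.induction_on generalizing w with
  | empty => exact ⟨0, by simp, by simpa using hw⟩
  | insert a A ha ih =>
    rw [Finset.prod_insert ha] at hw
    obtain ⟨w₁, w₂, h1, h2, rfl⟩ := exists_dvd_and_dvd_of_dvd_mul hw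
    obtain ⟨γ, hγ, rfl⟩ := ih h2
    obtain ⟨g, hg, rfl⟩ := (Nat.dvd_prime_pow (hp a)).1 h1
    refine ⟨Function.update γ a g, fun i => ?_, ?_⟩
    · by_cases hi : i = a
      · subst hi; simpa using hg
      · simpa [hi] using hγ i
    · rw [Finset.prod_insert ha, Function.update_self]
      congr 1
      refine Finset.prod_congr rfl fun i hi => ?_
      rw [Function.update_of_ne (by rintro rfl; exact ha hi)]

/-- The denominators are the divisors of the numbers `Q₀ ∏_{i ∈ A} p_i ^ D` with `|A| ≤ D`. -/
theorem mem_denominators_iff {ρ : ℝ} {N n : ℕ} {p : Fin n → ℕ} (hinj : Function.Injective p)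
    (hrange : Set.range p = primeSet ρ N) (q : ℕ) :
    q ∈ denominators ρ N ↔
      ∃ A : Finset (Fin n), A.card ≤ bigD ρ ∧ q ∣ bigQ ρ N * ∏ i ∈ A, p i ^ bigD ρ := by
  classical
  have hp : ∀ i, (p i).Prime := fun i => by
    have : p i ∈ primeSet ρ N := hrange ▸ Set.mem_range_self i
    exact this.1
  constructor
  · rintro ⟨Q, w, hQ, hw, rfl⟩
    rcases hw with ⟨k, -, hk, p', γ, hinj', hmem, hγ, rfl⟩ | hw
    · choose σ hσ using fun i => (hrange ▸ hmem i : p' i ∈ Set.range p)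
      have hσi : Function.Injective σ := fun i j h => hinj' (by rw [← hσ i, ← hσ j, h])
      refine ⟨Finset.univ.image σ, Finset.card_image_le.trans (by simpa using hk),
        Nat.mul_dvd_mul hQ ?_⟩
      rw [Finset.prod_image (fun i _ j _ h => hσi h)]
      refine Finset.prod_dvd_prod_of_dvd _ _ fun i _ => ?_
      rw [hσ]
      exact pow_dvd_pow _ (hγ i).2
    · rw [Set.mem_singleton_iff] at hw
      exact ⟨∅, by simp, by simpa [hw] using hQ⟩
  · rintro ⟨A, hA, hq⟩
    obtain ⟨Q, w, hQ, hw, rfl⟩ := exists_dvd_and_dvd_of_dvd_mul hq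
    obtain ⟨γ, hγ, rfl⟩ := exists_eq_prod_pow hp _ A hw
    refine ⟨Q, _, hQ, ?_, rfl⟩
    have hsub : ∏ i ∈ A, p i ^ γ i = ∏ i ∈ A with 1 ≤ γ i, p i ^ γ i := by
      rw [Finset.prod_filter_of_ne]
      intro i _ hi
      by_contra h0
      exact hi (by rw [Nat.lt_one_iff.1 (not_le.1 h0), pow_zero])
    set A' := A.filter fun i => 1 ≤ γ i with hA'
    rw [hsub]
    rcases A'.eq_empty_or_nonempty with h0 | hne
    · right; simp [h0]
    · left
      refine ⟨A'.card, Finset.card_pos.2 hne, (Finset.card_le_card (Finset.filter_subset _ _)).trans hA,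
        fun i => p (A'.equivFin.symm i), fun i => γ (A'.equivFin.symm i), ?_, ?_, ?_, ?_⟩
      · intro i j h
        exact A'.equivFin.symm.injective (Subtype.ext (hinj h))
      · intro i
        exact hrange ▸ Set.mem_range_self _
      · intro i
        exact ⟨(Finset.mem_filter.1 (A'.equivFin.symm i).2).2, hγ _⟩
      · rw [Equiv.prod_comp A'.equivFin.symm (fun i : A' => p i ^ γ i), Finset.prod_coe_sort A'
          (fun i => p i ^ γ i)]

/-! ### The exponential sum over the special rationals -/

section Rationals

variable {d n : ℕ} (Q₀ : ℕ) (q : Fin n → ℕ)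

/-- The coordinates `i` for which `q i` does not divide the vector `a`. -/
def nondivisors (a : Fin d → ℕ) (i : Fin n) : Bool := ¬ ∀ j, q i ∣ a j

theorem prod_dvd_iff {ι : Type*} [Fintype ι] {f : ι → ℕ}
    (hf : Pairwise (Function.onFun Nat.Coprime f)) (m : ℕ) :
    ∏ i, f i ∣ m ↔ ∀ i, f i ∣ m :=
  ⟨fun h i => (Finset.dvd_prod_of_mem f (Finset.mem_univ i)).trans h,
    fun h => Fintype.prod_dvd_of_isRelPrime (fun _ _ hij => Nat.coprime_iff_isRelPrime.1 (hf hij)) h⟩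

/-- The special rationals, written over the common denominator `Q = bigQ ρ N * ∏ i, p i ^ bigD ρ`, are
the `a / Q` such that at most `bigD ρ` of the prime powers do not divide `a`. -/
theorem mem_specialRationals_iff {ρ : ℝ} {N : ℕ} {p : Fin n → ℕ} (hinj : Function.Injective p)
    (hrange : Set.range p = primeSet ρ N) (u : EuclideanSpace ℝ (Fin d)) :
    u ∈ specialRationals d ρ N ↔
      ∃ a : Fin d → ℕ, (∀ j, 1 ≤ a j ∧ a j ≤ bigQ ρ N * ∏ i, p i ^ bigD ρ) ∧
        wt (nondivisors (fun i => p i ^ bigD ρ) a) ≤ bigD ρ ∧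
        u = WithLp.toLp 2 fun j => (a j : ℝ) / ((bigQ ρ N * ∏ i, p i ^ bigD ρ : ℕ) : ℝ) := by
  classical
  have hp : ∀ i, (p i).Prime := fun i => by
    have : p i ∈ primeSet ρ N := hrange ▸ Set.mem_range_self i
    exact this.1
  set D := bigD ρ
  set Q₀ := bigQ ρ N with hQ₀
  have hQ₀pos : 0 < Q₀ := pow_pos (Nat.factorial_pos _) _
  have hqpos : ∀ i, 0 < p i ^ D := fun i => pow_pos (hp i).pos _
  set Q := Q₀ * ∏ i, p i ^ D with hQ
  have hQpos : 0 < Q := Nat.mul_pos hQ₀pos (Finset.prod_pos fun i _ => hqpos i)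
  have hcop : Pairwise (Function.onFun Nat.Coprime fun i => p i ^ D) := fun i j hij =>
    Nat.Coprime.pow _ _ ((Nat.coprime_primes (hp i) (hp j)).2 fun h => hij (hinj h))
  have hsplit : ∀ A : Finset (Fin n), Q = (Q₀ * ∏ i ∈ A, p i ^ D) * ∏ i ∈ Aᶜ, p i ^ D := by
    intro A
    rw [mul_assoc, Finset.prod_mul_prod_compl]
  have hwt : ∀ a : Fin d → ℕ, wt (nondivisors (fun i => p i ^ D) a) =
      (Finset.univ.filter fun i => ¬ ∀ j, p i ^ D ∣ a j).card := by
    intro a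
    rw [wt, Finset.card_filter]
    refine Finset.sum_congr rfl fun i _ => ?_
    by_cases h : ∀ j, p i ^ D ∣ a j <;> simp [nondivisors, h]
  simp_rw [hwt]
  constructor
  · rintro ⟨q, a, hq, ha, -, rfl⟩
    obtain ⟨A, hA, hqA⟩ := (mem_denominators_iff hinj hrange q).1 hq
    obtain ⟨t, ht⟩ := hqA
    set t' := t * ∏ i ∈ Aᶜ, p i ^ D with ht'
    have hQt : Q = q * t' := by rw [hsplit A, ht, ht', mul_assoc]
    have ht'pos : 0 < t' := Nat.pos_of_ne_zero fun h => by simp [h] at hQt; omega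
    refine ⟨fun j => a j * t', fun j => ⟨Nat.mul_pos (ha j).1 ht'pos, ?_⟩, ?_, ?_⟩
    · rw [hQt]; exact Nat.mul_le_mul_right _ (ha j).2
    · refine le_trans (Finset.card_le_card ?_) hA
      intro i hi
      by_contra hiA
      refine (Finset.mem_filter.1 hi).2 fun j => Dvd.dvd.mul_left (Dvd.dvd.mul_left ?_ _) _
      exact Finset.dvd_prod_of_mem (fun i => p i ^ D) (by simpa using hiA)
    · congr 1
      ext j
      rw [hQt]
      have : (t' : ℝ) ≠ 0 := by positivity
      push_cast
      rw [mul_div_mul_right _ _ this]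
  · rintro ⟨a, ha, hwt, rfl⟩
    set A := Finset.univ.filter fun i => ¬ ∀ j, p i ^ D ∣ a j with hA
    set g := Nat.gcd Q (Finset.univ.gcd a) with hg
    have hgQ : g ∣ Q := Nat.gcd_dvd_left _ _
    have hga : ∀ j, g ∣ a j := fun j =>
      (Nat.gcd_dvd_right _ _).trans (Finset.gcd_dvd (Finset.mem_univ j))
    have hgpos : 0 < g := Nat.gcd_pos_of_pos_left _ hQpos
    obtain ⟨q, hq⟩ := hgQ
    choose b hb using hga
    refine ⟨q, b, ?_, fun j => ?_, ?_, ?_⟩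
    · refine (mem_denominators_iff hinj hrange q).2 ⟨A, hwt, ?_⟩
      have h1 : ∏ i ∈ Aᶜ, p i ^ D ∣ g := by
        refine Nat.dvd_gcd (Dvd.intro_left _ (hsplit A).symm) (Finset.dvd_gcd fun j _ => ?_)
        refine Finset.prod_dvd_of_isRelPrime (fun i _ i' _ hii => Nat.coprime_iff_isRelPrime.1 (hcop hii)) ?_
        intro i hi
        simp only [hA, Finset.compl_filter, Finset.mem_filter, not_not] at hi
        exact hi.2 j
      obtain ⟨s, hs⟩ := h1
      refine Dvd.intro_left s ?_
      have h2 := hsplit A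
      rw [hq, hs] at h2
      have h3 : 0 < ∏ i ∈ Aᶜ, p i ^ D := Finset.prod_pos fun i _ => hqpos i
      refine Nat.eq_of_mul_eq_mul_right h3 ?_
      rw [← h2]; ring
    · have h1 := (ha j).1
      have h2 := (ha j).2
      rw [hb j] at h1 h2
      rw [hq] at h2
      exact ⟨Nat.pos_of_ne_zero fun h => by simp [h] at h1, Nat.le_of_mul_le_mul_left h2 hgpos⟩
    · have hgcd : g = Nat.gcd (g * q) (g * Finset.univ.gcd b) := by
        conv_lhs => rw [hg, hq]
        congr 1
        rw [← normalize_eq g, ← Finset.gcd_mul_left]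
        exact Finset.gcd_congr rfl fun j _ => hb j
      rw [Nat.gcd_mul_left] at hgcd
      have h4 : g * Nat.gcd q (Finset.univ.gcd b) = g * 1 := by rw [mul_one]; exact hgcd.symm
      exact Nat.eq_of_mul_eq_mul_left hgpos h4
    · congr 1
      ext j
      have : (g : ℝ) ≠ 0 := by positivity
      rw [hq, hb j]
      push_cast
      rw [mul_div_mul_left _ _ this]

/-- The character `t ↦ exp(2πi t)`. -/
noncomputable def ch (t : ℝ) : ℂ := Complex.exp (2 * Real.pi * Complex.I * t)

theorem ch_add (s t : ℝ) : ch (s + t) = ch s * ch t := by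
  rw [ch, ch, ch, ← Complex.exp_add]; push_cast; ring_nf

theorem ch_sum {ι : Type*} (s : Finset ι) (f : ι → ℝ) : ch (∑ i ∈ s, f i) = ∏ i ∈ s, ch (f i) := by
  classical
  induction s using Finset.induction_on with
  | empty => simp [ch]
  | insert a s ha ih => rw [Finset.sum_insert ha, Finset.prod_insert ha, ch_add, ih]

theorem ch_intCast (m : ℤ) : ch m = 1 := by
  rw [ch, Complex.exp_eq_one_iff]
  exact ⟨m, by push_cast; ring⟩

theorem norm_ch (t : ℝ) : ‖ch t‖ = 1 := by
  rw [ch]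
  have : (2 * Real.pi * Complex.I * t : ℂ) = ((2 * Real.pi * t : ℝ) : ℂ) * Complex.I := by
    push_cast; ring
  rw [this, Complex.norm_exp_ofReal_mul_I]

theorem sum_ch_div {M : ℕ} (hM : 0 < M) (z : ℤ) :
    ∑ s ∈ Finset.Icc 1 M, ch ((s : ℝ) / M * z) = if (M : ℤ) ∣ z then (M : ℂ) else 0 := by
  have hM' : (M : ℝ) ≠ 0 := by positivity
  have hpow : ∀ s : ℕ, ch ((s : ℝ) / M * z) = ch (z / M) ^ s := by
    intro s
    rw [ch, ch, ← Complex.exp_nat_mul]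
    push_cast; ring_nf
  simp_rw [hpow]
  split_ifs with h
  · obtain ⟨c, rfl⟩ := h
    have : ch ((((M : ℤ) * c : ℤ) : ℝ) / M) = 1 := by
      rw [← ch_intCast c]
      congr 1
      push_cast
      field_simp
    simp_rw [this]
    simp
  · have hne : ch (z / M) ≠ 1 := by
      rw [ch, Ne, Complex.exp_eq_one_iff]
      rintro ⟨c, hc⟩
      apply h
      have hpi : (2 * Real.pi * Complex.I : ℂ) ≠ 0 := Complex.two_pi_I_ne_zero
      have h1 : ((z / M : ℝ) : ℂ) = c := by
        apply mul_left_cancel₀ hpi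
        rw [hc]; ring
      have h2 : (z / M : ℝ) = c := by exact_mod_cast h1
      rw [div_eq_iff hM'] at h2
      exact ⟨c, by rw [mul_comm]; exact_mod_cast h2⟩
    have hone : ch (z / M) ^ M = 1 := by
      rw [← hpow, div_self hM', one_mul, ch_intCast]
    have h1 : ∑ s ∈ Finset.Icc 1 M, ch (z / M) ^ s = ch (z / M) * ∑ s ∈ Finset.range M, ch (z / M) ^ s := by
      rw [Finset.mul_sum, Finset.range_eq_Ico, Finset.sum_Ico_eq_sum_range, ← Finset.Ico_add_one_right_eq_Icc,
        Finset.sum_Ico_eq_sum_range]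
      refine Finset.sum_congr (by simp) fun i _ => ?_
      rw [← pow_succ']; congr 1; omega
    rw [h1, geom_sum_eq hne, hone]
    simp

/-- The exponential sum over the multiples of `m` between `1` and `mM`. -/
theorem sum_ite_ch_div {m M : ℕ} (hm : 0 < m) (hM : 0 < M) (z : ℤ) :
    ∑ t ∈ Finset.Icc 1 (M * m), (if m ∣ t then ch ((t : ℝ) / (M * m : ℕ) * z) else 0) =
      if (M : ℤ) ∣ z then (M : ℂ) else 0 := by
  rw [← sum_ch_div hM, ← Finset.sum_filter]
  symm
  refine Finset.sum_bij (fun s _ => s * m) ?_ ?_ ?_ ?_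
  · intro s hs
    rw [Finset.mem_Icc] at hs
    simp only [Finset.mem_filter, Finset.mem_Icc]
    exact ⟨⟨Nat.mul_pos hs.1 hm, Nat.mul_le_mul_right _ hs.2⟩, Dvd.intro_left _ rfl⟩
  · intro s _ s' _ h
    exact Nat.eq_of_mul_eq_mul_right hm h
  · intro t ht
    simp only [Finset.mem_filter, Finset.mem_Icc] at ht
    obtain ⟨⟨h1, h2⟩, s, rfl⟩ := ht
    refine ⟨s, Finset.mem_Icc.2 ⟨Nat.pos_of_ne_zero fun h => by simp [h] at h1, ?_⟩, by ring⟩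
    rw [mul_comm] at h2
    exact Nat.le_of_mul_le_mul_right h2 hm
  · intro s _
    have : (m : ℝ) ≠ 0 := by positivity
    push_cast
    rw [mul_div_mul_right _ _ this]

/-- Inclusion and exclusion. With `y = 1` and `x i` the indicator of `q i ∣ a`, the product on the right
is the indicator of the vectors `a` for which `A` is the set of nondivisors, and those on the left
are the indicators of the common multiples of the `q i`, `i ∈ T`. -/
theorem prod_bool_expand {R : Type*} [CommRing R] (A : Fin n → Bool) (x y : Fin n → R) :
    ∑ T : Fin n → Bool, (∏ i, (if T i then (if A i then (-1 : R) else 1) else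
      (if A i then 1 else 0))) * ∏ i, (if T i then x i else y i) =
      ∏ i, if A i then y i - x i else x i := by
  have := Finset.prod_univ_sum (fun _ : Fin n => (Finset.univ : Finset Bool)) fun i b =>
    (if b then (if A i then (-1 : R) else 1) else (if A i then 1 else 0)) *
      (if b then x i else y i)
  rw [Fintype.piFinset_univ] at this
  simp_rw [← Finset.prod_mul_distrib]
  rw [← this]
  refine Finset.prod_congr rfl fun i _ => ?_
  rw [Fintype.sum_bool]
  by_cases h : A i <;> simp [h]; ring

/-- The exponential sum over the vectors `a/Q` in the unit cube, `Q = Q₀ ∏ q_i`, for which at most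
`D` of the `q_i` do not divide `a`. The proof is inclusion and exclusion over the sets of `i` with
`q_i ∣ a`. -/
theorem sum_ch_nondivisors (hQ₀ : 0 < Q₀) [∀ i, NeZero (q i)]
    (hq : Pairwise (Function.onFun Nat.Coprime q)) (hqQ : ∀ i, Q₀.Coprime (q i)) (D : ℕ)
    (x y : Fin d → ℤ) :
    ∑ a ∈ (Fintype.piFinset fun _ : Fin d => Finset.Icc 1 (Q₀ * ∏ i, q i)) with
        wt (nondivisors q a) ≤ D,
      ch (∑ j, (a j : ℝ) / (Q₀ * ∏ i, q i : ℕ) * ((y j - x j : ℤ) : ℝ)) =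
    (if ∀ j, (x j : ZMod Q₀) = y j then (Q₀ : ℂ) ^ d else 0) *
      lowKernel D (residues q x) (residues q y) := by
  classical
  set Q := Q₀ * ∏ i, q i with hQ
  have hqpos : ∀ i, 0 < q i := fun i => Nat.pos_of_ne_zero (NeZero.ne _)
  set S : Finset (Fin d → ℕ) := Fintype.piFinset fun _ : Fin d => Finset.Icc 1 Q
  set E : (Fin d → ℕ) → ℂ := fun a => ch (∑ j, (a j : ℝ) / (Q : ℕ) * ((y j - x j : ℤ) : ℝ)) with hE
  set z : Fin d → ℤ := fun j => y j - x j with hz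
  set δ : (Fin d → ℕ) → Fin n → ℂ := fun a i => if ∀ j, q i ∣ a j then 1 else 0 with hδ
  set g : Fin n → ℂ := fun i => if ∀ j, (q i : ℤ) ∣ z j then (q i : ℂ) ^ d else 0 with hg
  set g₀ : ℂ := if ∀ j, (Q₀ : ℤ) ∣ z j then (Q₀ : ℂ) ^ d else 0 with hg₀
  have hδA : ∀ a (A : Fin n → Bool), (if nondivisors q a = A then (1 : ℂ) else 0) =
      ∏ i, if A i then 1 - δ a i else δ a i := by
    intro a A
    split_ifs with h
    · rw [eq_comm, Finset.prod_eq_one]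
      intro i _
      rw [← h]
      by_cases hi : ∀ j, q i ∣ a j <;> simp [nondivisors, hδ, hi]
    · obtain ⟨i, hi⟩ := Function.ne_iff.1 h
      rw [eq_comm, Finset.prod_eq_zero (Finset.mem_univ i)]
      by_cases hi' : ∀ j, q i ∣ a j <;> cases hA : A i <;>
        simp_all [nondivisors]
  -- the sum over the vectors divisible by all `q i` with `T i`
  have hT : ∀ T : Fin n → Bool, ∑ a ∈ S, E a * ∏ i, (if T i then δ a i else 1) =
      g₀ * ∏ i, if T i then 1 else g i := by
    intro T
    set m := ∏ i, if T i then q i else 1 with hm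
    set M := Q₀ * ∏ i, if T i then 1 else q i with hM
    have hmpos : 0 < m := Finset.prod_pos fun i _ => by split_ifs <;> simp [hqpos]
    have hMpos : 0 < M := Nat.mul_pos hQ₀ (Finset.prod_pos fun i _ => by split_ifs <;> simp [hqpos])
    have hQM : Q = M * m := by
      rw [hQ, hM, hm, mul_assoc, ← Finset.prod_mul_distrib]
      congr 1
      exact Finset.prod_congr rfl fun i _ => by split_ifs <;> simp
    have hcop1 : Pairwise (Function.onFun Nat.Coprime fun i => if T i then q i else 1) := by
      intro i j hij
      have := hq hij
      simp only [Function.onFun] at this ⊢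
      split_ifs <;> first | exact this | simp
    have hcop2 : Pairwise (Function.onFun Nat.Coprime fun i => if T i then 1 else q i) := by
      intro i j hij
      have := hq hij
      simp only [Function.onFun] at this ⊢
      split_ifs <;> first | exact this | simp
    have hprod : ∀ a : Fin d → ℕ, (∏ i, if T i then δ a i else 1) =
        ∏ j, if m ∣ a j then (1 : ℂ) else 0 := by
      intro a
      have hl : (∏ i, if T i then δ a i else 1) =
          if ∀ i, T i = true → ∀ j, q i ∣ a j then (1 : ℂ) else 0 := by
        split_ifs with h
        · exact Finset.prod_eq_one fun i _ => by
            split_ifs with hi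
            · simp [hδ, h i hi]
            · rfl
        · push Not at h
          obtain ⟨i, hi, j, hj⟩ := h
          refine Finset.prod_eq_zero (Finset.mem_univ i) ?_
          rw [if_pos hi, hδ]
          exact if_neg fun h => hj (h j)
      rw [hl]
      have hmd : ∀ j, m ∣ a j ↔ ∀ i, T i = true → q i ∣ a j := by
        intro j
        rw [hm, prod_dvd_iff hcop1]
        refine forall_congr' fun i => ?_
        by_cases hi : T i <;> simp [hi]
      split_ifs with h
      · exact (Finset.prod_eq_one fun j _ => if_pos ((hmd j).2 fun i hi => h i hi j)).symm
      · push Not at h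
        obtain ⟨i, hi, j, hj⟩ := h
        exact (Finset.prod_eq_zero (Finset.mem_univ j)
          (if_neg fun h => hj ((hmd j).1 h i hi))).symm
    have hsum : ∑ a ∈ S, E a * ∏ i, (if T i then δ a i else 1) =
        ∏ j, if (M : ℤ) ∣ z j then (M : ℂ) else 0 := by
      have h1 : ∀ a, E a * ∏ i, (if T i then δ a i else 1) =
          ∏ j, if m ∣ a j then ch ((a j : ℝ) / (M * m : ℕ) * (z j : ℝ)) else 0 := by
        intro a
        rw [hprod, hE]
        simp only
        rw [ch_sum, ← Finset.prod_mul_distrib]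
        refine Finset.prod_congr rfl fun j _ => ?_
        rw [hQM]
        split_ifs
        · rw [mul_one]
        · rw [mul_zero]
      simp_rw [h1]
      have h2 := Finset.prod_univ_sum (fun _ : Fin d => Finset.Icc 1 Q) fun j (t : ℕ) =>
        if m ∣ t then ch ((t : ℝ) / (M * m : ℕ) * (z j : ℝ)) else 0
      rw [← h2]
      refine Finset.prod_congr rfl fun j _ => ?_
      rw [hQM, sum_ite_ch_div hmpos hMpos]
    rw [hsum]
    have hMd : ∀ j, (M : ℤ) ∣ z j ↔ (Q₀ : ℤ) ∣ z j ∧ ∀ i, T i = false → (q i : ℤ) ∣ z j := by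
      intro j
      have hc : Q₀.Coprime (∏ i, if T i then 1 else q i) :=
        Nat.Coprime.prod_right fun i _ => by
          split_ifs
          · exact Nat.coprime_one_right _
          · exact hqQ i
      simp_rw [Int.natCast_dvd, hM]
      have hmul : ∀ t : ℕ, (Q₀ * ∏ i, if T i then 1 else q i) ∣ t ↔
          Q₀ ∣ t ∧ (∏ i, if T i then 1 else q i) ∣ t := fun t =>
        ⟨fun h => ⟨(Dvd.intro _ rfl).trans h, (Dvd.intro_left _ rfl).trans h⟩,
          fun h => hc.mul_dvd_of_dvd_of_dvd h.1 h.2⟩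
      rw [hmul, prod_dvd_iff hcop2]
      refine and_congr Iff.rfl (forall_congr' fun i => ?_)
      by_cases hi : T i <;> simp [hi]
    by_cases h0 : ∀ j, (Q₀ : ℤ) ∣ z j
    · by_cases h1 : ∀ i, T i = false → ∀ j, (q i : ℤ) ∣ z j
      · rw [hg₀, if_pos h0]
        have : ∀ j, (M : ℤ) ∣ z j := fun j => (hMd j).2 ⟨h0 j, fun i hi => h1 i hi j⟩
        simp_rw [if_pos (this _)]
        rw [Finset.prod_const, Finset.card_univ, Fintype.card_fin, hM]
        push_cast
        rw [mul_pow, ← Finset.prod_pow]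
        congr 1
        refine Finset.prod_congr rfl fun i _ => ?_
        cases hi : T i
        · simp [hg, h1 i hi]
        · simp
      · push Not at h1
        obtain ⟨i, hi, j, hj⟩ := h1
        rw [Finset.prod_eq_zero (Finset.mem_univ j) (if_neg fun h => hj (((hMd j).1 h).2 i hi)),
          Finset.prod_eq_zero (Finset.mem_univ i), mul_zero]
        rw [hi, hg]
        simp only [Bool.false_eq_true, if_false]
        exact if_neg fun h => hj (h j)
    · rw [hg₀, if_neg h0, zero_mul]
      push Not at h0
      obtain ⟨j, hj⟩ := h0
      exact Finset.prod_eq_zero (Finset.mem_univ j) (if_neg fun h => hj ((hMd j).1 h).1)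
  have hA : ∀ A : Fin n → Bool, ∑ a ∈ S, E a * (if nondivisors q a = A then (1 : ℂ) else 0) =
      g₀ * ∏ i, if A i then g i - 1 else 1 := by
    intro A
    simp_rw [hδA]
    simp_rw [← prod_bool_expand A (δ _) (fun _ => (1 : ℂ))]
    simp_rw [Finset.mul_sum]
    rw [Finset.sum_comm]
    rw [← prod_bool_expand A (fun _ => (1 : ℂ)) g, Finset.mul_sum]
    refine Finset.sum_congr rfl fun T _ => ?_
    have := hT T
    calc _ = (∏ i, (if T i then (if A i then (-1 : ℂ) else 1) else (if A i then 1 else 0))) *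
          ∑ a ∈ S, E a * ∏ i, (if T i then δ a i else 1) := by
            rw [Finset.mul_sum]; exact Finset.sum_congr rfl fun a _ => by ring
      _ = _ := by rw [this]; ring
  have hker : ∀ A : Fin n → Bool, (setKernel A (residues q x) (residues q y) : ℂ) =
      ∏ i, if A i then g i - 1 else 1 := by
    intro A
    rw [setKernel]
    push_cast
    refine Finset.prod_congr rfl fun i _ => ?_
    split_ifs
    · rw [pointKernel, hg]
      have hiff : residues q x i = residues q y i ↔ ∀ j, (q i : ℤ) ∣ z j := by
        rw [funext_iff]
        refine forall_congr' fun j => ?_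
        simp only [residues, hz]
        exact ZMod.intCast_eq_intCast_iff_dvd_sub _ _ _
      simp only [hiff]
      split_ifs <;> simp
    · rfl
  have hg₀' : g₀ = if ∀ j, (x j : ZMod Q₀) = y j then (Q₀ : ℂ) ^ d else 0 := by
    rw [hg₀]
    refine if_congr (forall_congr' fun j => ?_) rfl rfl
    exact (ZMod.intCast_eq_intCast_iff_dvd_sub _ _ _).symm
  rw [← hg₀', lowKernel]
  push_cast
  simp_rw [hker, Finset.mul_sum, ← hA]
  rw [Finset.sum_comm, Finset.sum_filter]
  refine Finset.sum_congr rfl fun a _ => ?_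
  rw [← Finset.mul_sum, Finset.sum_ite_eq]
  simp only [Finset.mem_filter, Finset.mem_univ, true_and]
  split_ifs <;> simp [hE]

end Rationals

/-- The exponential sum over the special rationals. -/
theorem sum_ch_specialRationals {d n : ℕ} {ρ : ℝ} {N : ℕ} {p : Fin n → ℕ}
    (hinj : Function.Injective p) (hrange : Set.range p = primeSet ρ N)
    [∀ i, NeZero (p i ^ bigD ρ)] (x y : Fin d → ℤ) :
    ∑ u ∈ (finite_specialRationals d ρ N).toFinset, ch (∑ j, u j * ((y j - x j : ℤ) : ℝ)) =
    (if ∀ j, (x j : ZMod (bigQ ρ N)) = y j then (bigQ ρ N : ℂ) ^ d else 0) *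
      lowKernel (bigD ρ) (residues (fun i => p i ^ bigD ρ) x)
        (residues (fun i => p i ^ bigD ρ) y) := by
  classical
  have hmem : ∀ i, p i ∈ primeSet ρ N := fun i => hrange ▸ Set.mem_range_self i
  have hQ₀ : 0 < bigQ ρ N := pow_pos (Nat.factorial_pos _) _
  have hcop : Pairwise (Function.onFun Nat.Coprime fun i => p i ^ bigD ρ) := fun i j hij =>
    Nat.Coprime.pow _ _ ((Nat.coprime_primes (hmem i).1 (hmem j).1).2 fun h => hij (hinj h))
  have hcopQ : ∀ i, (bigQ ρ N).Coprime (p i ^ bigD ρ) := fun i =>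
    Nat.Coprime.pow _ _ ((Nat.Prime.coprime_iff_not_dvd (hmem i).1).2 fun h =>
      absurd ((hmem i).1.dvd_factorial.1 h) (not_le.2 (hmem i).2.1)).symm
  rw [← sum_ch_nondivisors (bigQ ρ N) _ hQ₀ hcop hcopQ]
  symm
  set Q := bigQ ρ N * ∏ i, p i ^ bigD ρ with hQ
  have hQpos : 0 < Q := Nat.mul_pos hQ₀ (Finset.prod_pos fun i _ => pow_pos (hmem i).1.pos _)
  have hQne : (Q : ℝ) ≠ 0 := by positivity
  refine Finset.sum_bij (fun a _ => WithLp.toLp 2 fun j => (a j : ℝ) / (Q : ℝ)) ?_ ?_ ?_ ?_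
  · intro a ha
    simp only [Finset.mem_filter, Fintype.mem_piFinset, Finset.mem_Icc] at ha
    rw [Set.Finite.mem_toFinset, mem_specialRationals_iff hinj hrange]
    exact ⟨a, ha.1, ha.2, rfl⟩
  · intro a _ b _ h
    ext j
    have := congrArg (fun u : EuclideanSpace ℝ (Fin d) => u j) h
    simp only at this
    rw [div_left_inj' hQne] at this
    exact_mod_cast this
  · intro u hu
    rw [Set.Finite.mem_toFinset, mem_specialRationals_iff hinj hrange] at hu
    obtain ⟨a, h1, h2, rfl⟩ := hu
    refine ⟨a, ?_, rfl⟩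
    simp only [Finset.mem_filter, Fintype.mem_piFinset, Finset.mem_Icc]
    exact ⟨h1, h2⟩
  · intro a _
    rfl

/-! ### Dilations and lattice sums in `ℝ^d` -/

section Dilation

variable {d : ℕ}

/-- The coordinatewise dilation `ξ ↦ (ε_j ξ_j)`. -/
def dil (ε : Fin d → ℝ) (ξ : EuclideanSpace ℝ (Fin d)) : EuclideanSpace ℝ (Fin d) :=
  WithLp.toLp 2 fun i => ε i * ξ i

@[simp] theorem dil_apply (ε : Fin d → ℝ) (ξ : EuclideanSpace ℝ (Fin d)) (i : Fin d) :
    dil ε ξ i = ε i * ξ i := rfl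

theorem contDiff_dil (ε : Fin d → ℝ) : ContDiff ℝ ∞ (dil ε) := by
  rw [contDiff_euclidean]
  intro i
  simp only [dil_apply]
  fun_prop

theorem dil_inv_dil {ε : Fin d → ℝ} (hε : ∀ i, 0 < ε i) (ξ : EuclideanSpace ℝ (Fin d)) :
    dil ε⁻¹ (dil ε ξ) = ξ := by
  ext i; simp [(hε i).ne']

theorem dil_dil_inv {ε : Fin d → ℝ} (hε : ∀ i, 0 < ε i) (ξ : EuclideanSpace ℝ (Fin d)) :
    dil ε (dil ε⁻¹ ξ) = ξ := by
  ext i; simp [(hε i).ne']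

theorem norm_dil_le {ε : Fin d → ℝ} {c : ℝ} (hε : ∀ i, 0 < ε i ∧ ε i ≤ c) (hc : 0 ≤ c)
    (ξ : EuclideanSpace ℝ (Fin d)) : ‖dil ε ξ‖ ≤ c * ‖ξ‖ := by
  rw [EuclideanSpace.norm_eq, EuclideanSpace.norm_eq, ← Real.sqrt_sq hc, ← Real.sqrt_mul (sq_nonneg c),
    Finset.mul_sum]
  refine Real.sqrt_le_sqrt (Finset.sum_le_sum fun i _ => ?_)
  rw [← mul_pow]
  refine pow_le_pow_left₀ (norm_nonneg _) ?_ 2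
  rw [dil_apply, norm_mul, Real.norm_of_nonneg (hε i).1.le]
  exact mul_le_mul_of_nonneg_right (hε i).2 (norm_nonneg _)

/-- The dilation as a measurable equivalence. -/
noncomputable def dilEquiv {ε : Fin d → ℝ} (hε : ∀ i, 0 < ε i) :
    EuclideanSpace ℝ (Fin d) ≃ᵐ EuclideanSpace ℝ (Fin d) where
  toFun := dil ε
  invFun := dil ε⁻¹
  left_inv := dil_inv_dil hε
  right_inv := dil_dil_inv hε
  measurable_toFun := (contDiff_dil ε).continuous.measurable
  measurable_invFun := (contDiff_dil ε⁻¹).continuous.measurable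

theorem map_dil {ε : Fin d → ℝ} (hε : ∀ i, 0 < ε i) :
    ENNReal.ofReal (∏ i, ε i) • Measure.map (dilEquiv hε) volume =
      (volume : Measure (EuclideanSpace ℝ (Fin d))) := by
  have hpos : 0 < ∏ i, ε i := Finset.prod_pos fun i _ => hε i
  have h1 := Real.smul_map_diagonal_volume_pi (D := ε) (by
    rw [Matrix.det_diagonal]; exact hpos.ne')
  rw [Matrix.det_diagonal, abs_of_pos hpos] at h1
  have hv := PiLp.volume_preserving_toLp (Fin d)
  have hcomp : (dilEquiv hε : EuclideanSpace ℝ (Fin d) → _) ∘ WithLp.toLp 2 =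
      WithLp.toLp 2 ∘ ⇑(Matrix.toLin' (Matrix.diagonal ε)) := by
    ext x i
    simp [dilEquiv, dil, Matrix.toLin'_apply, Matrix.mulVec_diagonal]
  have hm : Measurable ⇑(Matrix.toLin' (Matrix.diagonal ε)) :=
    (LinearMap.continuous_of_finiteDimensional _).measurable
  conv_lhs => rw [← hv.map_eq]
  rw [Measure.map_map (dilEquiv hε).measurable hv.measurable, hcomp,
    ← Measure.map_map hv.measurable hm, ← Measure.map_smul, h1, hv.map_eq]

theorem lintegral_comp_dil {ε : Fin d → ℝ} (hε : ∀ i, 0 < ε i)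
    (f : EuclideanSpace ℝ (Fin d) → ℝ≥0∞) :
    ENNReal.ofReal (∏ i, ε i) * ∫⁻ x, f (dil ε x) = ∫⁻ x, f x := by
  conv_rhs => rw [← map_dil hε]
  rw [lintegral_smul_measure, lintegral_map_equiv]
  rfl

theorem integral_comp_dil {ε : Fin d → ℝ} (hε : ∀ i, 0 < ε i)
    (f : EuclideanSpace ℝ (Fin d) → ℂ) :
    ((∏ i, ε i : ℝ) : ℂ) * ∫ x, f (dil ε x) = ∫ x, f x := by
  have hpos : 0 ≤ ∏ i, ε i := Finset.prod_nonneg fun i _ => (hε i).le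
  conv_rhs => rw [← map_dil hε]
  rw [integral_smul_measure, integral_map_equiv, ENNReal.toReal_ofReal hpos, Complex.real_smul]
  rfl

/-- The translates of the unit cube by lattice points. -/
def cubeAt (y : Fin d → ℤ) : Set (EuclideanSpace ℝ (Fin d)) := {t | ∀ i, ⌊t i⌋ = y i}

theorem measurableSet_cubeAt (y : Fin d → ℤ) : MeasurableSet (cubeAt y) := by
  have : cubeAt y = ⋂ i, (fun t : EuclideanSpace ℝ (Fin d) => ⌊t i⌋) ⁻¹' {y i} := by
    ext t; simp [cubeAt]
  rw [this]
  refine MeasurableSet.iInter fun i => ?_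
  have hm : Measurable fun t : EuclideanSpace ℝ (Fin d) => ⌊t i⌋ :=
    Int.measurable_floor.comp (by fun_prop)
  exact hm (measurableSet_singleton _)

theorem volume_cubeAt (y : Fin d → ℤ) : volume (cubeAt y) = 1 := by
  have hv := PiLp.volume_preserving_toLp (Fin d)
  rw [← hv.measure_preimage (measurableSet_cubeAt y).nullMeasurableSet]
  have : WithLp.toLp 2 ⁻¹' cubeAt y = Set.pi Set.univ fun i => Set.Ico (y i : ℝ) (y i + 1) := by
    ext t
    simp [cubeAt, Int.floor_eq_iff]
  rw [this, volume_pi_pi]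
  simp

theorem disjoint_cubeAt (s : Set (Fin d → ℤ)) : s.PairwiseDisjoint cubeAt := by
  intro y _ y' _ h
  refine Set.disjoint_left.2 fun t ht ht' => h ?_
  ext i
  rw [← ht i, ← ht' i]

/-- The decay profile `(1 + ‖x‖)^{-(d+1)}`. -/
noncomputable def decayProfile (x : EuclideanSpace ℝ (Fin d)) : ℝ≥0∞ :=
  ENNReal.ofReal ((1 + ‖x‖) ^ (-((d : ℝ) + 1)))

theorem lintegral_decayProfile_lt_top :
    ∫⁻ x : EuclideanSpace ℝ (Fin d), decayProfile x < ⊤ :=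
  finite_integral_one_add_norm (by simp)

theorem decayProfile_le {x x' : EuclideanSpace ℝ (Fin d)} (h : ‖x'‖ ≤ ‖x‖ + d) :
    decayProfile x ≤ ENNReal.ofReal ((1 + (d : ℝ)) ^ ((d : ℝ) + 1)) * decayProfile x' := by
  rw [decayProfile, decayProfile, ← ENNReal.ofReal_mul (by positivity)]
  refine ENNReal.ofReal_le_ofReal ?_
  have h1 : (0 : ℝ) < 1 + ‖x‖ := by positivity
  have h2 : (0 : ℝ) < 1 + ‖x'‖ := by positivity
  have h3 : (0 : ℝ) < 1 + d := by positivity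
  rw [Real.rpow_neg h1.le, Real.rpow_neg h2.le, ← div_eq_mul_inv, le_div_iff₀ (by positivity),
    inv_mul_le_iff₀ (by positivity), ← Real.mul_rpow h1.le h3.le]
  refine Real.rpow_le_rpow h2.le ?_ (by positivity)
  nlinarith [norm_nonneg x, Nat.cast_nonneg (α := ℝ) d]

theorem norm_le_card_of_abs_le_one {x : EuclideanSpace ℝ (Fin d)} (h : ∀ i, |x i| ≤ 1) :
    ‖x‖ ≤ d := by
  rw [EuclideanSpace.norm_eq]
  refine Real.sqrt_le_iff.2 ⟨Nat.cast_nonneg _, ?_⟩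
  calc ∑ i, ‖x i‖ ^ 2 ≤ ∑ _i : Fin d, (1 : ℝ) := Finset.sum_le_sum fun i _ => by
        rw [Real.norm_eq_abs]; exact pow_le_one₀ (abs_nonneg _) (h i)
    _ = d := by simp
    _ ≤ (d : ℝ) ^ 2 := by exact_mod_cast Nat.le_self_pow two_ne_zero d

/-- A sum of a slowly varying profile over lattice points is bounded by its integral. -/
theorem sum_decayProfile_le {ε : Fin d → ℝ} (hε : ∀ i, 0 < ε i ∧ ε i ≤ 1)
    (F : Finset (Fin d → ℤ)) (x : EuclideanSpace ℝ (Fin d)) :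
    ENNReal.ofReal (∏ i, ε i) * ∑ y ∈ F, decayProfile (dil ε (x - latticePoint y)) ≤
      ENNReal.ofReal ((1 + (d : ℝ)) ^ ((d : ℝ) + 1)) *
        ∫⁻ x : EuclideanSpace ℝ (Fin d), decayProfile x := by
  set c := ENNReal.ofReal ((1 + (d : ℝ)) ^ ((d : ℝ) + 1))
  have h1 : ∀ y : Fin d → ℤ, decayProfile (dil ε (x - latticePoint y)) ≤
      ∫⁻ t in cubeAt y, c * decayProfile (dil ε (x - t)) := by
    intro y
    calc decayProfile (dil ε (x - latticePoint y))
        = ∫⁻ _t in cubeAt y, decayProfile (dil ε (x - latticePoint y)) := by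
          rw [setLIntegral_const, volume_cubeAt, mul_one]
      _ ≤ _ := by
          refine setLIntegral_mono' (measurableSet_cubeAt y) fun t ht => decayProfile_le ?_
          have h2 : dil ε (x - t) = dil ε (x - latticePoint y) + dil ε (latticePoint y - t) := by
            ext i; simp; ring
          rw [h2]
          refine (norm_add_le _ _).trans ?_
          gcongr
          refine norm_le_card_of_abs_le_one fun i => ?_
          have h3 := ht i
          rw [Int.floor_eq_iff] at h3
          rw [dil_apply, abs_mul, abs_of_pos (hε i).1]
          have h4 : |(latticePoint y - t) i| ≤ 1 := by
            rw [PiLp.sub_apply, latticePoint, abs_le]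
            constructor <;> simp only <;> linarith
          calc ε i * |(latticePoint y - t) i| ≤ 1 * 1 :=
                mul_le_mul (hε i).2 h4 (abs_nonneg _) zero_le_one
            _ = 1 := one_mul 1
  calc ENNReal.ofReal (∏ i, ε i) * ∑ y ∈ F, decayProfile (dil ε (x - latticePoint y))
      ≤ ENNReal.ofReal (∏ i, ε i) * ∑ y ∈ F, ∫⁻ t in cubeAt y, c * decayProfile (dil ε (x - t)) := by
        gcongr with y; exact h1 y
    _ = ENNReal.ofReal (∏ i, ε i) *
          ∫⁻ t in ⋃ y ∈ F, cubeAt y, c * decayProfile (dil ε (x - t)) := by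
        rw [lintegral_biUnion_finset (disjoint_cubeAt _) fun y _ => measurableSet_cubeAt y]
    _ ≤ ENNReal.ofReal (∏ i, ε i) * ∫⁻ t, c * decayProfile (dil ε (x - t)) := by
        gcongr; exact Measure.restrict_le_self
    _ = ENNReal.ofReal (∏ i, ε i) * ∫⁻ t, c * decayProfile (dil ε t) := by
        rw [lintegral_sub_left_eq_self (fun t => c * decayProfile (dil ε t)) x]
    _ = c * ∫⁻ t : EuclideanSpace ℝ (Fin d), decayProfile t := by
        rw [lintegral_comp_dil (fun i => (hε i).1) (fun t => c * decayProfile t),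
          lintegral_const_mul']
        exact ENNReal.ofReal_ne_top

theorem exists_enorm_le_decayProfile (S : 𝓢(EuclideanSpace ℝ (Fin d), ℂ)) :
    ∃ C : ℝ, 0 ≤ C ∧ ∀ x, ‖S x‖ₑ ≤ ENNReal.ofReal C * decayProfile x := by
  set C := 2 ^ (d + 1) * ((Finset.Iic ((d + 1, 0) : ℕ × ℕ)).sup fun m =>
    SchwartzMap.seminorm ℝ m.1 m.2) S with hC
  have h : ∀ x, (1 + ‖x‖) ^ (d + 1) * ‖S x‖ ≤ C := fun x => by
    have := SchwartzMap.one_add_le_sup_seminorm_apply (𝕜 := ℝ) (m := (d + 1, 0)) (k := d + 1) (n := 0)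
      le_rfl le_rfl S x
    simpa using this
  have hC0 : 0 ≤ C := le_trans (by positivity) (h 0)
  refine ⟨C, hC0, fun x => ?_⟩
  rw [decayProfile, ← ENNReal.ofReal_mul hC0, ← ofReal_norm]
  refine ENNReal.ofReal_le_ofReal ?_
  have h1 : (0 : ℝ) < 1 + ‖x‖ := by positivity
  rw [Real.rpow_neg h1.le, ← div_eq_mul_inv, le_div_iff₀ (by positivity), mul_comm]
  have := h x
  rwa [← Real.rpow_natCast, Nat.cast_add, Nat.cast_one] at this

/-- Interpolating a finitely supported function on the lattice by a kernel of width `ε⁻¹ ≥ 1`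
is bounded from `ℓ^p` to `L^p`, uniformly in `ε`. -/
theorem exists_lintegral_interpolation_le (S : 𝓢(EuclideanSpace ℝ (Fin d), ℂ)) {p : ℝ}
    (hp : 1 ≤ p) :
    ∃ C : ℝ, 0 ≤ C ∧ ∀ (ε : Fin d → ℝ), (∀ i, 0 < ε i ∧ ε i ≤ 1) →
      ∀ (F : Finset (Fin d → ℤ)) (a : (Fin d → ℤ) → ℂ),
        (∫⁻ x, ‖∑ y ∈ F, a y * (((∏ i, ε i : ℝ) : ℂ) * S (dil ε (x - latticePoint y)))‖ₑ ^ p) ^ (1 / p)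
          ≤ ENNReal.ofReal C * (∑ y ∈ F, ‖a y‖ₑ ^ p) ^ (1 / p) := by
  obtain ⟨C, hC0, hC⟩ := exists_enorm_le_decayProfile S
  set K := ENNReal.ofReal C * (ENNReal.ofReal ((1 + (d : ℝ)) ^ ((d : ℝ) + 1)) *
        ∫⁻ x : EuclideanSpace ℝ (Fin d), decayProfile x) with hK
  have hKtop : K ≠ ⊤ := ENNReal.mul_ne_top ENNReal.ofReal_ne_top
    (ENNReal.mul_ne_top ENNReal.ofReal_ne_top lintegral_decayProfile_lt_top.ne)
  have hp0 : 0 < p := by linarith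
  have hK2 : ∫⁻ x, ‖S x‖ₑ ≤ K := by
    calc ∫⁻ x, ‖S x‖ₑ ≤ ∫⁻ x, ENNReal.ofReal C * decayProfile x := lintegral_mono hC
      _ = ENNReal.ofReal C * ∫⁻ x : EuclideanSpace ℝ (Fin d), decayProfile x :=
          lintegral_const_mul' _ _ ENNReal.ofReal_ne_top
      _ ≤ K := by
          rw [hK]; gcongr
          refine le_mul_of_one_le_left' ?_
          rw [← ENNReal.ofReal_one]
          refine ENNReal.ofReal_le_ofReal (Real.one_le_rpow ?_ (by positivity))
          linarith [Nat.cast_nonneg (α := ℝ) d]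
  refine ⟨K.toReal, ENNReal.toReal_nonneg, fun ε hε F a => ?_⟩
  rw [ENNReal.ofReal_toReal hKtop]
  set e := ENNReal.ofReal (∏ i, ε i) with he
  have hpos : 0 < ∏ i, ε i := Finset.prod_pos fun i _ => (hε i).1
  set w : EuclideanSpace ℝ (Fin d) → (Fin d → ℤ) → ℝ≥0∞ :=
    fun x y => e * ‖S (dil ε (x - latticePoint y))‖ₑ with hw
  have hmeas : ∀ y, Measurable fun x => w x y := fun y => by
    refine Measurable.const_mul ?_ _
    refine Measurable.enorm ?_
    exact (S.continuous.comp ((contDiff_dil ε).continuous.comp (by fun_prop))).measurable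
  have hwsum : ∀ x, ∑ y ∈ F, w x y ≤ K := by
    intro x
    calc ∑ y ∈ F, w x y ≤ ∑ y ∈ F, e * (ENNReal.ofReal C * decayProfile (dil ε (x - latticePoint y))) :=
          Finset.sum_le_sum fun y _ => by simp only [hw]; gcongr; exact hC _
      _ = ENNReal.ofReal C * (e * ∑ y ∈ F, decayProfile (dil ε (x - latticePoint y))) := by
          simp_rw [Finset.mul_sum]; exact Finset.sum_congr rfl fun y _ => by ring
      _ ≤ K := by rw [hK]; exact mul_le_mul_right (sum_decayProfile_le hε F x) _
  have hwint : ∀ y, ∫⁻ x, w x y ≤ K := by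
    intro y
    simp only [hw]
    rw [lintegral_sub_right_eq_self (fun x => e * ‖S (dil ε x)‖ₑ) (latticePoint y),
      lintegral_const_mul' _ _ ENNReal.ofReal_ne_top,
      lintegral_comp_dil (fun i => (hε i).1) fun x => ‖S x‖ₑ]
    exact hK2
  -- Hölder's inequality with weights `w x y`
  have hpt : ∀ x, ‖∑ y ∈ F, a y * (((∏ i, ε i : ℝ) : ℂ) * S (dil ε (x - latticePoint y)))‖ₑ ^ p ≤
      K ^ (p - 1) * ∑ y ∈ F, w x y * ‖a y‖ₑ ^ p := by
    intro x
    have h1 : ‖∑ y ∈ F, a y * (((∏ i, ε i : ℝ) : ℂ) * S (dil ε (x - latticePoint y)))‖ₑ ≤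
        ∑ y ∈ F, w x y * ‖a y‖ₑ := by
      refine (enorm_sum_le _ _).trans (Finset.sum_le_sum fun y _ => le_of_eq ?_)
      rw [enorm_mul, enorm_mul, mul_comm]
      congr 2
      rw [← ofReal_norm, Complex.norm_real, Real.norm_of_nonneg hpos.le]
    have h2 := ENNReal.inner_le_weight_mul_Lp_of_nonneg F hp (w x) fun y => ‖a y‖ₑ
    calc _ ≤ ((∑ y ∈ F, w x y) ^ (1 - p⁻¹) * (∑ y ∈ F, w x y * ‖a y‖ₑ ^ p) ^ p⁻¹) ^ p :=
          ENNReal.rpow_le_rpow (h1.trans h2) hp0.le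
      _ = (∑ y ∈ F, w x y) ^ (p - 1) * ∑ y ∈ F, w x y * ‖a y‖ₑ ^ p := by
          rw [ENNReal.mul_rpow_of_nonneg _ _ hp0.le, ← ENNReal.rpow_mul, ← ENNReal.rpow_mul,
            inv_mul_cancel₀ hp0.ne', ENNReal.rpow_one]
          congr 2
          field_simp
      _ ≤ _ := by
          gcongr
          exact hwsum x
  have hint : ∫⁻ x, ‖∑ y ∈ F, a y * (((∏ i, ε i : ℝ) : ℂ) * S (dil ε (x - latticePoint y)))‖ₑ ^ p ≤
      K ^ p * ∑ y ∈ F, ‖a y‖ₑ ^ p := by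
    calc _ ≤ ∫⁻ x, K ^ (p - 1) * ∑ y ∈ F, w x y * ‖a y‖ₑ ^ p := lintegral_mono hpt
      _ = K ^ (p - 1) * ∑ y ∈ F, (∫⁻ x, w x y) * ‖a y‖ₑ ^ p := by
          rw [lintegral_const_mul' _ _ (ENNReal.rpow_ne_top_of_nonneg (by linarith) hKtop),
            lintegral_finsetSum _ fun y _ => (hmeas y).mul_const _]
          congr 1
          exact Finset.sum_congr rfl fun y _ => lintegral_mul_const _ (hmeas y)
      _ ≤ K ^ (p - 1) * ∑ y ∈ F, K * ‖a y‖ₑ ^ p := by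
          gcongr with y; exact hwint y
      _ = K ^ p * ∑ y ∈ F, ‖a y‖ₑ ^ p := by
          rw [← Finset.mul_sum, ← mul_assoc]
          congr 1
          nth_rw 2 [← ENNReal.rpow_one K]
          rw [← ENNReal.rpow_add_of_nonneg _ _ (by linarith) zero_le_one]
          congr 1; ring
  calc _ ≤ (K ^ p * ∑ y ∈ F, ‖a y‖ₑ ^ p) ^ (1 / p) :=
        ENNReal.rpow_le_rpow hint (by positivity)
    _ = _ := by
        rw [ENNReal.mul_rpow_of_nonneg _ _ (by positivity), ← ENNReal.rpow_mul,
          mul_one_div_cancel hp0.ne', ENNReal.rpow_one]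

end Dilation

/-! ### Transference from `ℝ^d` to the lattice -/

section Transference

variable {d : ℕ}

/-- The phase `ξ · z` of a lattice point. -/
def phase (ξ : EuclideanSpace ℝ (Fin d)) (z : Fin d → ℤ) : ℝ := ∑ j, ξ j * (z j : ℝ)

theorem phase_sub (ξ : EuclideanSpace ℝ (Fin d)) (z w : Fin d → ℤ) :
    phase ξ (z - w) = phase ξ z - phase ξ w := by
  simp [phase, mul_sub, Finset.sum_sub_distrib]

theorem ch_neg (t : ℝ) : ch (-t) = (starRingEnd ℂ) (ch t) := by
  rw [ch, ch, ← Complex.exp_conj]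
  congr 1
  simp only [map_mul, Complex.conj_ofReal, Complex.conj_I, map_ofNat]
  push_cast
  ring

theorem ch_phase_sub (ξ : EuclideanSpace ℝ (Fin d)) (z w : Fin d → ℤ) :
    ch (phase ξ (z - w)) = ch (-phase ξ w) * ch (phase ξ z) := by
  rw [← ch_add, phase_sub, neg_add_eq_sub]

theorem contDiff_ch_phase (z : Fin d → ℤ) :
    ContDiff ℝ ∞ fun ξ : EuclideanSpace ℝ (Fin d) => ch (phase ξ z) := by
  unfold ch phase
  have h : ContDiff ℝ ∞ fun ξ : EuclideanSpace ℝ (Fin d) => ∑ j, ξ j * (z j : ℝ) := by fun_prop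
  exact (contDiff_const.mul (Complex.ofRealCLM.contDiff.comp h)).cexp

theorem continuous_ch_phase (z : Fin d → ℤ) :
    Continuous fun ξ : EuclideanSpace ℝ (Fin d) => ch (phase ξ z) :=
  (contDiff_ch_phase z).continuous

/-- The trigonometric polynomial with coefficients `a` on `F`. -/
noncomputable def trigPoly (F : Finset (Fin d → ℤ)) (a : (Fin d → ℤ) → ℂ)
    (ξ : EuclideanSpace ℝ (Fin d)) : ℂ := ∑ y ∈ F, a y * ch (phase ξ y)

theorem dil_inv_eq_zero {E : Type*} [Zero E] {w : EuclideanSpace ℝ (Fin d) → E} {R c : ℝ}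
    (hw : ∀ x, R ≤ ‖x‖ → w x = 0) {ε : Fin d → ℝ} (hε : ∀ i, 0 < ε i ∧ ε i ≤ c) (hc : 0 < c)
    {ξ : EuclideanSpace ℝ (Fin d)} (hξ : c * R ≤ ‖ξ‖) : w (dil ε⁻¹ ξ) = 0 := by
  refine hw _ ?_
  have h := norm_dil_le hε hc.le (dil ε⁻¹ ξ)
  rw [dil_dil_inv fun i => (hε i).1] at h
  exact le_of_mul_le_mul_left (hξ.trans h) hc

theorem exists_schwartz_trigPoly {w : EuclideanSpace ℝ (Fin d) → ℂ} {R : ℝ}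
    (hw : ContDiff ℝ ∞ w) (hw0 : ∀ x, R ≤ ‖x‖ → w x = 0) {ε : Fin d → ℝ}
    (hε : ∀ i, 0 < ε i ∧ ε i ≤ 1) (F : Finset (Fin d → ℤ)) (a : (Fin d → ℤ) → ℂ) :
    ∃ s : 𝓢(EuclideanSpace ℝ (Fin d), ℂ), ⇑s = fun ξ => w (dil ε⁻¹ ξ) * trigPoly F a ξ := by
  have h1 : ContDiff ℝ ∞ fun ξ => w (dil ε⁻¹ ξ) * trigPoly F a ξ := by
    refine (hw.comp (contDiff_dil _)).mul ?_
    exact ContDiff.sum fun y _ => contDiff_const.mul (contDiff_ch_phase y)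
  have h2 : HasCompactSupport fun ξ => w (dil ε⁻¹ ξ) * trigPoly F a ξ := by
    refine HasCompactSupport.intro (isCompact_closedBall (0 : EuclideanSpace ℝ (Fin d)) R) ?_
    intro ξ hξ
    rw [dil_inv_eq_zero hw0 hε one_pos, zero_mul]
    simp only [Metric.mem_closedBall, dist_zero_right, not_le] at hξ
    linarith
  exact ⟨h2.toSchwartzMap h1, rfl⟩

/-- The transform of a trigonometric polynomial localized by `w` is a superposition of translates of
one bump. -/
theorem fourier_trigPoly {w S s : 𝓢(EuclideanSpace ℝ (Fin d), ℂ)} {ε : Fin d → ℝ}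
    (hS : S = 𝓕 w) (hε : ∀ i, 0 < ε i) (F : Finset (Fin d → ℤ)) (a : (Fin d → ℤ) → ℂ)
    (hs : ⇑s = fun ξ => w (dil ε⁻¹ ξ) * trigPoly F a ξ) (x : EuclideanSpace ℝ (Fin d)) :
    𝓕 s x = ∑ y ∈ F, a y * (((∏ i, ε i : ℝ) : ℂ) * S (dil ε (x - latticePoint y))) := by
  have hch : ∀ t : ℝ, Complex.exp (↑(-2 * Real.pi * t) * Complex.I) = ch (-t) := by
    intro t; rw [ch]; congr 1; push_cast; ring
  have hint : ∀ y, Integrable fun ξ : EuclideanSpace ℝ (Fin d) =>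
      ch (-inner ℝ ξ (x - latticePoint y)) * w (dil ε⁻¹ ξ) := by
    intro y
    have h1 : Integrable fun ξ => w (dil ε⁻¹ ξ) := by
      have h2 : Integrable (⇑w) (ENNReal.ofReal (∏ i, (ε⁻¹) i) •
          Measure.map (dilEquiv (ε := ε⁻¹) fun i => inv_pos.2 (hε i)) volume) := by
        rw [map_dil]; exact w.integrable
      have hpos : 0 < ∏ i, (ε⁻¹) i := Finset.prod_pos fun i _ => inv_pos.2 (hε i)
      rw [integrable_smul_measure (by simpa using hpos) ENNReal.ofReal_ne_top,
        integrable_map_equiv] at h2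
      exact h2
    refine h1.bdd_mul (c := 1) ?_ (Filter.Eventually.of_forall fun ξ => (norm_ch _).le)
    refine Continuous.aestronglyMeasurable ?_
    unfold ch
    fun_prop
  rw [SchwartzMap.fourier_coe, Real.fourier_eq', hs]
  have h1 : ∀ ξ : EuclideanSpace ℝ (Fin d),
      Complex.exp (↑(-2 * Real.pi * inner ℝ ξ x) * Complex.I) • (w (dil ε⁻¹ ξ) * trigPoly F a ξ) =
      ∑ y ∈ F, a y * (ch (-inner ℝ ξ (x - latticePoint y)) * w (dil ε⁻¹ ξ)) := by
    intro ξ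
    rw [hch, smul_eq_mul, trigPoly, Finset.mul_sum, Finset.mul_sum]
    refine Finset.sum_congr rfl fun y _ => ?_
    have : -inner ℝ ξ (x - latticePoint y) = -inner ℝ ξ x + phase ξ y := by
      rw [inner_sub_right]
      have : inner ℝ ξ (latticePoint y) = phase ξ y := by
        rw [PiLp.inner_apply]
        simp [phase, latticePoint, mul_comm]
      rw [this]; ring
    rw [this, ch_add]; ring
  simp_rw [h1]
  rw [integral_finsetSum _ fun y _ => (hint y).const_mul _]
  refine Finset.sum_congr rfl fun y _ => ?_
  rw [integral_const_mul, hS, SchwartzMap.fourier_coe, Real.fourier_eq',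
    ← integral_comp_dil hε]
  congr 3
  ext v
  rw [dil_inv_dil hε, hch, smul_eq_mul]
  congr 3
  simp only [PiLp.inner_apply, dil_apply]
  refine Finset.sum_congr rfl fun i _ => ?_
  simp
  ring

/-- The inverse Fourier transform of `Θ w` at a lattice point. -/
noncomputable def multKernel (Θ w : EuclideanSpace ℝ (Fin d) → ℂ) (z : Fin d → ℤ) : ℂ :=
  ∫ ξ, Θ ξ * w ξ * ch (phase ξ z)

/-- The extension of a sequence on the lattice to a function on `ℝ^d` with compact spectrum is
bounded from `ℓ^p` to `L^p`. -/
theorem exists_eLpNorm_fourier_le {w : EuclideanSpace ℝ (Fin d) → ℂ} {R : ℝ}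
    (hw : ContDiff ℝ ∞ w) (hw0 : ∀ x, R ≤ ‖x‖ → w x = 0) {p : ℝ≥0∞} (hp1 : 1 ≤ p) (hp : p < ⊤) :
    ∃ C : ℝ, 0 ≤ C ∧ ∀ (ε : Fin d → ℝ), (∀ i, 0 < ε i ∧ ε i ≤ 1) →
      ∀ (F : Finset (Fin d → ℤ)) (a : (Fin d → ℤ) → ℂ) (s : 𝓢(EuclideanSpace ℝ (Fin d), ℂ)),
        (⇑s = fun ξ => w (dil ε⁻¹ ξ) * trigPoly F a ξ) →
        eLpNorm (⇑(𝓕 s : 𝓢(EuclideanSpace ℝ (Fin d), ℂ))) p volume ≤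
          ENNReal.ofReal C * (∑ y ∈ F, ‖a y‖ₑ ^ p.toReal) ^ (1 / p.toReal) := by
  have hcs : HasCompactSupport w :=
    HasCompactSupport.intro (isCompact_closedBall (0 : EuclideanSpace ℝ (Fin d)) R) fun ξ hξ => by
      simp only [Metric.mem_closedBall, dist_zero_right, not_le] at hξ
      exact hw0 ξ hξ.le
  set W := hcs.toSchwartzMap hw
  have hp0 : p ≠ 0 := fun h => by simp [h] at hp1
  have hp1' : 1 ≤ p.toReal := by
    rw [← ENNReal.toReal_one]
    exact ENNReal.toReal_mono hp.ne hp1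
  obtain ⟨C, hC0, hC⟩ := exists_lintegral_interpolation_le (𝓕 W) hp1'
  refine ⟨C, hC0, fun ε hε F a s hs => ?_⟩
  rw [eLpNorm_eq_lintegral_rpow_enorm_toReal hp0 hp.ne]
  have h := fourier_trigPoly (w := W) rfl (fun i => (hε i).1) F a hs
  simp_rw [h]
  exact hC ε hε F a

/-- Hölder's inequality for the inner product of `L²`. -/
theorem enorm_inner_le {p q : ℝ≥0∞} (hpq : p.toReal.HolderConjugate q.toReal) (hp : p < ⊤)
    (hq : q < ⊤) (h g : Lp ℂ 2 (volume : Measure (EuclideanSpace ℝ (Fin d)))) :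
    ‖inner ℂ h g‖ₑ ≤ eLpNorm h q volume * eLpNorm g p volume := by
  have hp0 : p ≠ 0 := fun h => by have := hpq.pos; simp [h] at this
  have hq0 : q ≠ 0 := fun h => by have := hpq.symm.pos; simp [h] at this
  rw [L2.inner_def, eLpNorm_eq_lintegral_rpow_enorm_toReal hp0 hp.ne,
    eLpNorm_eq_lintegral_rpow_enorm_toReal hq0 hq.ne]
  calc _ ≤ ∫⁻ x, ‖inner ℂ (h x) (g x)‖ₑ := enorm_integral_le_lintegral_enorm _
    _ ≤ ∫⁻ x, ((fun x => ‖h x‖ₑ) * fun x => ‖g x‖ₑ) x := by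
        refine lintegral_mono fun x => ?_
        simp only [Pi.mul_apply, ← ofReal_norm]
        rw [← ENNReal.ofReal_mul (norm_nonneg _)]
        exact ENNReal.ofReal_le_ofReal (norm_inner_le_norm _ _)
    _ ≤ _ := ENNReal.lintegral_mul_le_Lp_mul_Lq _ hpq.symm
        (Lp.aestronglyMeasurable h).enorm (Lp.aestronglyMeasurable g).enorm

/-- The multiplier bound is applied to a Schwartz function whose transform is `w`: the image lies in
`L²`, so `Θ w` is square integrable, on a bounded set. -/
theorem IsMultiplierBound.integrable_mul_cutoff {Θ : EuclideanSpace ℝ (Fin d) → ℂ} {p : ℝ≥0∞}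
    {A : ℝ} (hA : IsMultiplierBound Θ p A) {w : EuclideanSpace ℝ (Fin d) → ℂ} {R : ℝ}
    (hw : ContDiff ℝ ∞ w) (hw0 : ∀ x, R ≤ ‖x‖ → w x = 0) :
    Integrable fun ξ => Θ ξ * w ξ := by
  have hcs : HasCompactSupport w :=
    HasCompactSupport.intro (isCompact_closedBall (0 : EuclideanSpace ℝ (Fin d)) R) fun ξ hξ => by
      simp only [Metric.mem_closedBall, dist_zero_right, not_le] at hξ
      exact hw0 ξ hξ.le
  set W := hcs.toSchwartzMap hw
  have hW : ⇑W = w := rfl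
  have hmem : MemLp (⇑((𝓕 W : 𝓢(EuclideanSpace ℝ (Fin d), ℂ)).toLp 2 volume)) p volume :=
    ((𝓕 W : 𝓢(EuclideanSpace ℝ (Fin d), ℂ)).memLp p volume).ae_eq
      (SchwartzMap.coeFn_toLp _ 2 volume).symm
  obtain ⟨g, hg, -⟩ := hA _ hmem
  have h1 : (fun ξ => Θ ξ * w ξ) =ᵐ[volume] ⇑(𝓕⁻ g : Lp ℂ 2 (volume : Measure (EuclideanSpace ℝ (Fin d)))) := by
    rw [SchwartzMap.toLp_fourierInv_eq, FourierTransform.fourierInv_fourier_eq] at hg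
    filter_upwards [hg, SchwartzMap.coeFn_toLp W 2 volume] with ξ h1 h2
    rw [h1, h2, hW]
  have h2 : MemLp (fun ξ => Θ ξ * w ξ) 2 volume := (memLp_congr_ae h1).2 (Lp.memLp _)
  have hfin : IsFiniteMeasure ((volume : Measure (EuclideanSpace ℝ (Fin d))).restrict
      (Metric.closedBall 0 R)) :=
    ⟨by rw [Measure.restrict_apply_univ]; exact measure_closedBall_lt_top⟩
  have h3 : IntegrableOn (fun ξ => Θ ξ * w ξ) (Metric.closedBall 0 R) :=
    MemLp.integrable one_le_two (h2.mono_measure Measure.restrict_le_self)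
  refine (integrableOn_iff_integrable_of_support_subset ?_).1 h3
  intro ξ hξ
  rw [Metric.mem_closedBall, dist_zero_right]
  by_contra hlt
  exact hξ (by simp only [hw0 ξ (not_le.1 hlt).le, mul_zero])

/-- Transference: a multiplier of `L^p(ℝ^d)`, localized near the origin at a scale `ε ≤ 1/2`,
gives a convolution operator on `ℓ^p(ℤ^d)` bounded uniformly in `ε`. -/
theorem exists_transfer_bound {η : EuclideanSpace ℝ (Fin d) → ℝ} (hη : IsCutoff η)
    {m : EuclideanSpace ℝ (Fin d) → ℂ} (hm : ContDiff ℝ ∞ m)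
    (hm0 : ∀ x, 1 / (8 * (d : ℝ)) ≤ ‖x‖ → m x = 0) {p q : ℝ≥0∞}
    (hpq : p.toReal.HolderConjugate q.toReal) :
    ∃ C : ℝ, 0 ≤ C ∧ ∀ (Θ : EuclideanSpace ℝ (Fin d) → ℂ) (A : ℝ), 0 ≤ A →
      IsMultiplierBound Θ p A → ∀ (ε : Fin d → ℝ), (∀ i, 0 < ε i ∧ ε i ≤ 1 / 2) →
      (Integrable fun ξ => Θ ξ * m (dil ε⁻¹ ξ)) ∧
      ∀ (F : Finset (Fin d → ℤ)) (a b : (Fin d → ℤ) → ℂ),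
        ‖∑ x ∈ F, ∑ y ∈ F, b x * a y * multKernel Θ (fun ξ => m (dil ε⁻¹ ξ)) (y - x)‖ ≤
          C * A * ((∑ y ∈ F, ‖a y‖ ^ p.toReal) ^ (1 / p.toReal) *
            (∑ x ∈ F, ‖b x‖ ^ q.toReal) ^ (1 / q.toReal)) := by
  have htop : ∀ r : ℝ≥0∞, 1 < r.toReal → 1 ≤ r ∧ r < ⊤ := by
    intro r hr
    have h1 : r ≠ ⊤ := fun h => by rw [h] at hr; norm_num at hr
    refine ⟨?_, h1.lt_top⟩
    by_contra hlt
    have := ENNReal.toReal_mono ENNReal.one_ne_top (not_le.1 hlt).le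
    rw [ENNReal.toReal_one] at this
    linarith
  obtain ⟨hp1, hp⟩ := htop p hpq.lt
  obtain ⟨hq1, hq⟩ := htop q hpq.symm.lt
  set w : EuclideanSpace ℝ (Fin d) → ℂ := fun ξ => (η ξ : ℂ) with hwdef
  have hw : ContDiff ℝ ∞ w := Complex.ofRealCLM.contDiff.comp hη.smooth
  have hw0 : ∀ x, 1 / (8 * (d : ℝ)) ≤ ‖x‖ → w x = 0 := fun x hx => by
    simp only [hwdef, hη.eq_zero x hx, Complex.ofReal_zero]
  obtain ⟨C₁, hC₁0, hC₁⟩ := exists_eLpNorm_fourier_le hm hm0 hp1 hp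
  obtain ⟨C₂, hC₂0, hC₂⟩ := exists_eLpNorm_fourier_le hw hw0 hq1 hq
  refine ⟨C₁ * C₂, mul_nonneg hC₁0 hC₂0, fun Θ A hA0 hA ε hε => ?_⟩
  have hε1 : ∀ i, 0 < ε i ∧ ε i ≤ 1 := fun i => ⟨(hε i).1, (hε i).2.trans (by norm_num)⟩
  -- the cutoff `η` equals one on the support of the dilated function
  have hwm : ∀ ξ, w ξ * m (dil ε⁻¹ ξ) = m (dil ε⁻¹ ξ) := by
    intro ξ
    by_cases hξ : ‖ξ‖ ≤ 1 / (16 * (d : ℝ))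
    · simp only [hwdef, hη.eq_one ξ hξ, Complex.ofReal_one, one_mul]
    · rw [dil_inv_eq_zero hm0 hε (by norm_num), mul_zero]
      have : (1 / 2 : ℝ) * (1 / (8 * (d : ℝ))) = 1 / (16 * d) := by
        rw [one_div_mul_one_div]; congr 1; ring
      rw [this]; exact (not_le.1 hξ).le
  have hint : Integrable fun ξ => Θ ξ * m (dil ε⁻¹ ξ) := by
    have h1 := hA.integrable_mul_cutoff hw hw0
    obtain ⟨c, hc⟩ : ∃ c, ∀ x, ‖m x‖ ≤ c := by
      have hcs : HasCompactSupport m :=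
        HasCompactSupport.intro (isCompact_closedBall (0 : EuclideanSpace ℝ (Fin d)) (1 / (8 * (d : ℝ))))
          fun ξ hξ => by
            simp only [Metric.mem_closedBall, dist_zero_right, not_le] at hξ
            exact hm0 ξ hξ.le
      exact hm.continuous.bounded_above_of_compact_support hcs
    have h2 : (fun ξ => Θ ξ * m (dil ε⁻¹ ξ)) = fun ξ => Θ ξ * w ξ * m (dil ε⁻¹ ξ) := by
      ext ξ; rw [mul_assoc, hwm]
    rw [h2]
    exact h1.mul_bdd (c := c)
      (hm.continuous.comp (contDiff_dil _).continuous).aestronglyMeasurable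
      (Filter.Eventually.of_forall fun ξ => hc _)
  refine ⟨hint, fun F a b => ?_⟩
  set b' : (Fin d → ℤ) → ℂ := fun x => (starRingEnd ℂ) (b x) with hb'
  obtain ⟨s, hs⟩ := exists_schwartz_trigPoly hm hm0 hε1 F a
  obtain ⟨t, ht⟩ := exists_schwartz_trigPoly hw hw0 (ε := fun _ => 1) (fun i => ⟨one_pos, le_rfl⟩) F b'
  set f := (𝓕 s : 𝓢(EuclideanSpace ℝ (Fin d), ℂ)).toLp 2 volume with hf
  set h := (𝓕 t : 𝓢(EuclideanSpace ℝ (Fin d), ℂ)).toLp 2 volume with hh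
  have hfae : ⇑f =ᵐ[volume] ⇑(𝓕 s : 𝓢(EuclideanSpace ℝ (Fin d), ℂ)) := SchwartzMap.coeFn_toLp _ 2 volume
  have hhae : ⇑h =ᵐ[volume] ⇑(𝓕 t : 𝓢(EuclideanSpace ℝ (Fin d), ℂ)) := SchwartzMap.coeFn_toLp _ 2 volume
  obtain ⟨g, hg, hgA⟩ := hA f (((𝓕 s : 𝓢(EuclideanSpace ℝ (Fin d), ℂ)).memLp p volume).ae_eq hfae.symm)
  have hgs : ∀ᵐ ξ, (𝓕⁻ g) ξ = Θ ξ * s ξ := by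
    rw [hf, SchwartzMap.toLp_fourierInv_eq, FourierTransform.fourierInv_fourier_eq] at hg
    filter_upwards [hg, SchwartzMap.coeFn_toLp s 2 volume] with ξ h1 h2
    rw [h1, h2]
  have hinner : inner ℂ h g =
      ∑ x ∈ F, ∑ y ∈ F, b x * a y * multKernel Θ (fun ξ => m (dil ε⁻¹ ξ)) (y - x) := by
    have h1 : inner ℂ h g = inner ℂ (t.toLp 2 volume) (𝓕⁻ g) := by
      rw [← Lp.inner_fourier_eq (t.toLp 2 volume) (𝓕⁻ g), FourierTransform.fourier_fourierInv_eq,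
        SchwartzMap.toLp_fourier_eq]
    rw [h1, L2.inner_def]
    have h2 : ∀ᵐ ξ, inner ℂ (t.toLp 2 volume ξ) ((𝓕⁻ g) ξ) =
        ∑ x ∈ F, ∑ y ∈ F, b x * a y * (Θ ξ * m (dil ε⁻¹ ξ) * ch (phase ξ (y - x))) := by
      filter_upwards [hgs, SchwartzMap.coeFn_toLp t 2 volume] with ξ h3 h4
      rw [h3, h4, ht, hs]
      have hone : dil (fun _ => (1 : ℝ))⁻¹ ξ = ξ := by ext i; simp
      simp only [RCLike.inner_apply, hone, map_mul, hwdef, Complex.conj_ofReal, trigPoly, map_sum, hb',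
        Complex.conj_conj, ← ch_neg]
      have h5 := hwm ξ
      simp only [hwdef] at h5
      calc _ = (η ξ * m (dil ε⁻¹ ξ)) * Θ ξ * ((∑ x ∈ F, b x * ch (-phase ξ x)) *
            ∑ y ∈ F, a y * ch (phase ξ y)) := by ring
        _ = _ := by
            rw [h5, Finset.sum_mul_sum, Finset.mul_sum]
            refine Finset.sum_congr rfl fun x _ => ?_
            rw [Finset.mul_sum]
            refine Finset.sum_congr rfl fun y _ => ?_
            rw [phase_sub, sub_eq_add_neg, ch_add]; ring
    rw [integral_congr_ae h2]
    have h3 : ∀ z, Integrable fun ξ => Θ ξ * m (dil ε⁻¹ ξ) * ch (phase ξ z) := fun z =>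
      hint.mul_bdd (c := 1) (continuous_ch_phase z).aestronglyMeasurable
        (Filter.Eventually.of_forall fun ξ => (norm_ch _).le)
    rw [integral_finsetSum _ fun x _ => integrable_finsetSum _ fun y _ => (h3 _).const_mul _]
    refine Finset.sum_congr rfl fun x _ => ?_
    rw [integral_finsetSum _ fun y _ => (h3 _).const_mul _]
    refine Finset.sum_congr rfl fun y _ => ?_
    rw [integral_const_mul]
    rfl
  have hbound : ‖inner ℂ h g‖ₑ ≤ ENNReal.ofReal (C₁ * C₂ * A *
      ((∑ y ∈ F, ‖a y‖ ^ p.toReal) ^ (1 / p.toReal) *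
            (∑ x ∈ F, ‖b x‖ ^ q.toReal) ^ (1 / q.toReal))) := by
    have hsum : ∀ (r : ℝ≥0∞) (c : (Fin d → ℤ) → ℂ), (∑ y ∈ F, ‖c y‖ₑ ^ r.toReal) ^ (1 / r.toReal) =
        ENNReal.ofReal ((∑ y ∈ F, ‖c y‖ ^ r.toReal) ^ (1 / r.toReal)) := by
      intro r c
      have hr : 0 ≤ r.toReal := ENNReal.toReal_nonneg
      rw [← ENNReal.ofReal_rpow_of_nonneg (Finset.sum_nonneg fun _ _ => by positivity) (by positivity),
        ENNReal.ofReal_sum_of_nonneg fun _ _ => by positivity]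
      congr 1
      refine Finset.sum_congr rfl fun y _ => ?_
      rw [← ENNReal.ofReal_rpow_of_nonneg (norm_nonneg _) hr, ofReal_norm]
    have e1 : eLpNorm h q volume ≤ ENNReal.ofReal C₂ *
        ENNReal.ofReal ((∑ x ∈ F, ‖b x‖ ^ q.toReal) ^ (1 / q.toReal)) := by
      rw [eLpNorm_congr_ae hhae]
      refine (hC₂ (fun _ => 1) (fun i => ⟨one_pos, le_rfl⟩) F b' t ht).trans_eq ?_
      rw [hsum]
      simp [hb']
    have e2 : eLpNorm g p volume ≤ ENNReal.ofReal A * (ENNReal.ofReal C₁ *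
        ENNReal.ofReal ((∑ y ∈ F, ‖a y‖ ^ p.toReal) ^ (1 / p.toReal))) := by
      refine hgA.trans ?_
      gcongr
      rw [eLpNorm_congr_ae hfae, ← hsum]
      exact hC₁ ε hε1 F a s hs
    refine (enorm_inner_le hpq hp hq h g).trans ((mul_le_mul' e1 e2).trans_eq ?_)
    rw [← ENNReal.ofReal_mul hC₁0, ← ENNReal.ofReal_mul hC₂0, ← ENNReal.ofReal_mul hA0,
      ← ENNReal.ofReal_mul (by positivity)]
    congr 1; ring
  rw [← hinner]
  rw [← ofReal_norm] at hbound
  exact (ENNReal.ofReal_le_ofReal_iff (by positivity)).1 hbound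

end Transference

/-! ### The operator as an average over the residues -/

/-- Hölder's inequality with weights. -/
theorem sum_weighted_holder {ι : Type*} (s : Finset ι) {p q : ℝ} (hpq : p.HolderConjugate q)
    {w u v : ι → ℝ} (hw : ∀ i ∈ s, 0 ≤ w i) (hu : ∀ i ∈ s, 0 ≤ u i) (hv : ∀ i ∈ s, 0 ≤ v i) :
    ∑ i ∈ s, w i * (u i ^ (1 / p) * v i ^ (1 / q)) ≤
      (∑ i ∈ s, w i * u i) ^ (1 / p) * (∑ i ∈ s, w i * v i) ^ (1 / q) := by
  have hp := hpq.pos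
  have hq := hpq.symm.pos
  have h := Real.inner_le_Lp_mul_Lq_of_nonneg s (f := fun i => (w i * u i) ^ (1 / p))
    (g := fun i => (w i * v i) ^ (1 / q)) hpq
    (fun i hi => Real.rpow_nonneg (mul_nonneg (hw i hi) (hu i hi)) _)
    (fun i hi => Real.rpow_nonneg (mul_nonneg (hw i hi) (hv i hi)) _)
  have e1 : ∑ i ∈ s, ((w i * u i) ^ (1 / p)) ^ p = ∑ i ∈ s, w i * u i :=
    Finset.sum_congr rfl fun i hi => by
      rw [← Real.rpow_mul (mul_nonneg (hw i hi) (hu i hi)), one_div_mul_cancel hp.ne', Real.rpow_one]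
  have e2 : ∑ i ∈ s, ((w i * v i) ^ (1 / q)) ^ q = ∑ i ∈ s, w i * v i :=
    Finset.sum_congr rfl fun i hi => by
      rw [← Real.rpow_mul (mul_nonneg (hw i hi) (hv i hi)), one_div_mul_cancel hq.ne', Real.rpow_one]
  rw [e1, e2] at h
  refine le_trans (le_of_eq (Finset.sum_congr rfl fun i hi => ?_)) h
  rw [Real.mul_rpow (hw i hi) (hu i hi), Real.mul_rpow (hw i hi) (hv i hi)]
  have : w i = w i ^ (1 / p) * w i ^ (1 / q) := by
    rw [← Real.rpow_add_of_nonneg (hw i hi) (by positivity) (by positivity)]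
    have := hpq.inv_add_inv_eq_one
    rw [one_div, one_div, this, Real.rpow_one]
  nth_rw 1 [this]
  ring

theorem tendsto_product_self (α : Type*) :
    Filter.Tendsto (fun s : Finset α => s ×ˢ s) Filter.atTop Filter.atTop := by
  classical
  refine Filter.tendsto_atTop_finset_of_monotone
    (fun s t h => Finset.product_subset_product h h) fun x => ⟨{x.1, x.2}, ?_⟩
  simp

section LowKernel

variable {n : ℕ} {G : Fin n → Type} [∀ i, Fintype (G i)] [∀ i, Nonempty (G i)]
  [∀ i, DecidableEq (G i)]

/-- The kernel of the projection to functions of low degree is idempotent. -/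
theorem expect_lowKernel_mul (D : ℕ) (b b' : ∀ i, G i) :
    𝔼 c, lowKernel D c b * lowKernel D c b' = lowKernel D b b' := by
  simp_rw [lowKernel_comm D _ b, lowKernel_comm D _ b']
  simp only [lowKernel, Finset.sum_mul_sum]
  rw [Finset.expect_sum_comm]
  refine Finset.sum_congr rfl fun A hA => ?_
  rw [Finset.expect_sum_comm]
  simp_rw [expect_setKernel_mul]
  rw [Finset.sum_ite_eq, if_pos hA]
  exact setKernel_comm _ _ _

end LowKernel

theorem abs_apply_le_norm {d : ℕ} (ξ : EuclideanSpace ℝ (Fin d)) (j : Fin d) : |ξ j| ≤ ‖ξ‖ := by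
  rw [← Real.norm_eq_abs]; exact PiLp.norm_apply_le ξ j

theorem one_div_eight_mul_le (d : ℕ) : 1 / (8 * (d : ℝ)) ≤ 1 / 8 := by
  rcases Nat.eq_zero_or_pos d with h | h
  · simp [h]
  · have : (1 : ℝ) ≤ d := by exact_mod_cast h
    exact one_div_le_one_div_of_le (by norm_num) (by linarith)

namespace BandKernel

variable (k : BandKernel) {d : ℕ}

/-- The function `∏_j χ(ξ_j)`, where `χ = k.hat` is the Fourier transform of the kernel. -/
def hatProd (ξ : EuclideanSpace ℝ (Fin d)) : ℝ := ∏ j, k.hat (ξ j)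

/-- The kernel `∏_j ε_j φ(ε_j x_j)` on the lattice, where `φ = k.ker`. -/
def dilateProd (ε : Fin d → ℝ) (x : Fin d → ℤ) : ℝ := ∏ j, k.dilate (ε j) (x j)

theorem summable_dilateProd {ε : Fin d → ℝ} (hε : ∀ i, 0 < ε i) :
    Summable fun x => ‖(k.dilateProd ε x : ℂ)‖ := by
  have h := (summable_and_tsum_prod (fun j (t : ℤ) => (k.dilate (ε j) t : ℂ)) fun j => by
    simpa using (k.summable_dilate (hε j)).abs).1
  refine h.congr fun x => ?_
  rw [dilateProd]; push_cast; rfl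

/-- The reproducing property at low frequencies. -/
theorem tsum_dilateProd_mul_ch {ε : Fin d → ℝ} (hε : ∀ i, 0 < ε i ∧ ε i ≤ 1 / 2)
    {ξ : EuclideanSpace ℝ (Fin d)} (hξ : ∀ j, |ξ j| ≤ 1 / 2) (x : Fin d → ℤ) :
    ∑' x', (k.dilateProd ε (x' - x) : ℂ) * ch (phase ξ x') =
      k.hatProd (dil ε⁻¹ ξ) * ch (phase ξ x) := by
  have h0 : ∑' t : Fin d → ℤ, (k.dilateProd ε t : ℂ) * ch (phase ξ t) = k.hatProd (dil ε⁻¹ ξ) := by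
    have h := (summable_and_tsum_prod (fun j (t : ℤ) => (k.dilate (ε j) t : ℂ) * ch (ξ j * t)) fun j => by
      simpa [norm_ch] using (k.summable_dilate (hε j).1).abs).2
    have h1 : ∀ t : Fin d → ℤ, (k.dilateProd ε t : ℂ) * ch (phase ξ t) =
        ∏ j, ((k.dilate (ε j) (t j) : ℂ) * ch (ξ j * t j)) := by
      intro t
      rw [dilateProd, phase, ch_sum, Finset.prod_mul_distrib]
      push_cast; rfl
    simp_rw [h1]
    rw [h, hatProd]
    push_cast
    refine Finset.prod_congr rfl fun j _ => ?_
    have := k.tsum_dilate_mul_exp (hε j).1 (hε j).2 (hξ j)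
    rw [dil_apply, Pi.inv_apply, inv_mul_eq_div, ← this]
    rfl
  rw [← h0, ← tsum_mul_right, ← (Equiv.subRight x).tsum_eq
    fun t : Fin d → ℤ => (k.dilateProd ε t : ℂ) * ch (phase ξ t) * ch (phase ξ x)]
  refine tsum_congr fun x' => ?_
  simp only [Equiv.subRight_apply]
  rw [mul_assoc, ← ch_add]
  congr 2
  rw [phase_sub]; ring

theorem hatProd_ne_zero {ξ : EuclideanSpace ℝ (Fin d)} (h : ∀ j, |ξ j| < 1) : k.hatProd ξ ≠ 0 :=
  Finset.prod_ne_zero_iff.2 fun j _ => k.hat_ne_zero _ (h j)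

theorem contDiff_hatProd : ContDiff ℝ ∞ (k.hatProd (d := d)) := by
  unfold hatProd
  refine contDiff_prod fun j _ => k.smooth.comp ?_
  fun_prop

/-- The quotient `η / χ²`, which is smooth because `χ` has no zeros on the support of `η`. -/
noncomputable def quotient (η : EuclideanSpace ℝ (Fin d) → ℝ) (ξ : EuclideanSpace ℝ (Fin d)) : ℂ :=
  ((η ξ / k.hatProd ξ ^ 2 : ℝ) : ℂ)

theorem quotient_eq_zero {η : EuclideanSpace ℝ (Fin d) → ℝ} (hη : IsCutoff η)
    {x : EuclideanSpace ℝ (Fin d)} (hx : 1 / (8 * (d : ℝ)) ≤ ‖x‖) : k.quotient η x = 0 := by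
  rw [quotient, hη.eq_zero x hx]; simp

theorem quotient_mul {η : EuclideanSpace ℝ (Fin d) → ℝ} (hη : IsCutoff η)
    (x : EuclideanSpace ℝ (Fin d)) : k.quotient η x * k.hatProd x ^ 2 = η x := by
  by_cases hx : 1 / (8 * (d : ℝ)) ≤ ‖x‖
  · rw [k.quotient_eq_zero hη hx, hη.eq_zero x hx]; simp
  · have hne : k.hatProd x ≠ 0 := k.hatProd_ne_zero fun j =>
      (abs_apply_le_norm x j).trans_lt (by linarith [one_div_eight_mul_le d])
    rw [quotient]
    norm_cast
    exact div_mul_cancel₀ _ (pow_ne_zero 2 hne)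

theorem contDiff_quotient {η : EuclideanSpace ℝ (Fin d) → ℝ} (hη : IsCutoff η) :
    ContDiff ℝ ∞ (k.quotient η) := by
  refine Complex.ofRealCLM.contDiff.comp ?_
  rw [contDiff_iff_contDiffAt]
  intro x
  by_cases hx : ‖x‖ < 1
  · exact hη.smooth.contDiffAt.div (k.contDiff_hatProd.contDiffAt.pow 2)
      (pow_ne_zero 2 (k.hatProd_ne_zero fun j => (abs_apply_le_norm x j).trans_lt hx))
  · have hev : (fun x => η x / k.hatProd x ^ 2) =ᶠ[nhds x] fun _ => 0 := by
      have hopen : IsOpen {y : EuclideanSpace ℝ (Fin d) | 1 / 2 < ‖y‖} :=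
        isOpen_lt continuous_const continuous_norm
      filter_upwards [hopen.mem_nhds (show 1 / 2 < ‖x‖ by linarith)] with y hy
      rw [hη.eq_zero y, zero_div]
      have hy' : 1 / 2 < ‖y‖ := hy
      linarith [one_div_eight_mul_le d]
    exact contDiffAt_const.congr_of_eventuallyEq hev

/-- Convolving the localized kernel with `η / χ²` on both sides recovers the kernel with `η`. -/
theorem hasSum_dilateProd_mul_multKernel {η : EuclideanSpace ℝ (Fin d) → ℝ} (hη : IsCutoff η)
    {Θ : EuclideanSpace ℝ (Fin d) → ℂ} {ε : Fin d → ℝ} (hε : ∀ i, 0 < ε i ∧ ε i ≤ 1 / 2)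
    (hint : Integrable fun ξ => Θ ξ * k.quotient η (dil ε⁻¹ ξ)) (x y : Fin d → ℤ) :
    HasSum (fun z : (Fin d → ℤ) × (Fin d → ℤ) =>
      ((k.dilateProd ε (z.1 - x) : ℂ) * k.dilateProd ε (z.2 - y)) *
        multKernel Θ (fun ξ => k.quotient η (dil ε⁻¹ ξ)) (z.2 - z.1))
      (multKernel Θ (fun ξ => (η (dil ε⁻¹ ξ) : ℂ)) (y - x)) := by
  have hs0 := k.summable_dilateProd fun i => (hε i).1
  have hs : ∀ x : Fin d → ℤ, Summable fun x' => ‖(k.dilateProd ε (x' - x) : ℂ)‖ := fun x =>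
    (Equiv.subRight x).summable_iff.2 hs0
  have hch : ∀ z, Integrable fun ξ => Θ ξ * k.quotient η (dil ε⁻¹ ξ) * ch (phase ξ z) := fun z =>
    hint.mul_bdd (c := 1) (continuous_ch_phase z).aestronglyMeasurable
      (Filter.Eventually.of_forall fun ξ => (norm_ch _).le)
  set Fz : (Fin d → ℤ) × (Fin d → ℤ) → EuclideanSpace ℝ (Fin d) → ℂ := fun z ξ =>
    ((k.dilateProd ε (z.1 - x) : ℂ) * k.dilateProd ε (z.2 - y)) *
      (Θ ξ * k.quotient η (dil ε⁻¹ ξ) * ch (phase ξ (z.2 - z.1))) with hFz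
  have h1 := hasSum_integral_of_summable_integral_norm (μ := volume) (F := Fz)
    (fun z => (hch _).const_mul _) (by
      simp only [hFz, norm_mul, norm_ch, mul_one, integral_const_mul]
      refine Summable.mul_right _ ?_
      have := summable_mul_of_summable_norm (f := fun x' => ‖(k.dilateProd ε (x' - x) : ℂ)‖)
        (g := fun x' => ‖(k.dilateProd ε (x' - y) : ℂ)‖) (by simpa using hs x) (by simpa using hs y)
      exact this)
  have h2 : ∀ z, ∫ ξ, Fz z ξ = ((k.dilateProd ε (z.1 - x) : ℂ) * k.dilateProd ε (z.2 - y)) *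
        multKernel Θ (fun ξ => k.quotient η (dil ε⁻¹ ξ)) (z.2 - z.1) := by
    intro z
    simp only [hFz]
    rw [integral_const_mul]
    rfl
  simp_rw [h2] at h1
  suffices hfin : multKernel Θ (fun ξ => (η (dil ε⁻¹ ξ) : ℂ)) (y - x) = ∫ ξ, ∑' z, Fz z ξ by
    rw [hfin]; exact h1
  change ∫ ξ, Θ ξ * (η (dil ε⁻¹ ξ) : ℂ) * ch (phase ξ (y - x)) = _
  congr 1
  ext ξ
  by_cases hξ : ‖ξ‖ ≤ 1 / 2
  · have hξj : ∀ j, |ξ j| ≤ 1 / 2 := fun j => (abs_apply_le_norm ξ j).trans hξ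
    have e1 := k.tsum_dilateProd_mul_ch hε hξj y
    have e2 := congrArg (starRingEnd ℂ) (k.tsum_dilateProd_mul_ch hε hξj x)
    rw [Complex.conj_tsum, map_mul, Complex.conj_ofReal, ← ch_neg] at e2
    simp only [map_mul, Complex.conj_ofReal, ← ch_neg] at e2
    have e3 : ∀ z : (Fin d → ℤ) × (Fin d → ℤ), Fz z ξ = (Θ ξ * k.quotient η (dil ε⁻¹ ξ)) *
        (((k.dilateProd ε (z.1 - x) : ℂ) * ch (-phase ξ z.1)) *
          ((k.dilateProd ε (z.2 - y) : ℂ) * ch (phase ξ z.2))) := by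
      intro z
      simp only [hFz]
      rw [ch_phase_sub]; ring
    have e4 := tsum_mul_tsum_of_summable_norm
      (f := fun x' => (k.dilateProd ε (x' - x) : ℂ) * ch (-phase ξ x'))
      (g := fun y' => (k.dilateProd ε (y' - y) : ℂ) * ch (phase ξ y'))
      (by simpa only [norm_mul, norm_ch, mul_one] using hs x)
      (by simpa only [norm_mul, norm_ch, mul_one] using hs y)
    simp_rw [e3]
    rw [tsum_mul_left, ← e4, e1, e2, ch_phase_sub, ← k.quotient_mul hη]
    ring
  · have h3 : ∀ z, Fz z ξ = 0 := by
      intro z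
      simp only [hFz]
      rw [dil_inv_eq_zero (fun x hx => k.quotient_eq_zero hη hx) hε (by norm_num)]
      · simp
      · linarith [one_div_eight_mul_le d]
    simp_rw [h3, tsum_zero]
    rw [dil_inv_eq_zero hη.eq_zero hε (by norm_num)]
    · simp
    · linarith [one_div_eight_mul_le d]

theorem latticeKernel_eq (M₀ : ℕ) (ε : Fin d → ℝ) (x : Fin d → ℤ) (c : Fin d → ZMod M₀)
    (y : Fin d → ℤ) :
    k.latticeKernel M₀ ε (x, c) y =
      (M₀ : ℝ) ^ d * k.dilateProd ε (x - y) * if (∀ j, (y j : ZMod M₀) = c j) then 1 else 0 := by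
  rw [latticeKernel, Finset.prod_mul_distrib, Finset.prod_mul_distrib, Finset.prod_const,
    Finset.card_univ, Fintype.card_fin, dilateProd]
  congr 1
  split_ifs with h
  · exact Finset.prod_eq_one fun j _ => if_pos (h j)
  · push Not at h
    obtain ⟨j, hj⟩ := h
    exact Finset.prod_eq_zero (Finset.mem_univ j) (if_neg hj)

/-- Averaging over the residues turns the product of the two low parts into the kernel of the
exponential sum. -/
theorem sum_expect_lowPart_mul (M₀ : ℕ) [NeZero M₀] (ε : Fin d → ℝ) {n : ℕ} (q : Fin n → ℕ)
    [∀ i, NeZero (q i)] (D : ℕ) (F : Finset (Fin d → ℤ)) (f g : (Fin d → ℤ) → ℂ)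
    (x' y' : Fin d → ℤ) :
    ∑ c₀ : Fin d → ZMod M₀, ((M₀ : ℂ) ^ d)⁻¹ *
      𝔼 c, lowPart D (k.latticeKernel M₀ ε (x', c₀)) (residues q) F g c *
        lowPart D (k.latticeKernel M₀ ε (y', c₀)) (residues q) F f c =
    ∑ x ∈ F, ∑ y ∈ F, (g x * f y * ((if ∀ j, (x j : ZMod M₀) = y j then (M₀ : ℂ) ^ d else 0) *
      lowKernel D (residues q x) (residues q y))) *
        ((k.dilateProd ε (x' - x) : ℂ) * k.dilateProd ε (y' - y)) := by
  classical
  have hM : ((M₀ : ℂ) ^ d) ≠ 0 := pow_ne_zero _ (by exact_mod_cast NeZero.ne M₀)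
  have h1 : ∀ c₀ : Fin d → ZMod M₀,
      𝔼 c, lowPart D (k.latticeKernel M₀ ε (x', c₀)) (residues q) F g c *
        lowPart D (k.latticeKernel M₀ ε (y', c₀)) (residues q) F f c =
      ∑ x ∈ F, ∑ y ∈ F, ((k.latticeKernel M₀ ε (x', c₀) x : ℂ) * g x) *
        ((k.latticeKernel M₀ ε (y', c₀) y : ℂ) * f y) *
          lowKernel D (residues q x) (residues q y) := by
    intro c₀
    simp_rw [lowPart_eq, Finset.sum_mul_sum]
    rw [Finset.expect_sum_comm]
    refine Finset.sum_congr rfl fun x _ => ?_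
    rw [Finset.expect_sum_comm]
    refine Finset.sum_congr rfl fun y _ => ?_
    rw [← expect_lowKernel_mul D (residues q x) (residues q y)]
    have : ((𝔼 c, lowKernel D c (residues q x) * lowKernel D c (residues q y) : ℝ) : ℂ) =
        𝔼 c, ((lowKernel D c (residues q x) : ℂ) * lowKernel D c (residues q y)) := by
      rw [Fintype.expect_eq_sum_div_card, Fintype.expect_eq_sum_div_card]; push_cast; rfl
    rw [this, Finset.mul_expect]
    exact Finset.expect_congr rfl fun c _ => by ring
  simp_rw [h1, Finset.mul_sum]
  rw [Finset.sum_comm]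
  refine Finset.sum_congr rfl fun x _ => ?_
  rw [Finset.sum_comm]
  refine Finset.sum_congr rfl fun y _ => ?_
  rw [Finset.sum_eq_single fun j => (x j : ZMod M₀)]
  · simp_rw [latticeKernel_eq]
    have : (∀ j, (y j : ZMod M₀) = x j) ↔ ∀ j, (x j : ZMod M₀) = y j :=
      forall_congr' fun j => eq_comm
    simp only [this, implies_true, if_true]
    push_cast
    split_ifs
    · push_cast; field_simp
    · simp
  · intro c₀ _ hc₀
    rw [latticeKernel_eq, if_neg]
    · simp
    · intro h; exact hc₀ (funext fun j => (h j).symm)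
  · simp

end BandKernel

/-- The kernel of the exponential sum times the localized kernel of `Θ` defines an operator on
`ℓ^p`, bounded uniformly in the moduli and in `ε`: it is the average over the residues of the
transferred operator between the low parts. -/
theorem exists_pairing_bound {d : ℕ} {η : EuclideanSpace ℝ (Fin d) → ℝ} (hη : IsCutoff η) (r D : ℕ)
    (hr : 2 ≤ r) {p q : ℝ≥0∞} (hpq : p.toReal.HolderConjugate q.toReal)
    (hp1 : 2 * r / (2 * r - 1) < p.toReal) (hp2 : p.toReal < 2 * r)
    (hq1 : 2 * r / (2 * r - 1) < q.toReal) (hq2 : q.toReal < 2 * r) :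
    ∃ C : ℝ, 0 ≤ C ∧ ∀ (Θ : EuclideanSpace ℝ (Fin d) → ℂ) (A : ℝ), 0 ≤ A →
      IsMultiplierBound Θ p A → ∀ (ε : Fin d → ℝ), (∀ i, 0 < ε i ∧ ε i ≤ 1 / 2) →
      ∀ (M₀ : ℕ), 0 < M₀ → ∀ (n : ℕ) (s : Fin n → ℕ) [∀ i, NeZero (s i)],
      Pairwise (Function.onFun Nat.Coprime s) → (∀ i, M₀.Coprime (s i)) →
      (∀ B : Finset (Fin n), B.card ≤ 2 * r * D → ∀ j,
        M₀ * (∏ i : B, s i : ℕ) * (2 * r * ε j) ≤ 1) →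
      ∀ (F : Finset (Fin d → ℤ)) (f g : (Fin d → ℤ) → ℂ),
        ‖∑ x ∈ F, ∑ y ∈ F, g x * f y * ((if ∀ j, (x j : ZMod M₀) = y j then (M₀ : ℂ) ^ d else 0) *
            lowKernel D (residues s x) (residues s y)) *
              multKernel Θ (fun ξ => (η (dil ε⁻¹ ξ) : ℂ)) (y - x)‖ ≤
          C * A * ((∑ y ∈ F, ‖f y‖ ^ p.toReal) ^ (1 / p.toReal) *
            (∑ x ∈ F, ‖g x‖ ^ q.toReal) ^ (1 / q.toReal)) := by
  obtain ⟨k⟩ := exists_bandKernel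
  obtain ⟨C₀, hC₀0, hC₀⟩ := exists_transfer_bound hη (k.contDiff_quotient hη)
    (fun x hx => k.quotient_eq_zero hη hx) hpq
  obtain ⟨C₁, hC₁0, hC₁⟩ := exists_lowPart_bound r D hr p.toReal hp1 hp2
  obtain ⟨C₂, hC₂0, hC₂⟩ := exists_lowPart_bound r D hr q.toReal hq1 hq2
  refine ⟨C₀ * (C₁ ^ (1 / p.toReal) * C₂ ^ (1 / q.toReal)), by positivity, ?_⟩
  intro Θ A hA0 hA ε hε M₀ hM₀ n s _ hs hsM hεM F f g
  have : NeZero M₀ := ⟨hM₀.ne'⟩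
  obtain ⟨hint, htrans⟩ := hC₀ Θ A hA0 hA ε hε
  have hfam := k.uniformFamily M₀ hM₀ (fun i => (hε i).1) s hs hsM hr hεM
  have hμ : ∀ (X₀ : Finset (Fin d → ℤ)) y, ∑ x ∈ X₀ ×ˢ (Finset.univ : Finset (Fin d → ZMod M₀)),
      ((M₀ : ℝ) ^ d)⁻¹ * k.latticeKernel M₀ ε x y ≤ 1 := fun X₀ y =>
    k.sum_latticeKernel_le M₀ (fun i => (hε i).1) (fun i => (hε i).2.trans (by norm_num)) X₀ y
  set Lf := fun (x' : Fin d → ℤ) (c₀ : Fin d → ZMod M₀) =>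
    lowPart D (k.latticeKernel M₀ ε (x', c₀)) (residues s) F f with hLf
  set Lg := fun (x' : Fin d → ℤ) (c₀ : Fin d → ZMod M₀) =>
    lowPart D (k.latticeKernel M₀ ε (x', c₀)) (residues s) F g with hLg
  set mk : (Fin d → ℤ) → ℂ := multKernel Θ (fun ξ => k.quotient η (dil ε⁻¹ ξ)) with hmk
  set T := ∑ x ∈ F, ∑ y ∈ F, g x * f y * ((if ∀ j, (x j : ZMod M₀) = y j then (M₀ : ℂ) ^ d else 0) *
    lowKernel D (residues s x) (residues s y)) *
      multKernel Θ (fun ξ => (η (dil ε⁻¹ ξ) : ℂ)) (y - x) with hT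
  set S : Finset (Fin d → ℤ) → ℂ := fun X₀ => ∑ c₀ : Fin d → ZMod M₀, ((M₀ : ℂ) ^ d)⁻¹ *
    𝔼 c, ∑ x' ∈ X₀, ∑ y' ∈ X₀, Lg x' c₀ c * Lf y' c₀ c * mk (y' - x') with hS
  have hlim : Filter.Tendsto S Filter.atTop (nhds T) := by
    have h1 : ∀ X₀, S X₀ = ∑ x ∈ F, ∑ y ∈ F,
        g x * f y * ((if ∀ j, (x j : ZMod M₀) = y j then (M₀ : ℂ) ^ d else 0) *
          lowKernel D (residues s x) (residues s y)) * ∑ z ∈ X₀ ×ˢ X₀,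
            ((k.dilateProd ε (z.1 - x) : ℂ) * k.dilateProd ε (z.2 - y)) * mk (z.2 - z.1) := by
      intro X₀
      have h2 : S X₀ = ∑ x' ∈ X₀, ∑ y' ∈ X₀, (∑ c₀ : Fin d → ZMod M₀, ((M₀ : ℂ) ^ d)⁻¹ *
          𝔼 c, Lg x' c₀ c * Lf y' c₀ c) * mk (y' - x') := by
        simp only [hS, Finset.expect_sum_comm, Finset.mul_sum, Finset.sum_mul]
        rw [Finset.sum_comm]
        refine Finset.sum_congr rfl fun x' _ => ?_
        rw [Finset.sum_comm]
        refine Finset.sum_congr rfl fun y' _ => Finset.sum_congr rfl fun c₀ _ => ?_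
        rw [← Finset.expect_mul]; ring
      rw [h2]
      simp only [hLf, hLg, k.sum_expect_lowPart_mul, Finset.sum_product, Finset.sum_mul, Finset.mul_sum]
      refine (Finset.sum_congr rfl fun x' _ => Finset.sum_comm).trans (Finset.sum_comm.trans
        (Finset.sum_congr rfl fun x _ => ?_))
      refine (Finset.sum_congr rfl fun x' _ => Finset.sum_comm).trans (Finset.sum_comm.trans
        (Finset.sum_congr rfl fun y _ => Finset.sum_congr rfl fun x' _ =>
          Finset.sum_congr rfl fun y' _ => ?_))
      ring
    have h3 := fun x y => k.hasSum_dilateProd_mul_multKernel hη hε hint x y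
    have h5 : ∀ x y : Fin d → ℤ, Filter.Tendsto (fun X₀ : Finset (Fin d → ℤ) => ∑ z ∈ X₀ ×ˢ X₀,
        ((k.dilateProd ε (z.1 - x) : ℂ) * k.dilateProd ε (z.2 - y)) * mk (z.2 - z.1)) Filter.atTop
        (nhds (multKernel Θ (fun ξ => (η (dil ε⁻¹ ξ) : ℂ)) (y - x))) := by
      intro x y
      have h6 := h3 x y
      rw [HasSum, SummationFilter.unconditional_filter] at h6
      exact h6.comp (tendsto_product_self _)
    rw [Filter.tendsto_congr h1]
    exact tendsto_finsetSum _ fun x _ => tendsto_finsetSum _ fun y _ =>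
      Filter.Tendsto.const_mul _ (h5 x y)
  have hbound : ∀ X₀, ‖S X₀‖ ≤ C₀ * (C₁ ^ (1 / p.toReal) * C₂ ^ (1 / q.toReal)) * A *
      ((∑ y ∈ F, ‖f y‖ ^ p.toReal) ^ (1 / p.toReal) *
        (∑ x ∈ F, ‖g x‖ ^ q.toReal) ^ (1 / q.toReal)) := by
    intro X₀
    let Γ : Type := ∀ i : Fin n, Fin d → ZMod (s i)
    set w : ℝ := ((M₀ : ℝ) ^ d)⁻¹ * (Fintype.card Γ : ℝ)⁻¹ with hw
    have hw0 : 0 ≤ w := by positivity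
    set R : (Fin d → ZMod M₀) × Γ → ℂ := fun i =>
      ∑ x' ∈ X₀, ∑ y' ∈ X₀, Lg x' i.1 i.2 * Lf y' i.1 i.2 * mk (y' - x') with hR
    have e1 : S X₀ = ∑ i, (w : ℂ) * R i := by
      rw [Fintype.sum_prod_type]
      simp only [hS, hR, hw]
      refine Finset.sum_congr rfl fun c₀ _ => ?_
      rw [Fintype.expect_eq_sum_div_card, ← Finset.mul_sum]
      push_cast
      rw [div_eq_inv_mul, mul_assoc]
    have e2 : ∀ (t : ℝ) (h : (Fin d → ℤ) → ℂ), ∑ i : (Fin d → ZMod M₀) × Γ, w * ∑ x' ∈ X₀,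
        ‖lowPart D (k.latticeKernel M₀ ε (x', i.1)) (residues s) F h i.2‖ ^ t =
        ∑ x ∈ X₀ ×ˢ (Finset.univ : Finset (Fin d → ZMod M₀)), ((M₀ : ℝ) ^ d)⁻¹ *
          𝔼 c, ‖lowPart D (k.latticeKernel M₀ ε x) (residues s) F h c‖ ^ t := by
      intro t h
      rw [Finset.sum_product_right, Fintype.sum_prod_type]
      refine Finset.sum_congr rfl fun c₀ _ => ?_
      simp only [Fintype.expect_eq_sum_div_card, hw, Finset.mul_sum, div_eq_inv_mul]
      rw [Finset.sum_comm]
      refine Finset.sum_congr rfl fun x _ => Finset.sum_congr rfl fun c _ => ?_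
      rw [mul_assoc]
    have e3 : ∀ i, ‖R i‖ ≤ C₀ * A * ((∑ x' ∈ X₀, ‖Lf x' i.1 i.2‖ ^ p.toReal) ^ (1 / p.toReal) *
        (∑ x' ∈ X₀, ‖Lg x' i.1 i.2‖ ^ q.toReal) ^ (1 / q.toReal)) := fun i =>
      htrans X₀ (fun y' => Lf y' i.1 i.2) fun x' => Lg x' i.1 i.2
    have e4 := sum_weighted_holder (Finset.univ : Finset ((Fin d → ZMod M₀) × Γ)) hpq
      (w := fun _ => w) (u := fun i => ∑ x' ∈ X₀, ‖Lf x' i.1 i.2‖ ^ p.toReal)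
      (v := fun i => ∑ x' ∈ X₀, ‖Lg x' i.1 i.2‖ ^ q.toReal) (fun _ _ => hw0)
      (fun _ _ => Finset.sum_nonneg fun _ _ => by positivity)
      (fun _ _ => Finset.sum_nonneg fun _ _ => by positivity)
    have e5 : ∑ i : (Fin d → ZMod M₀) × Γ, w * ∑ x' ∈ X₀, ‖Lf x' i.1 i.2‖ ^ p.toReal ≤
        C₁ * ∑ y ∈ F, ‖f y‖ ^ p.toReal := by
      rw [hLf, e2]
      exact hC₁ n _ _ _ _ _ (fun _ => ((M₀ : ℝ) ^ d)⁻¹) _ F hfam (fun _ => by positivity) (hμ X₀) f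
    have e6 : ∑ i : (Fin d → ZMod M₀) × Γ, w * ∑ x' ∈ X₀, ‖Lg x' i.1 i.2‖ ^ q.toReal ≤
        C₂ * ∑ y ∈ F, ‖g y‖ ^ q.toReal := by
      rw [hLg, e2]
      exact hC₂ n _ _ _ _ _ (fun _ => ((M₀ : ℝ) ^ d)⁻¹) _ F hfam (fun _ => by positivity) (hμ X₀) g
    have hp0 := hpq.pos
    have hq0 := hpq.symm.pos
    calc ‖S X₀‖ ≤ ∑ i, ‖(w : ℂ) * R i‖ := by rw [e1]; exact norm_sum_le _ _
      _ ≤ ∑ i : (Fin d → ZMod M₀) × Γ, C₀ * A * (w *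
            ((∑ x' ∈ X₀, ‖Lf x' i.1 i.2‖ ^ p.toReal) ^ (1 / p.toReal) *
              (∑ x' ∈ X₀, ‖Lg x' i.1 i.2‖ ^ q.toReal) ^ (1 / q.toReal))) := by
          refine Finset.sum_le_sum fun i _ => ?_
          rw [norm_mul, Complex.norm_real, Real.norm_of_nonneg hw0]
          refine (mul_le_mul_of_nonneg_left (e3 i) hw0).trans_eq (by ring)
      _ ≤ C₀ * A * ((C₁ * ∑ y ∈ F, ‖f y‖ ^ p.toReal) ^ (1 / p.toReal) *
            (C₂ * ∑ y ∈ F, ‖g y‖ ^ q.toReal) ^ (1 / q.toReal)) := by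
          rw [← Finset.mul_sum]
          refine mul_le_mul_of_nonneg_left (e4.trans ?_) (mul_nonneg hC₀0 hA0)
          refine mul_le_mul (Real.rpow_le_rpow ?_ e5 (by positivity))
            (Real.rpow_le_rpow ?_ e6 (by positivity)) (by positivity) (by positivity)
          · exact Finset.sum_nonneg fun i _ => mul_nonneg hw0 (Finset.sum_nonneg fun _ _ => by positivity)
          · exact Finset.sum_nonneg fun i _ => mul_nonneg hw0 (Finset.sum_nonneg fun _ _ => by positivity)
      _ = _ := by
          rw [Real.mul_rpow hC₁0 (by positivity), Real.mul_rpow hC₂0 (by positivity)]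
          ring
  exact le_of_tendsto' hlim.norm hbound

/-! ### The size of the moduli -/

section Moduli

theorem factorial_le_exp_sq (n : ℕ) : ((n ! : ℕ) : ℝ) ≤ Real.exp ((n : ℝ) ^ 2) := by
  have h1 : ((n ! : ℕ) : ℝ) ≤ (n : ℝ) ^ n := by exact_mod_cast Nat.factorial_le_pow n
  have h2 : (n : ℝ) ≤ Real.exp n := by linarith [Real.add_one_le_exp (n : ℝ)]
  refine h1.trans ((pow_le_pow_left₀ (by positivity) h2 n).trans_eq ?_)
  rw [← Real.exp_nat_mul, sq]

/-- The exponent `N ^ (2 * ρ)` in the bound on `ε` beats the size `exp (O (N ^ ρ))` of the moduli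
`Q₀ * p₁ ^ D * ⋯ * p_m ^ D`, as soon as `N` is large. -/
theorem exists_bigQ_mul_le {ρ : ℝ} (hρ : 0 < ρ) (D m : ℕ) {c : ℝ} (hc : 0 < c) :
    ∃ N₁ : ℕ, ∀ N : ℕ, N₁ ≤ N → 1 ≤ N ∧
      ((cutN ρ N)! ^ D : ℕ) * (N : ℝ) ^ m * (c * Real.exp (-(N : ℝ) ^ (2 * ρ))) ≤ 1 := by
  set K : ℝ := 4 * D + m / ρ with hK
  have hK0 : 0 ≤ K := by positivity
  have ht := (tendsto_rpow_atTop hρ).comp tendsto_natCast_atTop_atTop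
  obtain ⟨N₁, hN₁⟩ := Filter.eventually_atTop.1
    ((ht.eventually_ge_atTop (K + |Real.log c| + 1)).and (Filter.eventually_ge_atTop 1))
  refine ⟨N₁, fun N hN => ⟨(hN₁ N hN).2, ?_⟩⟩
  obtain ⟨h1, h2⟩ := hN₁ N hN
  simp only [Function.comp_apply] at h1
  have hN1 : (1 : ℝ) ≤ N := by exact_mod_cast h2
  have hN0 : (0 : ℝ) < N := by linarith
  set t : ℝ := (N : ℝ) ^ ρ with ht
  have hsq : (N : ℝ) ^ (2 * ρ) = t ^ 2 := by
    rw [ht, ← Real.rpow_natCast, ← Real.rpow_mul hN0.le, mul_comm]; norm_num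
  have hhalf : ((N : ℝ) ^ (ρ / 2)) ^ 2 = t := by
    rw [ht, ← Real.rpow_natCast, ← Real.rpow_mul hN0.le]; norm_num
  have hone : (1 : ℝ) ≤ (N : ℝ) ^ (ρ / 2) := Real.one_le_rpow hN1 (by positivity)
  have hcut : ((cutN ρ N : ℕ) : ℝ) ^ 2 ≤ 4 * t := by
    have h3 : ((cutN ρ N : ℕ) : ℝ) ≤ 2 * (N : ℝ) ^ (ρ / 2) := by
      rw [cutN]; push_cast
      linarith [Nat.floor_le (show 0 ≤ (N : ℝ) ^ (ρ / 2) by positivity)]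
    calc ((cutN ρ N : ℕ) : ℝ) ^ 2 ≤ (2 * (N : ℝ) ^ (ρ / 2)) ^ 2 := by gcongr
      _ = 4 * t := by rw [mul_pow, hhalf]; norm_num
  have hfac : (((cutN ρ N)! ^ D : ℕ) : ℝ) ≤ Real.exp (D * (4 * t)) := by
    push_cast
    rw [Real.exp_nat_mul]
    exact pow_le_pow_left₀ (by positivity)
      ((factorial_le_exp_sq _).trans (Real.exp_le_exp.2 hcut)) D
  have hpow : (N : ℝ) ^ m ≤ Real.exp (m * (t / ρ)) := by
    rw [Real.exp_nat_mul]
    refine pow_le_pow_left₀ hN0.le ?_ m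
    exact (Real.le_exp_log _).trans (Real.exp_le_exp.2 (Real.log_le_rpow_div hN0.le hρ))
  have hlast : K * t + Real.log c ≤ t ^ 2 := by
    nlinarith [le_abs_self (Real.log c), abs_nonneg (Real.log c)]
  calc ((cutN ρ N)! ^ D : ℕ) * (N : ℝ) ^ m * (c * Real.exp (-(N : ℝ) ^ (2 * ρ)))
      ≤ Real.exp (D * (4 * t)) * Real.exp (m * (t / ρ)) *
          (Real.exp (Real.log c) * Real.exp (-(t ^ 2))) := by
        rw [hsq, Real.exp_log hc]; gcongr
    _ = Real.exp (K * t + Real.log c - t ^ 2) := by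
        rw [← Real.exp_add, ← Real.exp_add, ← Real.exp_add, hK]; congr 1; ring
    _ ≤ 1 := Real.exp_le_one_iff.2 (by linarith)

theorem exp_neg_rpow_le_half {N : ℕ} (hN : 1 ≤ N) {s : ℝ} (hs : 0 ≤ s) :
    Real.exp (-(N : ℝ) ^ s) ≤ 1 / 2 := by
  have h1 : (1 : ℝ) ≤ (N : ℝ) ^ s := Real.one_le_rpow (by exact_mod_cast hN) hs
  rw [Real.exp_neg, one_div]
  exact inv_anti₀ two_pos (by linarith [Real.add_one_le_exp ((N : ℝ) ^ s)])

end Moduli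

/-! ### The kernel of the periodic multiplier -/

section Kernel

variable {d : ℕ}

/-- The Fourier coefficients `∑_{u ∈ 𝒰_N} e(u · z) ∫ Θ(ξ) η_N(ξ) e(ξ · z) dξ` of `Δ_N`. -/
noncomputable def torusKernel (ρ : ℝ) (N : ℕ) (Θ : EuclideanSpace ℝ (Fin d) → ℂ)
    (η : EuclideanSpace ℝ (Fin d) → ℝ) (ε : Fin d → ℝ) (z : Fin d → ℤ) : ℂ :=
  (∑ u ∈ (finite_specialRationals d ρ N).toFinset, ch (phase u z)) *
    multKernel Θ (fun ξ => (η (dil ε⁻¹ ξ) : ℂ)) z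

/-- The bound for small `N`, where the number of frequencies is harmless. -/
theorem norm_sum_torusKernel_le {ρ : ℝ} {N : ℕ} {Θ : EuclideanSpace ℝ (Fin d) → ℂ}
    {η : EuclideanSpace ℝ (Fin d) → ℝ} {ε : Fin d → ℝ} {B p q : ℝ}
    (hB : ∀ (F : Finset (Fin d → ℤ)) (a b : (Fin d → ℤ) → ℂ),
      ‖∑ x ∈ F, ∑ y ∈ F, b x * a y * multKernel Θ (fun ξ => (η (dil ε⁻¹ ξ) : ℂ)) (y - x)‖ ≤
        B * ((∑ y ∈ F, ‖a y‖ ^ p) ^ (1 / p) * (∑ x ∈ F, ‖b x‖ ^ q) ^ (1 / q)))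
    (F : Finset (Fin d → ℤ)) (f g : (Fin d → ℤ) → ℂ) :
    ‖∑ x ∈ F, ∑ y ∈ F, g x * f y * torusKernel ρ N Θ η ε (y - x)‖ ≤
      (finite_specialRationals d ρ N).toFinset.card * (B *
        ((∑ y ∈ F, ‖f y‖ ^ p) ^ (1 / p) * (∑ x ∈ F, ‖g x‖ ^ q) ^ (1 / q))) := by
  have h1 : ∑ x ∈ F, ∑ y ∈ F, g x * f y * torusKernel ρ N Θ η ε (y - x) =
      ∑ u ∈ (finite_specialRationals d ρ N).toFinset, ∑ x ∈ F, ∑ y ∈ F,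
        (g x * ch (-phase u x)) * (f y * ch (phase u y)) *
          multKernel Θ (fun ξ => (η (dil ε⁻¹ ξ) : ℂ)) (y - x) := by
    symm
    rw [Finset.sum_comm]
    refine Finset.sum_congr rfl fun x _ => ?_
    rw [Finset.sum_comm]
    refine Finset.sum_congr rfl fun y _ => ?_
    rw [torusKernel, Finset.sum_mul, Finset.mul_sum]
    refine Finset.sum_congr rfl fun u _ => ?_
    rw [phase_sub, sub_eq_add_neg (phase u y), ch_add]
    ring
  rw [h1, ← nsmul_eq_mul]
  refine (norm_sum_le _ _).trans (Finset.sum_le_card_nsmul _ _ _ fun u _ => ?_)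
  refine (hB F (fun y => f y * ch (phase u y)) fun x => g x * ch (-phase u x)).trans_eq ?_
  simp only [norm_mul, norm_ch, mul_one]

/-- The pairing bound, uniform in `N`: for large `N` it is `exists_pairing_bound` with the prime powers
`p ^ bigD ρ` as moduli, and for the remaining `N` the number of frequencies is bounded. -/
theorem exists_torusKernel_bound {η : EuclideanSpace ℝ (Fin d) → ℝ} (hη : IsCutoff η) {ρ : ℝ}
    (hρ : 0 < ρ) {p q : ℝ≥0∞} (hpq : p.toReal.HolderConjugate q.toReal) :
    ∃ C : ℝ, 0 ≤ C ∧ ∀ (Θ : EuclideanSpace ℝ (Fin d) → ℂ) (A : ℝ), 0 ≤ A →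
      IsMultiplierBound Θ p A → ∀ N : ℕ, 2 ≤ N →
      ∀ ε : Fin d → ℝ, (∀ i, 0 < ε i ∧ ε i ≤ Real.exp (-(N : ℝ) ^ (2 * ρ))) →
      (Integrable fun ξ => Θ ξ * (η (dil ε⁻¹ ξ) : ℂ)) ∧
      ∀ (F : Finset (Fin d → ℤ)) (f g : (Fin d → ℤ) → ℂ),
        ‖∑ x ∈ F, ∑ y ∈ F, g x * f y * torusKernel ρ N Θ η ε (y - x)‖ ≤
          C * A * ((∑ y ∈ F, ‖f y‖ ^ p.toReal) ^ (1 / p.toReal) *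
            (∑ x ∈ F, ‖g x‖ ^ q.toReal) ^ (1 / q.toReal)) := by
  classical
  have hp1 := hpq.lt
  have hq1 := hpq.symm.lt
  -- An exponent `2 * r` beyond both `p` and `q`; by duality `(2 * r)' < p, q` as well.
  obtain ⟨r₀, hr₀⟩ := exists_nat_gt (max p.toReal q.toReal)
  set r : ℕ := max r₀ 2 with hr
  have hr2 : 2 ≤ r := le_max_right _ _
  have hrr : (r₀ : ℝ) ≤ r := by exact_mod_cast le_max_left _ _
  have hr2' : (2 : ℝ) ≤ r := by exact_mod_cast hr2
  have hpr : p.toReal < 2 * r := by linarith [le_max_left p.toReal q.toReal]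
  have hqr : q.toReal < 2 * r := by linarith [le_max_right p.toReal q.toReal]
  have hdual : ∀ {a b : ℝ}, a.HolderConjugate b → b < 2 * r → 2 * r / (2 * r - 1) < a := by
    intro a b hab hb
    have h1 := hab.lt
    have h2 := hab.symm.lt
    have h3 := hab.mul_eq_add
    rw [div_lt_iff₀ (by linarith)]
    have h4 : (a - 1) * (b - 1) = 1 := by linarith
    nlinarith
  obtain ⟨C₁, hC₁0, hC₁⟩ := exists_pairing_bound hη r (bigD ρ) hr2 hpq (hdual hpq hqr) hpr
    (hdual hpq.symm hpr) hqr
  obtain ⟨C₂, hC₂0, hC₂⟩ := exists_transfer_bound hη (m := fun x => (η x : ℂ))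
    (Complex.ofRealCLM.contDiff.comp hη.smooth) (fun x hx => by rw [hη.eq_zero x hx]; simp) hpq
  obtain ⟨N₁, hN₁⟩ := exists_bigQ_mul_le hρ (bigD ρ) (bigD ρ * (2 * r * bigD ρ))
    (c := 2 * r) (by linarith)
  obtain ⟨U, hU⟩ : ∃ U : ℕ → ℕ, ∀ N, (finite_specialRationals d ρ N).toFinset.card = U N :=
    ⟨_, fun _ => rfl⟩
  have hU0 : ∀ N, (0 : ℝ) ≤ U N * C₂ := fun N => mul_nonneg (Nat.cast_nonneg _) hC₂0
  refine ⟨C₁ + ∑ N ∈ Finset.range N₁, U N * C₂,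
    add_nonneg hC₁0 (Finset.sum_nonneg fun N _ => hU0 N), ?_⟩
  intro Θ A hA0 hA N hN ε hε
  have hN1 : 1 ≤ N := by omega
  have hε2 : ∀ i, 0 < ε i ∧ ε i ≤ 1 / 2 := fun i =>
    ⟨(hε i).1, (hε i).2.trans (exp_neg_rpow_le_half hN1 (by positivity))⟩
  obtain ⟨hint, htr⟩ := hC₂ Θ A hA0 hA ε hε2
  refine ⟨hint, fun F f g => ?_⟩
  set P := (∑ y ∈ F, ‖f y‖ ^ p.toReal) ^ (1 / p.toReal) *
    (∑ x ∈ F, ‖g x‖ ^ q.toReal) ^ (1 / q.toReal) with hP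
  have hP0 : 0 ≤ P := by positivity
  rcases lt_or_ge N N₁ with hlt | hge
  · refine (norm_sum_torusKernel_le htr F f g).trans ?_
    rw [← hP, hU]
    have h1 : U N * C₂ ≤ ∑ N ∈ Finset.range N₁, U N * C₂ :=
      Finset.single_le_sum (f := fun N => (U N : ℝ) * C₂) (fun N _ => hU0 N)
        (Finset.mem_range.2 hlt)
    calc _ = (U N * C₂) * A * P := by ring
      _ ≤ _ := by
        refine mul_le_mul_of_nonneg_right (mul_le_mul_of_nonneg_right ?_ hA0) hP0
        linarith
  · have hfin : (primeSet ρ N).Finite := (Set.finite_Iic N).subset fun x hx => hx.2.2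
    let e := hfin.toFinset.equivFin.symm
    let s : Fin hfin.toFinset.card → ℕ := fun i => (e i : ℕ)
    have hinj : Function.Injective s := Subtype.val_injective.comp e.injective
    have hmem : ∀ i, s i ∈ primeSet ρ N := fun i => hfin.mem_toFinset.1 (e i).2
    have hrange : Set.range s = primeSet ρ N := by
      refine Set.Subset.antisymm (Set.range_subset_iff.2 hmem) fun x hx => ?_
      exact ⟨e.symm ⟨x, hfin.mem_toFinset.2 hx⟩, by simp [s]⟩
    have : ∀ i, NeZero (s i ^ bigD ρ) := fun i => ⟨pow_ne_zero _ (hmem i).1.ne_zero⟩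
    have hker : ∀ x y, torusKernel ρ N Θ η ε (y - x) =
        ((if ∀ j, (x j : ZMod (bigQ ρ N)) = y j then (bigQ ρ N : ℂ) ^ d else 0) *
          lowKernel (bigD ρ) (residues (fun i => s i ^ bigD ρ) x)
            (residues (fun i => s i ^ bigD ρ) y)) *
        multKernel Θ (fun ξ => (η (dil ε⁻¹ ξ) : ℂ)) (y - x) := by
      intro x y
      rw [torusKernel, ← sum_ch_specialRationals hinj hrange]
      rfl
    have hmain := hC₁ Θ A hA0 hA ε hε2 (bigQ ρ N) (pow_pos (Nat.factorial_pos _) _) _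
      (fun i => s i ^ bigD ρ)
      (fun i j hij => Nat.Coprime.pow _ _
        ((Nat.coprime_primes (hmem i).1 (hmem j).1).2 fun h => hij (hinj h)))
      (fun i => Nat.Coprime.pow _ _ ((Nat.Prime.coprime_iff_not_dvd (hmem i).1).2 fun h =>
        absurd ((hmem i).1.dvd_factorial.1 h) (not_le.2 (hmem i).2.1)).symm)
      (fun B hB j => ?_) F f g
    · rw [← hP] at hmain
      simp only [hker, ← mul_assoc] at hmain ⊢
      refine hmain.trans (mul_le_mul_of_nonneg_right (mul_le_mul_of_nonneg_right ?_ hA0) hP0)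
      exact le_add_of_nonneg_right (Finset.sum_nonneg fun N _ => hU0 N)
    · obtain ⟨-, h2⟩ := hN₁ N hge
      refine le_trans ?_ h2
      have h3 : ((∏ i : B, s i ^ bigD ρ : ℕ) : ℝ) ≤ (N : ℝ) ^ (bigD ρ * (2 * r * bigD ρ)) := by
        have h4 : ∏ i : B, s i ^ bigD ρ ≤ N ^ (bigD ρ * (2 * r * bigD ρ)) := by
          calc ∏ i : B, s i ^ bigD ρ ≤ ∏ _i : B, N ^ bigD ρ :=
                Finset.prod_le_prod' fun i _ => Nat.pow_le_pow_left (hmem i).2.2 _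
            _ = N ^ (bigD ρ * B.card) := by simp [pow_mul]
            _ ≤ _ := Nat.pow_le_pow_right hN1 (Nat.mul_le_mul_left _ hB)
        exact_mod_cast h4
      rw [show bigQ ρ N = (cutN ρ N)! ^ bigD ρ from rfl]
      have := (hε j).2
      have := (hε j).1
      gcongr

end Kernel

/-! ### Operators on `ℓ^p` from pairing bounds -/

section Operator

theorem exists_norm_le_one_mul_eq_norm (z : ℂ) : ∃ c : ℂ, ‖c‖ ≤ 1 ∧ c * z = ‖z‖ := by
  rcases eq_or_ne z 0 with rfl | hz
  · exact ⟨0, by simp, by simp⟩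
  · have hz' : ((‖z‖ : ℝ) : ℂ) ≠ 0 := by exact_mod_cast norm_ne_zero_iff.2 hz
    refine ⟨(starRingEnd ℂ) z / ‖z‖, ?_, ?_⟩
    · rw [norm_div, RCLike.norm_conj, Complex.norm_real, norm_norm]
      exact div_self_le_one _
    · rw [div_mul_eq_mul_div, mul_comm, Complex.mul_conj, Complex.normSq_eq_norm_sq]
      push_cast
      rw [sq, mul_div_assoc, div_self hz', mul_one]

/-- The `ℓ^p` norm over a finite set is attained by pairing with the unit ball of `ℓ^q`. -/
theorem exists_dual_vector {ι : Type*} (s : Finset ι) {p q : ℝ} (hpq : p.HolderConjugate q)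
    (h : ι → ℂ) : ∃ g : ι → ℂ, ∑ x ∈ s, ‖g x‖ ^ q ≤ 1 ∧
      ∑ x ∈ s, g x * h x = (((∑ x ∈ s, ‖h x‖ ^ p) ^ (1 / p) : ℝ) : ℂ) := by
  obtain ⟨⟨g, hg, hg'⟩, -⟩ := NNReal.isGreatest_Lp s (fun i => ‖h i‖₊) hpq
  choose c hc1 hc2 using fun i => exists_norm_le_one_mul_eq_norm (h i)
  refine ⟨fun i => c i * (g i : ℝ), ?_, ?_⟩
  · have h1 : ∑ x ∈ s, ((g x : ℝ)) ^ q ≤ 1 := by exact_mod_cast hg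
    refine (Finset.sum_le_sum fun x _ => ?_).trans h1
    refine Real.rpow_le_rpow (norm_nonneg _) ?_ hpq.symm.nonneg
    rw [norm_mul, Complex.norm_real, Real.norm_of_nonneg (NNReal.coe_nonneg _)]
    exact mul_le_of_le_one_left (g x).2 (hc1 x)
  · have h2 : ∑ x ∈ s, ‖h x‖ * (g x : ℝ) = (∑ x ∈ s, ‖h x‖ ^ p) ^ (1 / p) := by
      simpa using congrArg NNReal.toReal hg'
    rw [← h2]
    push_cast
    refine Finset.sum_congr rfl fun x _ => ?_
    rw [← hc2 x]; ring

variable {ι : Type*} {p : ℝ≥0∞} {q B : ℝ} {K : ι → ι → ℂ}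

theorem sum_norm_rpow_le (hp : 0 < p.toReal) (f : lp (fun _ : ι => ℂ) p) (s : Finset ι) :
    (∑ y ∈ s, ‖f y‖ ^ p.toReal) ^ (1 / p.toReal) ≤ ‖f‖ := by
  rw [one_div]
  exact (Real.rpow_inv_le_iff_of_pos (Finset.sum_nonneg fun _ _ => by positivity)
    (lp.norm_nonneg' f) hp).2
    (lp.sum_rpow_le_norm_rpow hp f s)

/-- A kernel whose pairings over finite sets are bounded has rows in the dual space. -/
theorem summable_norm_mul_of_pairing (hpq : p.toReal.HolderConjugate q) (hB : 0 ≤ B)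
    (hK : ∀ (F : Finset ι) (f g : ι → ℂ), ‖∑ x ∈ F, ∑ y ∈ F, g x * f y * K x y‖ ≤
      B * ((∑ y ∈ F, ‖f y‖ ^ p.toReal) ^ (1 / p.toReal) * (∑ x ∈ F, ‖g x‖ ^ q) ^ (1 / q)))
    (f : lp (fun _ : ι => ℂ) p) (x : ι) : Summable fun y => ‖f y * K x y‖ := by
  classical
  have hp0 := hpq.pos
  have hq0 := hpq.symm.pos
  choose c hc1 hc2 using fun y => exists_norm_le_one_mul_eq_norm (f y * K x y)
  refine summable_of_sum_le (c := B * ‖f‖) (fun _ => norm_nonneg _) fun s => ?_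
  have h1 := hK (insert x s) (fun y => if y ∈ s then c y * f y else 0) (Pi.single x 1)
  have h2 : ∑ x' ∈ insert x s, ∑ y ∈ insert x s, (Pi.single x 1 : ι → ℂ) x' *
      (if y ∈ s then c y * f y else 0) * K x' y = ((∑ y ∈ s, ‖f y * K x y‖ : ℝ) : ℂ) := by
    rw [Finset.sum_eq_single x]
    · rw [← Finset.sum_subset (Finset.subset_insert x s)]
      · push_cast
        refine Finset.sum_congr rfl fun y hy => ?_
        rw [if_pos hy, Pi.single_eq_same, ← hc2 y]; ring
      · intro y _ hy
        rw [if_neg hy]; simp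
    · intro x' _ hx'
      simp [Pi.single_eq_of_ne hx']
    · intro h
      exact absurd (Finset.mem_insert_self x s) h
  have h3 : ∑ x' ∈ insert x s, ‖(Pi.single x 1 : ι → ℂ) x'‖ ^ q = 1 := by
    rw [Finset.sum_eq_single x]
    · simp
    · intro x' _ hx'
      simp [Pi.single_eq_of_ne hx', hq0.ne']
    · intro h
      exact absurd (Finset.mem_insert_self x s) h
  rw [h2, h3, Real.one_rpow, mul_one, Complex.norm_real,
    Real.norm_of_nonneg (Finset.sum_nonneg fun _ _ => norm_nonneg _)] at h1
  refine h1.trans (mul_le_mul_of_nonneg_left ?_ hB)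
  refine le_trans ?_ (sum_norm_rpow_le hp0 f (insert x s))
  gcongr with y hy
  split_ifs
  · rw [norm_mul]
    exact mul_le_of_le_one_left (norm_nonneg _) (hc1 y)
  · simp

/-- By duality, a kernel whose pairings over finite sets are bounded defines an operator on `ℓ^p`
by summation. -/
theorem exists_lp_operator [Fact (1 ≤ p)] (hpq : p.toReal.HolderConjugate q) (hB : 0 ≤ B)
    (hK : ∀ (F : Finset ι) (f g : ι → ℂ), ‖∑ x ∈ F, ∑ y ∈ F, g x * f y * K x y‖ ≤
      B * ((∑ y ∈ F, ‖f y‖ ^ p.toReal) ^ (1 / p.toReal) * (∑ x ∈ F, ‖g x‖ ^ q) ^ (1 / q))) :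
    ∃ T : lp (fun _ : ι => ℂ) p →L[ℂ] lp (fun _ : ι => ℂ) p,
      (∀ f x, T f x = ∑' y, f y * K x y) ∧ ∀ f, ‖T f‖ ≤ B * ‖f‖ := by
  classical
  have hp0 := hpq.pos
  have hq0 := hpq.symm.pos
  have hsum : ∀ (f : lp (fun _ : ι => ℂ) p) x, Summable fun y => f y * K x y := fun f x =>
    (summable_norm_mul_of_pairing hpq hB hK f x).of_norm
  have hle : ∀ (f : lp (fun _ : ι => ℂ) p) (s : Finset ι),
      ∑ x ∈ s, ‖∑' y, f y * K x y‖ ^ p.toReal ≤ (B * ‖f‖) ^ p.toReal := by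
    intro f s
    obtain ⟨g, hg1, hg2⟩ := exists_dual_vector s hpq fun x => ∑' y, f y * K x y
    have hlim : Filter.Tendsto (fun F : Finset ι => ∑ x ∈ s, g x * ∑ y ∈ F, f y * K x y)
        Filter.atTop (nhds (∑ x ∈ s, g x * ∑' y, f y * K x y)) :=
      tendsto_finsetSum _ fun x _ => ((hsum f x).hasSum).const_mul _
    have hF : ∀ᶠ F : Finset ι in Filter.atTop,
        ‖∑ x ∈ s, g x * ∑ y ∈ F, f y * K x y‖ ≤ B * ‖f‖ := by
      filter_upwards [Filter.eventually_ge_atTop s] with F hsF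
      have hsF' : s ⊆ F := hsF
      have h1 := hK F f fun x => if x ∈ s then g x else 0
      have h2 : ∑ x ∈ F, ∑ y ∈ F, (if x ∈ s then g x else 0) * f y * K x y =
          ∑ x ∈ s, g x * ∑ y ∈ F, f y * K x y := by
        rw [← Finset.sum_subset hsF']
        · refine Finset.sum_congr rfl fun x hx => ?_
          simp only [if_pos hx, Finset.mul_sum, mul_assoc]
        · intro x _ hx
          simp [hx]
      have h3 : ∑ x ∈ F, ‖if x ∈ s then g x else 0‖ ^ q ≤ 1 := by
        rw [← Finset.sum_subset hsF']
        · refine le_trans (Finset.sum_le_sum fun x hx => ?_) hg1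
          rw [if_pos hx]
        · intro x _ hx
          simp [hx, hq0.ne']
      rw [h2] at h1
      refine h1.trans (mul_le_mul_of_nonneg_left ?_ hB)
      calc _ ≤ ‖f‖ * 1 := by
            refine mul_le_mul (sum_norm_rpow_le hp0 f F)
              (Real.rpow_le_one (Finset.sum_nonneg fun _ _ => by positivity) h3 (by positivity))
              (Real.rpow_nonneg (Finset.sum_nonneg fun _ _ => by positivity) _) (norm_nonneg _)
        _ = ‖f‖ := mul_one _
    have h4 := le_of_tendsto hlim.norm hF
    have h5 : 0 ≤ ∑ x ∈ s, ‖∑' y, f y * K x y‖ ^ p.toReal :=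
      Finset.sum_nonneg fun _ _ => by positivity
    rw [hg2, Complex.norm_real, Real.norm_of_nonneg (by positivity), one_div] at h4
    exact (Real.rpow_inv_le_iff_of_pos h5 (mul_nonneg hB (norm_nonneg _)) hp0).1 h4
  let L : lp (fun _ : ι => ℂ) p →ₗ[ℂ] lp (fun _ : ι => ℂ) p :=
    { toFun := fun f => ⟨fun x => ∑' y, f y * K x y, memℓp_gen' (hle f)⟩
      map_add' := fun f g => by
        ext x
        change ∑' y, (f + g) y * K x y = (∑' y, f y * K x y) + ∑' y, g y * K x y
        rw [← (hsum f x).tsum_add (hsum g x)]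
        simp only [lp.coeFn_add, Pi.add_apply, add_mul]
      map_smul' := fun a f => by
        ext x
        change ∑' y, (a • f) y * K x y = a * ∑' y, f y * K x y
        rw [← tsum_mul_left]
        simp only [lp.coeFn_smul, Pi.smul_apply, smul_eq_mul, mul_assoc] }
  have hL : ∀ f, ‖L f‖ ≤ B * ‖f‖ := fun f =>
    lp.norm_le_of_forall_sum_le hp0 (mul_nonneg hB (norm_nonneg _)) (hle f)
  exact ⟨L.mkContinuous B hL, fun f x => rfl, hL⟩

end Operator

/-! ### The inverse transform on the torus -/

section Torus

variable {d : ℕ}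

theorem unitCube_eq_cubeAt :
    {ξ : EuclideanSpace ℝ (Fin d) | ∀ i, ξ i ∈ Set.Ico (0 : ℝ) 1} = cubeAt 0 := by
  ext ξ
  simp [cubeAt, Int.floor_eq_zero_iff]

theorem iUnion_cubeAt : (⋃ y : Fin d → ℤ, cubeAt y) = Set.univ :=
  Set.eq_univ_of_forall fun t => Set.mem_iUnion.2 ⟨fun i => ⌊t i⌋, fun _ => rfl⟩

theorem setIntegral_cubeAt_comp_sub {E : Type*} [NormedAddCommGroup E] [NormedSpace ℝ E]
    (g : EuclideanSpace ℝ (Fin d) → E) (n : Fin d → ℤ) :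
    ∫ ξ in cubeAt 0, g (ξ - latticePoint n) = ∫ ξ in cubeAt (-n), g ξ := by
  have h : (fun ξ : EuclideanSpace ℝ (Fin d) => ξ - latticePoint n) ⁻¹' cubeAt (-n) =
      cubeAt 0 := by
    ext ξ
    simp only [cubeAt, latticePoint, Set.mem_preimage, Set.mem_ofPred_eq, PiLp.sub_apply,
      Int.floor_sub_intCast, Pi.neg_apply, Pi.zero_apply]
    exact forall_congr' fun i => by omega
  rw [← h]
  exact (measurePreserving_sub_right volume (latticePoint n)).setIntegral_preimage_emb
    (MeasurableEquiv.subRight (latticePoint n)).measurableEmbedding g _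

/-- Unfolding: the integral over a fundamental domain of the periodization. -/
theorem integral_unitCube_tsum {g : EuclideanSpace ℝ (Fin d) → ℂ} (hg : Integrable g) :
    ∫ ξ in cubeAt (0 : Fin d → ℤ), ∑' n : Fin d → ℤ, g (ξ - latticePoint n) = ∫ ξ, g ξ := by
  have hdisj : Pairwise (Function.onFun Disjoint (cubeAt (d := d))) := fun y y' h =>
    disjoint_cubeAt Set.univ (Set.mem_univ y) (Set.mem_univ y') h
  have h1 : HasSum (fun y : Fin d → ℤ => ∫ ξ in cubeAt y, g ξ) (∫ ξ, g ξ) := by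
    have := hasSum_integral_iUnion (fun y => measurableSet_cubeAt y) hdisj hg.integrableOn
    rwa [iUnion_cubeAt, setIntegral_univ] at this
  have h2 : HasSum (fun y : Fin d → ℤ => ∫ ξ in cubeAt y, ‖g ξ‖) (∫ ξ, ‖g ξ‖) := by
    have := hasSum_integral_iUnion (fun y => measurableSet_cubeAt y) hdisj hg.norm.integrableOn
    rwa [iUnion_cubeAt, setIntegral_univ] at this
  rw [← integral_tsum_of_summable_integral_norm
    (fun n => (hg.comp_sub_right (latticePoint n)).integrableOn)]
  · simp only [setIntegral_cubeAt_comp_sub]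
    exact ((Equiv.neg (Fin d → ℤ)).tsum_eq fun y => ∫ ξ in cubeAt y, g ξ).trans h1.tsum_eq
  · have h3 : ∀ n : Fin d → ℤ, ∫ ξ in cubeAt 0, ‖g (ξ - latticePoint n)‖ =
        ∫ ξ in cubeAt (-n), ‖g ξ‖ := fun n => setIntegral_cubeAt_comp_sub (fun ξ => ‖g ξ‖) n
    simp only [h3]
    exact (Equiv.neg (Fin d → ℤ)).summable_iff.2 h2.summable

theorem phase_add_left (ξ u : EuclideanSpace ℝ (Fin d)) (z : Fin d → ℤ) :
    phase (ξ + u) z = phase ξ z + phase u z := by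
  simp [phase, add_mul, Finset.sum_add_distrib]

theorem ch_phase_sub_latticePoint (ξ : EuclideanSpace ℝ (Fin d)) (n z : Fin d → ℤ) :
    ch (phase (ξ - latticePoint n) z) = ch (phase ξ z) := by
  have h1 : phase (latticePoint n) z = ((∑ j, n j * z j : ℤ) : ℝ) := by
    simp [phase, latticePoint]
  have h2 := phase_add_left (ξ - latticePoint n) (latticePoint n) z
  rw [sub_add_cancel] at h2
  rw [h2, ch_add, h1, ch_intCast, mul_one]

theorem integrable_mul_ch {g : EuclideanSpace ℝ (Fin d) → ℂ} (hg : Integrable g)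
    (z : Fin d → ℤ) : Integrable fun ξ => g ξ * ch (phase ξ z) :=
  hg.mul_bdd (c := 1) (continuous_ch_phase z).aestronglyMeasurable
    (Filter.Eventually.of_forall fun _ => (norm_ch _).le)

/-- Translations of the frequency become modulations of the kernel. -/
theorem integral_sum_translates_mul_ch {g : EuclideanSpace ℝ (Fin d) → ℂ} (hg : Integrable g)
    (U : Finset (EuclideanSpace ℝ (Fin d))) (z : Fin d → ℤ) :
    ∫ ξ, (∑ u ∈ U, g (ξ - u)) * ch (phase ξ z) =
      (∑ u ∈ U, ch (phase u z)) * ∫ ξ, g ξ * ch (phase ξ z) := by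
  simp only [Finset.sum_mul]
  rw [integral_finsetSum _ fun u _ => integrable_mul_ch (hg.comp_sub_right u) z]
  refine Finset.sum_congr rfl fun u _ => ?_
  rw [← integral_add_right_eq_self _ u, ← integral_const_mul]
  congr 1
  ext ξ
  rw [add_sub_cancel_right, phase_add_left, ch_add]
  ring

/-- The cutoff is supported in a translate of the unit cube, so its periodization has at most one
nonzero term at each point. -/
theorem summable_translates_mul_cutoff {η : EuclideanSpace ℝ (Fin d) → ℝ} (hη : IsCutoff η)
    (Θ : EuclideanSpace ℝ (Fin d) → ℂ) {ε : Fin d → ℝ} (hε : ∀ i, 0 < ε i ∧ ε i ≤ 1 / 2)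
    (ξ : EuclideanSpace ℝ (Fin d)) :
    Summable fun n : Fin d → ℤ =>
      Θ (ξ - latticePoint n) * (η (dil ε⁻¹ (ξ - latticePoint n)) : ℂ) := by
  refine summable_of_hasFiniteSupport (Set.Subsingleton.finite ?_)
  have hlt : ∀ n : Fin d → ℤ,
      Θ (ξ - latticePoint n) * (η (dil ε⁻¹ (ξ - latticePoint n)) : ℂ) ≠ 0 →
      ∀ i, |ξ i - n i| < 1 / 2 := by
    intro n hn i
    by_contra hge
    refine hn ?_
    have h1 := abs_apply_le_norm (ξ - latticePoint n) i
    have h2 : (ξ - latticePoint n) i = ξ i - n i := rfl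
    rw [h2] at h1
    rw [dil_inv_eq_zero hη.eq_zero hε (by norm_num)
      (by linarith [one_div_eight_mul_le d, not_lt.1 hge])]
    simp
  intro n hn m hm
  ext i
  have h1 := abs_lt.1 (hlt n hn i)
  have h2 := abs_lt.1 (hlt m hm i)
  have h3 : (n i : ℝ) < m i + 1 := by linarith
  have h4 : (m i : ℝ) < n i + 1 := by linarith
  have h5 : n i < m i + 1 := by exact_mod_cast h3
  have h6 : m i < n i + 1 := by exact_mod_cast h4
  omega

/-- On `ℓ¹` the operator is convolution with `torusKernel`, by unfolding. -/
theorem torusFourierInv_periodicMultiplier_mul {η : EuclideanSpace ℝ (Fin d) → ℝ}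
    (hη : IsCutoff η) (ρ : ℝ) (N : ℕ) {Θ : EuclideanSpace ℝ (Fin d) → ℂ} {ε : Fin d → ℝ}
    (hε : ∀ i, 0 < ε i ∧ ε i ≤ 1 / 2) (hint : Integrable fun ξ => Θ ξ * (η (dil ε⁻¹ ξ) : ℂ))
    {f : (Fin d → ℤ) → ℂ} (hf : Summable fun y => ‖f y‖) (x : Fin d → ℤ) :
    torusFourierInv (fun ξ => periodicMultiplier ρ N Θ η ε ξ * discreteFourier f ξ) x =
      ∑' y, f y * torusKernel ρ N Θ η ε (y - x) := by
  set G : EuclideanSpace ℝ (Fin d) → ℂ := fun ξ => Θ ξ * (η (dil ε⁻¹ ξ) : ℂ) with hG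
  set U := (finite_specialRationals d ρ N).toFinset with hU
  set H : EuclideanSpace ℝ (Fin d) → ℂ := fun ξ => ∑ u ∈ U, G (ξ - u) with hH
  set W : EuclideanSpace ℝ (Fin d) → ℂ := fun ξ => ∑' y, f y * ch (phase ξ (y - x)) with hW
  have hHint : Integrable H := integrable_finsetSum _ fun u _ => hint.comp_sub_right u
  have hbd : ∀ y ξ, ‖f y * ch (phase ξ (y - x))‖ ≤ ‖f y‖ := fun y ξ => by
    rw [norm_mul, norm_ch, mul_one]
  have hWcont : Continuous W := continuous_tsum
    (fun y => continuous_const.mul (continuous_ch_phase _)) hf hbd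
  have hWbd : ∀ ξ, ‖W ξ‖ ≤ ∑' y, ‖f y‖ := fun ξ => tsum_of_norm_bounded hf.hasSum fun y => hbd y ξ
  have hHW : Integrable fun ξ => H ξ * W ξ := hHint.mul_bdd hWcont.aestronglyMeasurable
    (Filter.Eventually.of_forall hWbd)
  have hWper : ∀ ξ n, W (ξ - latticePoint n) = W ξ := fun ξ n => by
    simp only [hW, ch_phase_sub_latticePoint]
  have hWeq : ∀ ξ, W ξ = discreteFourier f ξ * ch (-phase ξ x) := by
    intro ξ
    simp only [hW, discreteFourier]
    rw [← tsum_mul_right]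
    refine tsum_congr fun y => ?_
    rw [ch_phase_sub]
    change f y * (_ * ch (phase ξ y)) = f y * ch (phase ξ y) * _
    ring
  have hper : ∀ ξ, periodicMultiplier ρ N Θ η ε ξ = ∑' n : Fin d → ℤ, H (ξ - latticePoint n) := by
    intro ξ
    simp only [hH]
    rw [Summable.tsum_finsetSum]
    · refine Finset.sum_congr rfl fun u _ => tsum_congr fun n => ?_
      rw [sub_right_comm]
      rfl
    · intro u _
      simp only [sub_right_comm]
      exact summable_translates_mul_cutoff hη Θ hε _
  have hleft : torusFourierInv
      (fun ξ => periodicMultiplier ρ N Θ η ε ξ * discreteFourier f ξ) x = ∫ ξ, H ξ * W ξ := by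
    rw [← integral_unitCube_tsum hHW, torusFourierInv, unitCube_eq_cubeAt]
    congr 1
    ext ξ
    simp only [hWper]
    rw [tsum_mul_right, ← hper, hWeq, ← mul_assoc]
    congr 1
    rw [ch, phase]
    congr 1
    push_cast
    ring
  have hker : ∀ z, torusKernel ρ N Θ η ε z = ∫ ξ, H ξ * ch (phase ξ z) := fun z =>
    (integral_sum_translates_mul_ch hint U z).symm
  rw [hleft]
  simp only [hW, ← tsum_mul_left, hker]
  rw [← integral_tsum_of_summable_integral_norm]
  · refine tsum_congr fun y => ?_
    rw [← integral_const_mul]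
    congr 1
    ext ξ
    ring
  · intro y
    exact ((integrable_mul_ch hHint (y - x)).const_mul (f y)).congr
      (Filter.Eventually.of_forall fun ξ => by ring)
  · have h1 : ∀ y, ∫ ξ, ‖H ξ * (f y * ch (phase ξ (y - x)))‖ = ‖f y‖ * ∫ ξ, ‖H ξ‖ := by
      intro y
      rw [← integral_const_mul]
      congr 1
      ext ξ
      rw [norm_mul, norm_mul, norm_ch]; ring
    simp only [h1]
    exact hf.mul_right _

end Torus

end IonescuWainger

/-- The operator `f ↦ ℱ⁻¹(Δ_N f̂)`, defined by this formula on `ℓ¹(ℤ^d)` (which is contained and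
dense in `ℓ^p(ℤ^d)`), extends to a bounded operator `T` on `ℓ^p(ℤ^d)`, with norm at most
`C A_p log N`. -/
theorem mainTheorem4 (d : ℕ) (hd : 1 ≤ d)
    (η : EuclideanSpace ℝ (Fin d) → ℝ) (hη : IonescuWainger.IsCutoff η)
    (ρ : ℝ) (hρ : 0 < ρ) (p : ℝ≥0∞) [Fact (1 ≤ p)] (hp1 : 1 < p) (hp : p < ⊤) :
    ∃ C : ℝ, 0 < C ∧
      ∀ (Θ : EuclideanSpace ℝ (Fin d) → ℂ) (A : ℝ≥0∞ → ℝ),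
        AEStronglyMeasurable Θ volume →
        (∀ s : ℝ≥0∞, 1 < s → s < ⊤ → 0 < A s ∧ IonescuWainger.IsMultiplierBound Θ s (A s)) →
        ∀ (N : ℕ), 2 ≤ N →
        ∀ (ε : Fin d → ℝ), (∀ i, 0 < ε i ∧ ε i ≤ Real.exp (-(N : ℝ) ^ (2 * ρ))) →
          ∃ T : lp (fun _ : Fin d → ℤ => ℂ) p →L[ℂ] lp (fun _ : Fin d → ℤ => ℂ) p,
            (∀ f : lp (fun _ : Fin d → ℤ => ℂ) p, Summable (fun x => ‖f x‖) →
              ∀ x, T f x = IonescuWainger.torusFourierInv (fun ξ =>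
                IonescuWainger.periodicMultiplier ρ N Θ η ε ξ *
                  IonescuWainger.discreteFourier f ξ) x) ∧
            ∀ f : lp (fun _ : Fin d → ℤ => ℂ) p, ‖T f‖ ≤ C * A p * Real.log N * ‖f‖ := by
  open IonescuWainger in
  have hp1' : 1 < p.toReal := by
    simpa using (ENNReal.toReal_lt_toReal ENNReal.one_ne_top hp.ne).2 hp1
  have hpq : p.toReal.HolderConjugate p.toReal.conjExponent :=
    Real.HolderConjugate.conjExponent hp1'
  have hpq' : p.toReal.HolderConjugate (ENNReal.ofReal p.toReal.conjExponent).toReal := by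
    rwa [ENNReal.toReal_ofReal hpq.symm.nonneg]
  obtain ⟨C, hC0, hC⟩ := exists_torusKernel_bound hη hρ hpq'
  have hlog2 : 0 < Real.log 2 := Real.log_pos one_lt_two
  -- The operators are bounded uniformly in `N`; the factor `log N ≥ log 2` is not needed.
  refine ⟨(C + 1) / Real.log 2, by positivity, ?_⟩
  intro Θ A _ hA N hN ε hε
  obtain ⟨hA0, hAp⟩ := hA p hp1 hp
  obtain ⟨hint, hpair⟩ := hC Θ (A p) hA0.le hAp N hN ε hε
  have hε2 : ∀ i, 0 < ε i ∧ ε i ≤ 1 / 2 := fun i =>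
    ⟨(hε i).1, (hε i).2.trans (exp_neg_rpow_le_half (by omega) (by positivity))⟩
  obtain ⟨T, hT, hTle⟩ := exists_lp_operator (K := fun x y => torusKernel ρ N Θ η ε (y - x)) hpq'
    (mul_nonneg hC0 hA0.le) hpair
  refine ⟨T, fun f hf x => ?_, fun f => ?_⟩
  · rw [hT, torusFourierInv_periodicMultiplier_mul hη ρ N hε2 hint hf]
  · refine (hTle f).trans (mul_le_mul_of_nonneg_right ?_ (norm_nonneg _))
    have hlogN : Real.log 2 ≤ Real.log N :=
      Real.log_le_log two_pos (by exact_mod_cast hN)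
    calc C * A p ≤ (C + 1) * A p := by gcongr; linarith
      _ = (C + 1) / Real.log 2 * A p * Real.log 2 := by field_simp
      _ ≤ _ := by gcongr
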